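/- Let $(M,g_0)$ be a smooth Riemannian manifold (without boundary, second countable, not necessarily complete or compact) of dimension $n\ge 3$ with volume measure $\mu$ normalized by $\mu(M)=1$, scalar curvature $S_0$ and conformal Laplacian $L_0=S_0-\frac{4(n-1)}{n-2}\Delta_0$. Let $T>0$ and let $g(t)=u(t)^{\frac{4}{n-2}}g_0$, $t\in[0,T]$, be a normalized Yamabe flow with $u(0)=1$: the function $u>0$ is continuous on $[0,T]\times M$, its spatial derivative exists and is continuous on $[0,T]\times M$, and on $(0,T)\times M$ $$\partial_t\big(u^{\frac{n+2}{n-2}}\big)=\tfrac{n+2}{4}\big(\rho\,u^{\frac{n+2}{n-2}}-L_0u\big),\qquad L_0u=S\,u^{\frac{n+2}{n-2}},$$ where $S=S(t)$ is the scalar curvature of $g(t)$, given by the second identity in the weak sense on $M$ for every $t\in[0,T]$, and $\rho(t)=\mathrm{Vol}_g(M)^{-1}\int_M S\,d\mathrm{Vol}_g$. Write $H^1(M,g)$ for the space of $v\in L^2(M,d\mathrm{Vol}_g)$ with weak gradient in $L^2(M,d\mathrm{Vol}_g)$, and $H^1(M)=H^1(M,g_0)$. Assume that * $S\in C^0([0,T],H^1(M,g))\cap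 C^1((0,T),H^1(M,g))$; * $C_c^\infty(M)$ is dense in $H^1(M)$; * $H^1(M)=H^1(M,g(t))$, with norms that are equivalent uniformly in $t\in[0,T]$; * the Yamabe constant $$Y(M,g_0)=\inf_{v\in H^1(M)\setminus\{0\}}\frac{\int_M \frac{4(n-1)}{n-2}|\nabla v|^2+S_0v^2\,d\mu}{\|v\|^2_{L^{2n/(n-2)}(M)}}$$ is positive (the infimum being over those $v$ for which $S_0v^2$ is integrable). Write $S_-=-\min\{S,0\}$ and $(S_0)_-=-\min\{S_0,0\}$. Then for all $2\le p\le\infty$ and all $t\in[0,T]$ $$\|S_-(t)\|_{L^p(M,g(t))}\le e^{\frac{t\,n\,\rho(0)}{2p}}\,\|(S_0)_-\|_{L^p(M,g_0)},$$ where the exponential factor is $1$ for $p=\infty$ and the right-hand side is $+\infty$ if $(S_0)_-\notin L^p$. In particular, if $(S_0)_-\in L^\infty(M)$, then $S_-(t)\in L^\infty(M)$ for all $t\in[0,T]$ with $\|S_-(t)\|_{L^\infty}\le\|(S_0)_-\|_{L^\infty}$. Moreover, if $S_0\ge0$ almost everywhere, then $S(t)\ge0$ almost everywhere on $M$ for every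 $t\in[0,T]$. -/

import Mathlib

open Set Filter Topology MeasureTheory
open scoped Manifold ContDiff ENNReal NNReal

noncomputable section

namespace YamabeFlow

/-- The model space `ℝⁿ` with its Euclidean norm. -/
abbrev Eucl (n : ℕ) := EuclideanSpace ℝ (Fin n)

section Geometry

variable {n : ℕ} {M : Type*} [TopologicalSpace M] [ChartedSpace (Eucl n) M]

/-- The `i`-th partial derivative of `f` at `y`. -/
def partialD {n : ℕ} (i : Fin n) (f : Eucl n → ℝ) (y : Eucl n) : ℝ :=
  fderiv ℝ f y (EuclideanSpace.single i 1)

variable (n M) in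
/-- A (not necessarily regular) field of bilinear forms on the tangent spaces of `M`. Smooth
Riemannian metrics and their conformal multiples are of this kind. -/
abbrev MetricField :=
  ∀ x : M, TangentSpace (𝓡 n) x →L[ℝ] TangentSpace (𝓡 n) x →L[ℝ] ℝ

/-- The inverse of the chart at `x₀`. -/
def param (x₀ : M) (y : Eucl n) : M := (chartAt (Eucl n) x₀).symm y

/-- The coordinate vector field `∂ᵢ` of the chart at `x₀`, at the point with coordinates `y`. -/
def coordVec (x₀ : M) (y : Eucl n) (i : Fin n) : TangentSpace (𝓡 n) (param x₀ y) :=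
  mfderiv (𝓡 n) (𝓡 n) (param x₀) y (EuclideanSpace.single i (1 : ℝ))

/-- The coefficient matrix `mᵢⱼ = m(∂ᵢ, ∂ⱼ)` of `m` in the chart at `x₀`. -/
def gram (m : MetricField n M) (x₀ : M) (y : Eucl n) : Matrix (Fin n) (Fin n) ℝ :=
  Matrix.of fun i j => m (param x₀ y) (coordVec x₀ y i) (coordVec x₀ y j)

/-! #### Scalar curvature in coordinates -/

/-- The Christoffel symbol `Γᵏᵢⱼ = ½ mᵏˡ (∂ᵢ mⱼₗ + ∂ⱼ mᵢₗ - ∂ₗ mᵢⱼ)`. -/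
def christoffel (m : MetricField n M) (x₀ : M) (k i j : Fin n) (y : Eucl n) : ℝ :=
  (1 / 2) * ∑ l, (gram m x₀ y)⁻¹ k l *
    (partialD i (fun z => gram m x₀ z j l) y + partialD j (fun z => gram m x₀ z i l) y
      - partialD l (fun z => gram m x₀ z i j) y)

/-- The Ricci tensor `Rⱼₖ = ∂ᵢ Γⁱⱼₖ - ∂ₖ Γⁱᵢⱼ + Γⁱᵢₗ Γˡⱼₖ - Γⁱₖₗ Γˡᵢⱼ`. -/
def ricci (m : MetricField n M) (x₀ : M) (j k : Fin n) (y : Eucl n) : ℝ :=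
  ∑ i, (partialD i (christoffel m x₀ i j k) y - partialD k (christoffel m x₀ i i j) y
    + ∑ l, (christoffel m x₀ i i l y * christoffel m x₀ l j k y
      - christoffel m x₀ i k l y * christoffel m x₀ l i j y))

/-- The scalar curvature `mʲᵏ Rⱼₖ`, evaluated at `x` in the chart at `x`. -/
def scalarCurvature (m : MetricField n M) (x : M) : ℝ :=
  ∑ j, ∑ k, (gram m x (chartAt (Eucl n) x x))⁻¹ j k * ricci m x j k (chartAt (Eucl n) x x)

/-! #### Weak gradients -/

/-- `X` is a weak gradient of `v` with respect to `m`: in every chart, `v` is locally integrable,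
the functions `m(X, ∂ᵢ)` are locally integrable, and they are the weak partial derivatives
of `v`. -/
def IsWeakGradient (m : MetricField n M) (v : M → ℝ) (X : ∀ x : M, TangentSpace (𝓡 n) x) :
    Prop :=
  ∀ x₀ : M,
    LocallyIntegrableOn (fun y => v (param x₀ y)) (chartAt (Eucl n) x₀).target volume ∧
    ∀ i : Fin n,
      LocallyIntegrableOn (fun y => m (param x₀ y) (X (param x₀ y)) (coordVec x₀ y i))
        (chartAt (Eucl n) x₀).target volume ∧
      ∀ η : Eucl n → ℝ, ContDiff ℝ ∞ η → HasCompactSupport η →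
        tsupport η ⊆ (chartAt (Eucl n) x₀).target →
        ∫ y, v (param x₀ y) * partialD i η y
          = - ∫ y, m (param x₀ y) (X (param x₀ y)) (coordVec x₀ y i) * η y

variable [MeasurableSpace M]

/-! #### Volume -/

/-- The volume measure `√det(mᵢⱼ) dy` of the domain of the chart at `x₀`, as a measure on `M`
carried by that domain. -/
def chartVolume (m : MetricField n M) (x₀ : M) : Measure M :=
  ((volume.restrict (chartAt (Eucl n) x₀).target).withDensity
    (fun y => ENNReal.ofReal (√(gram m x₀ y).det))).map (param x₀)

/-- The volume measure of `m`. The measures `chartVolume m x₀` agree on overlaps of chart domains;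
their least upper bound is the measure that restricts to each of them. -/
def vol (m : MetricField n M) : Measure M := ⨆ x₀ : M, chartVolume m x₀

/-! #### Sobolev space -/

/-- `∫ |∇v|² dVol`, which is `∞` if `v` has no weak gradient. (Weak gradients are unique almost
everywhere, so the infimum is over equal numbers.) -/
def dirichlet (m : MetricField n M) (v : M → ℝ) : ℝ≥0∞ :=
  ⨅ (X : ∀ x : M, TangentSpace (𝓡 n) x) (_ : IsWeakGradient m v X),
    ∫⁻ x, ENNReal.ofReal (m x (X x) (X x)) ∂(vol m)

/-- The norm of `H¹(M, m)`, which is `∞` exactly outside `H¹(M, m)`. -/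
def h1Norm (m : MetricField n M) (v : M → ℝ) : ℝ≥0∞ :=
  ((∫⁻ x, ENNReal.ofReal (v x ^ 2) ∂(vol m)) + dirichlet m v) ^ (1 / 2 : ℝ)

/-- `v ∈ H¹(M, m)`. -/
def MemH1 (m : MetricField n M) (v : M → ℝ) : Prop := h1Norm m v < ⊤

/-- Smooth compactly supported functions. -/
def IsTest (n : ℕ) {M : Type*} [TopologicalSpace M] [ChartedSpace (Eucl n) M] (ψ : M → ℝ) :
    Prop :=
  ContMDiff (𝓡 n) 𝓘(ℝ, ℝ) ∞ ψ ∧ HasCompactSupport ψ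

/-- `C_c^∞(M)` is dense in `H¹(M, m)`. -/
def TestDenseInH1 (m : MetricField n M) : Prop :=
  ∀ v : M → ℝ, MemH1 m v → ∀ ε : ℝ≥0∞, 0 < ε → ∃ ψ, IsTest n ψ ∧ h1Norm m (v - ψ) < ε

/-- `F ∈ C⁰(J, H¹(M, m))` for a family of metrics `m = m(t)`. -/
def ContInH1 (m : ℝ → MetricField n M) (J : Set ℝ) (F : ℝ → M → ℝ) : Prop :=
  ∀ t ∈ J, MemH1 (m t) (F t) ∧
    Tendsto (fun s => h1Norm (m t) (F s - F t)) (𝓝[J] t) (𝓝 0)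

/-- `F ∈ C¹(J, H¹(M, m))` for a family of metrics `m = m(t)` and an open interval `J`, with the
difference quotients converging in `H¹`. -/
def C1InH1 (m : ℝ → MetricField n M) (J : Set ℝ) (F : ℝ → M → ℝ) : Prop :=
  ContInH1 m J F ∧ ∃ F' : ℝ → M → ℝ, ContInH1 m J F' ∧
    ∀ t ∈ J, Tendsto (fun s => h1Norm (m t) ((s - t)⁻¹ • (F s - F t) - F' t)) (𝓝[≠] t) (𝓝 0)

/-! #### Yamabe constant and Yamabe flow -/

/-- The constant `4 (n - 1) / (n - 2)` of the conformal Laplacian. -/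
def confConst (n : ℕ) : ℝ := 4 * ((n : ℝ) - 1) / ((n : ℝ) - 2)

/-- The Yamabe constant of `m`: the infimum over `v ∈ H¹ \ {0}`, for which the numerator makes
sense, of `(∫ 4(n-1)/(n-2) |∇v|² + S v² dVol) / ‖v‖²` with the norm of `L^{2n/(n-2)}`. (A quotient
with infinite denominator is `0`.) -/
def yamabeConstant (m : MetricField n M) : EReal :=
  sInf {q : EReal | ∃ v : M → ℝ, MemH1 m v ∧ ¬ (v =ᵐ[vol m] 0) ∧
    Integrable (fun x => scalarCurvature m x * v x ^ 2) (vol m) ∧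
    q = (((confConst n * (dirichlet m v).toReal
        + ∫ x, scalarCurvature m x * v x ^ 2 ∂(vol m))
      / (eLpNorm v (ENNReal.ofReal (2 * n / ((n : ℝ) - 2))) (vol m)).toReal ^ 2 : ℝ) : EReal)}

/-- The conformal metric `w^{4/(n-2)} m`. -/
def conformal (m : MetricField n M) (w : M → ℝ) : MetricField n M :=
  fun x => (w x ^ (4 / ((n : ℝ) - 2))) • m x

/-- `σ` is the scalar curvature `w^{-(n+2)/(n-2)} L₀ w` of the metric `w^{4/(n-2)} m`, where
`L₀ = S₀ - 4(n-1)/(n-2) Δ₀` is the conformal Laplacian of `m` and `L₀ w` is taken in the weak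
sense. Note that `dψ(X)` is the product of the gradients of `ψ` and `w`. -/
def IsConformalScalarCurvature (m : MetricField n M) (w σ : M → ℝ) : Prop :=
  LocallyIntegrable (fun x => σ x * w x ^ (((n : ℝ) + 2) / ((n : ℝ) - 2))) (vol m) ∧
  LocallyIntegrable (fun x => scalarCurvature m x * w x) (vol m) ∧
  ∃ X : ∀ x : M, TangentSpace (𝓡 n) x, IsWeakGradient m w X ∧
    ∀ ψ : M → ℝ, IsTest n ψ →
      ∫ x, σ x * w x ^ (((n : ℝ) + 2) / ((n : ℝ) - 2)) * ψ x ∂(vol m)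
        = confConst n * (∫ x, (mfderiv (𝓡 n) 𝓘(ℝ, ℝ) ψ x (X x) : ℝ) ∂(vol m))
          + ∫ x, scalarCurvature m x * w x * ψ x ∂(vol m)

/-- The average `ρ` over `M` of the function `σ`, with respect to the volume of `m`. -/
def average (m : MetricField n M) (σ : M → ℝ) : ℝ :=
  ((vol m) univ).toReal⁻¹ * ∫ x, σ x ∂(vol m)

/-- `g(t) = u(t)^{4/(n-2)} g₀`, `t ∈ [0, T]`, is a normalized Yamabe flow starting at `g₀`, and
`S(t)` is the scalar curvature of `g(t)`: the function `u` is positive and continuous on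
`[0, T] × M`, its spatial derivative exists and is continuous on `[0, T] × M`, and
`∂ₜ (u^{(n+2)/(n-2)}) = (n+2)/4 (ρ u^{(n+2)/(n-2)} - L₀ u)`, `L₀ u = S u^{(n+2)/(n-2)}`,
where `L₀ u` is taken in the weak sense in space. -/
structure IsNormalizedYamabeFlow (g₀ : MetricField n M) (T : ℝ) (u S : ℝ → M → ℝ) : Prop where
  pos : ∀ t ∈ Icc 0 T, ∀ x, 0 < u t x
  initial : ∀ x, u 0 x = 1
  continuousOn : ContinuousOn (fun q : ℝ × M => u q.1 q.2) (Icc 0 T ×ˢ univ)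
  contMDiff : ∀ t ∈ Icc 0 T, ContMDiff (𝓡 n) 𝓘(ℝ, ℝ) 1 (u t)
  continuousOn_fderiv : ∀ x₀ : M,
    ContinuousOn (fun q : ℝ × Eucl n => fderiv ℝ (fun y => u q.1 (param x₀ y)) q.2)
      (Icc 0 T ×ˢ (chartAt (Eucl n) x₀).target)
  scalar : ∀ t ∈ Icc 0 T, IsConformalScalarCurvature g₀ (u t) (S t)
  flow : ∀ t ∈ Ioo 0 T, ∀ x,
    HasDerivAt (fun s => u s x ^ (((n : ℝ) + 2) / ((n : ℝ) - 2)))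
      (((n : ℝ) + 2) / 4 *
        (average (conformal g₀ (u t)) (S t) * u t x ^ (((n : ℝ) + 2) / ((n : ℝ) - 2))
          - S t x * u t x ^ (((n : ℝ) + 2) / ((n : ℝ) - 2)))) t

/-- The negative part `S₋ = - min(S, 0)`. -/
def negPart {M : Type*} (σ : M → ℝ) (x : M) : ℝ := - min (σ x) 0

end Geometry

end YamabeFlow

end

open Set Filter Topology MeasureTheory
open scoped Manifold ContDiff ENNReal NNReal

noncomputable section

namespace YamabeFlow

set_option linter.unusedSectionVars false

attribute [local instance] chartedSpaceSelf
-- Coordinate frames of a chart and the smoothness of their vector fields.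
section Charts

variable {n : ℕ} {M : Type*} [TopologicalSpace M] [ChartedSpace (Eucl n) M]

/-! Let `V = u^{2n/(n-2)}`, so that `dVol_g = V dμ` and `|∇φ|²_g dVol_g = u² |∇φ|² dμ`. Formally the
flow gives `∂ₜS = (n-1) Δ_g S + S (S - ρ)` and `∂ₜ dVol_g = (n/2) (ρ - S) dVol_g`. Fix a level `s ≥
0`, put `φ = (S₋ - s)₊` and `E(t) = ∫ φ² dVol_g`. In `E'` there is a good term `-2(n-1) ∫ |∇φ|²_g`
and there are cubic terms in `S`. The Yamabe functional is conformally covariant, so its positivity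
for `g₀` passes to `g(t)` and gives `(n-1) ∫ |∇φ|²_g ≥ -((n-2)/4) ∫ S φ²`. With exactly this
constant the cubic terms add up to something nonpositive, and `E' ≤ (n/2) ρ E` remains. Testing the
functional with the constant `1` gives `ρ ≥ 0`, and `ρ' = -((n-2)/2) ∫ (S - ρ)² dVol_g` makes `ρ`
nonincreasing. Hence `E(t) ≤ e^{nρ(0)t/2} E(0)` at every level
(`ConformalFlow.integral_negExcess_sq_le`).

All `Lᵖ` bounds follow from these quadratic ones. For `p > 2` the power `z^p` is a positive
superposition of the functions `(z - s)₊²`, so the growth factor is the same for every `p` and its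
`p`-th root is the claimed constant. For `p = ∞` one takes `s` to be the initial norm, so that `E(0)
= 0` (`eLpNorm_negPart_le`).

Three points need work on a manifold that may be incomplete and noncompact, with curvature that is
only a curve in `H¹`.

The conformal factor is bounded above and below. This is extracted from the equivalence of the
Sobolev norms by comparing them on `ψ cos(rf)` and `ψ sin(rf)` as `r → ∞`
(`le_of_forall_h1Norm_le`). Afterwards all norms may be taken with respect to `g₀`.

The evolution of `S` is only available weakly. It comes from differentiating the weak equation `L₀ u
= S u^{(n+2)/(n-2)}` in time, with the Laplacian moved to the test function
(`ConformalFlow.integral_deriv_mul_test`). Density of test functions extends it to bounded Sobolev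
functions (`ConformalFlow.integral_deriv_mul`). The same density replaces completeness, as it allows
the constant `1` as a test function.

The function `φ` is unbounded and `∫ φ S²` is not known to be finite. So `φ` is cut off at height
`2j`, with an error controlled by `∫ (S₋ - s - j)₊ S²`. The evolution inequality itself bounds this
integral by `∫ (S₋ - s - j)₊ |S'|` (`ConformalFlow.integrable_negExcess_mul_sq`), which is small for
large `j`, uniformly on compact time intervals inside `(0, T)`, by Dini's theorem. -/

lemma param_mem_source (x₀ : M) {y : Eucl n} (hy : y ∈ (chartAt (Eucl n) x₀).target) :
    param x₀ y ∈ (chartAt (Eucl n) x₀).source :=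
  (chartAt (Eucl n) x₀).map_target hy

lemma chart_param (x₀ : M) {y : Eucl n} (hy : y ∈ (chartAt (Eucl n) x₀).target) :
    chartAt (Eucl n) x₀ (param x₀ y) = y :=
  (chartAt (Eucl n) x₀).right_inv hy

lemma param_chart (x₀ : M) {x : M} (hx : x ∈ (chartAt (Eucl n) x₀).source) :
    param x₀ (chartAt (Eucl n) x₀ x) = x :=
  (chartAt (Eucl n) x₀).left_inv hx

lemma continuousOn_param (x₀ : M) :
    ContinuousOn (param x₀ : Eucl n → M) (chartAt (Eucl n) x₀).target :=
  (chartAt (Eucl n) x₀).continuousOn_symm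

variable [IsManifold (𝓡 n) ∞ M]

lemma contMDiffOn_param (x₀ : M) :
    ContMDiffOn (𝓡 n) (𝓡 n) ∞ (param x₀ : Eucl n → M) (chartAt (Eucl n) x₀).target :=
  contMDiffOn_chart_symm

lemma mdifferentiableAt_param (x₀ : M) {y : Eucl n} (hy : y ∈ (chartAt (Eucl n) x₀).target) :
    MDifferentiableAt (𝓡 n) (𝓡 n) (param x₀ : Eucl n → M) y :=
  mdifferentiableAt_atlas_symm (chart_mem_atlas _ x₀) hy

lemma mfderiv_param_bijective (x₀ : M) {y : Eucl n} (hy : y ∈ (chartAt (Eucl n) x₀).target) :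
    Function.Bijective (mfderiv (𝓡 n) (𝓡 n) (param x₀ : Eucl n → M) y) :=
  (mdifferentiable_chart (I := 𝓡 n) x₀).symm.mfderiv_bijective hy

/-- The coefficients of a tangent vector in the coordinate frame. -/
lemma exists_coordVec_sum (x₀ : M) {y : Eucl n} (hy : y ∈ (chartAt (Eucl n) x₀).target)
    (v : TangentSpace (𝓡 n) (param x₀ y)) :
    ∃ a : Fin n → ℝ, v = ∑ i, a i • coordVec x₀ y i := by
  obtain ⟨w, hw⟩ := (mfderiv_param_bijective x₀ hy).2 v
  let w' : Eucl n := w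
  refine ⟨fun i => w' i, ?_⟩
  have h : w' = ∑ i, w' i • EuclideanSpace.single i (1 : ℝ) := by
    have := (EuclideanSpace.basisFun (Fin n) ℝ).sum_repr w'
    simpa using this.symm
  rw [← hw]
  change mfderiv (𝓡 n) (𝓡 n) (param x₀ : Eucl n → M) y w' = _
  conv_lhs => rw [h]
  exact (map_sum (mfderiv (𝓡 n) (𝓡 n) (param x₀ : Eucl n → M) y) _ _).trans
    (Finset.sum_congr rfl fun i _ => map_smul _ _ _)

lemma coordVec_sum_eq_zero (x₀ : M) {y : Eucl n} (hy : y ∈ (chartAt (Eucl n) x₀).target)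
    (a : Fin n → ℝ) (h : ∑ i, a i • coordVec x₀ y i = 0) : a = 0 := by
  have h2 : mfderiv (𝓡 n) (𝓡 n) (param x₀ : Eucl n → M) y
      (∑ i, a i • EuclideanSpace.single i (1 : ℝ) : Eucl n) = 0 := by
    rw [← h]
    exact (map_sum (mfderiv (𝓡 n) (𝓡 n) (param x₀ : Eucl n → M) y) _ _).trans
      (Finset.sum_congr rfl fun i _ => map_smul _ _ _)
  have h3 : (∑ i, a i • EuclideanSpace.single i (1 : ℝ) : Eucl n) = 0 :=
    (mfderiv_param_bijective x₀ hy).1 (h2.trans (map_zero _).symm)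
  funext i
  have := congrArg (fun w : Eucl n => w i) h3
  simpa [Finset.sum_apply, PiLp.single_apply, Pi.single_apply] using this

/-- The chain rule in a chart. -/
lemma mfderiv_coordVec (x₀ : M) {y : Eucl n} (hy : y ∈ (chartAt (Eucl n) x₀).target)
    {f : M → ℝ} (hf : MDifferentiableAt (𝓡 n) 𝓘(ℝ, ℝ) f (param x₀ y)) (i : Fin n) :
    (mfderiv (𝓡 n) 𝓘(ℝ, ℝ) f (param x₀ y) (coordVec x₀ y i) : ℝ)
      = partialD i (fun z => f (param x₀ z)) y := by
  have h := mfderiv_comp y hf (mdifferentiableAt_param x₀ hy)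
  rw [mfderiv_eq_fderiv] at h
  unfold partialD
  change _ = fderiv ℝ (f ∘ param x₀) y _
  rw [h]; rfl

/-- A coordinate field is the tangent map of `param` applied to a constant section, so it inherits
smoothness from `param`. This is what makes the metric coefficients smooth. -/
lemma contMDiffOn_coordVec (x₀ : M) (i : Fin n) :
    ContMDiffOn (𝓡 n) ((𝓡 n).prod (𝓡 n)) ∞
      (fun y : Eucl n => Bundle.TotalSpace.mk' (Eucl n) (E := fun x : M => TangentSpace (𝓡 n) x)
        (param x₀ y) (coordVec x₀ y i)) (chartAt (Eucl n) x₀).target := by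
  have ho : IsOpen (chartAt (Eucl n) x₀).target := (chartAt (Eucl n) x₀).open_target
  have h1 := (contMDiffOn_param (n := n) x₀).contMDiffOn_tangentMapWithin (m := ∞) (by simp)
    ho.uniqueMDiffOn
  have h2 : ContMDiffOn (𝓡 n) ((𝓡 n).prod (𝓡 n)) ∞
      (fun y : Eucl n => Bundle.TotalSpace.mk' (Eucl n)
        (E := fun x : Eucl n => TangentSpace (𝓡 n) x) y
        (EuclideanSpace.single i (1 : ℝ))) (chartAt (Eucl n) x₀).target := by
    intro y hy
    exact (contMDiffWithinAt_vectorSpace_iff_contDiffWithinAt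
      (V := fun _ => EuclideanSpace.single i (1 : ℝ))).2 contDiffWithinAt_const
  have h3 := h1.comp h2 (fun y hy => hy)
  refine h3.congr ?_
  intro y hy
  simp only [Function.comp, tangentMapWithin, coordVec]
  rw [mfderivWithin_of_isOpen ho hy]

end Charts

/-! ### Linear algebra of the metric: coordinate formulas, Riesz representation, gradients. -/

section Metric

variable {n : ℕ} {M : Type*} [TopologicalSpace M] [ChartedSpace (Eucl n) M]
  [IsManifold (𝓡 n) ∞ M]
  (G : Bundle.ContMDiffRiemannianMetric (𝓡 n) ∞ (Eucl n) (fun x : M => TangentSpace (𝓡 n) x))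

lemma contDiffOn_gram (x₀ : M) (i j : Fin n) :
    ContDiffOn ℝ ∞ (fun y => gram G.inner x₀ y i j) (chartAt (Eucl n) x₀).target := by
  rw [← contMDiffOn_iff_contDiffOn]
  intro y hy
  have : ContMDiffWithinAt (𝓡 n) ((𝓡 n).prod 𝓘(ℝ)) ∞
      (fun y => Bundle.TotalSpace.mk' ℝ (E := Bundle.Trivial M ℝ) (param x₀ y)
        (G.inner (param x₀ y) (coordVec x₀ y i) (coordVec x₀ y j)))
      (chartAt (Eucl n) x₀).target y := by
    apply ContMDiffWithinAt.clm_bundle_apply₂ (F₁ := Eucl n) (F₂ := Eucl n)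
    · exact ContMDiffAt.comp_contMDiffWithinAt y G.contMDiff.contMDiffAt (contMDiffOn_param x₀ y hy)
    · exact contMDiffOn_coordVec x₀ i y hy
    · exact contMDiffOn_coordVec x₀ j y hy
  simp only [Bundle.contMDiffWithinAt_totalSpace] at this
  exact this.2

lemma inner_self_nonneg (x : M) (v : TangentSpace (𝓡 n) x) : 0 ≤ G.inner x v v := by
  by_cases h : v = 0
  · simp [h]
  · exact (G.pos x v h).le

lemma inner_self_eq_zero {x : M} {v : TangentSpace (𝓡 n) x} (h : G.inner x v v = 0) : v = 0 := by
  by_contra hv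
  exact absurd h (G.pos x v hv).ne'

lemma inner_sum_sum (x : M) {ι : Type*} [Fintype ι] (a b : ι → ℝ) (e : ι → TangentSpace (𝓡 n) x) :
    G.inner x (∑ i, a i • e i) (∑ j, b j • e j) = ∑ i, ∑ j, a i * b j * G.inner x (e i) (e j) := by
  simp only [map_sum, _root_.sum_apply, map_smul, _root_.smul_apply,
    smul_eq_mul, Finset.mul_sum]
  rw [Finset.sum_comm]
  exact Finset.sum_congr rfl fun i _ => Finset.sum_congr rfl fun j _ => by ring

lemma gram_posDef (x₀ : M) {y : Eucl n} (hy : y ∈ (chartAt (Eucl n) x₀).target) :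
    (gram G.inner x₀ y).PosDef := by
  refine Matrix.PosDef.of_dotProduct_mulVec_pos ?_ ?_
  · exact Matrix.IsHermitian.ext fun i j => G.symm _ _ _
  · intro a ha
    have h := G.pos (param x₀ y) (∑ i, a i • coordVec x₀ y i)
      (fun h => ha (coordVec_sum_eq_zero x₀ hy a h))
    rw [inner_sum_sum] at h
    refine h.trans_eq ?_
    simp only [dotProduct, Matrix.mulVec, gram, Matrix.of_apply, star_trivial, Pi.star_apply,
      Finset.mul_sum]
    refine Finset.sum_congr rfl fun i _ => Finset.sum_congr rfl fun j _ => by ring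

lemma gram_det_pos (x₀ : M) {y : Eucl n} (hy : y ∈ (chartAt (Eucl n) x₀).target) :
    0 < (gram G.inner x₀ y).det := (gram_posDef G x₀ hy).det_pos

/-- The inner product in coordinates, in terms of the covariant components. -/
lemma inner_eq_sum_inv_gram (x₀ : M) {y : Eucl n} (hy : y ∈ (chartAt (Eucl n) x₀).target)
    (v w : TangentSpace (𝓡 n) (param x₀ y)) :
    G.inner (param x₀ y) v w = ∑ i, ∑ j, (gram G.inner x₀ y)⁻¹ i j *
      G.inner (param x₀ y) v (coordVec x₀ y i) * G.inner (param x₀ y) w (coordVec x₀ y j) := by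
  obtain ⟨a, rfl⟩ := exists_coordVec_sum x₀ hy v
  obtain ⟨b, rfl⟩ := exists_coordVec_sum x₀ hy w
  set A := gram G.inner x₀ y with hA
  have hU : IsUnit A.det := (gram_det_pos G x₀ hy).ne'.isUnit
  have hs : ∀ i j, A i j = A j i := fun i j => G.symm _ _ _
  have hc : ∀ (c : Fin n → ℝ) i, G.inner (param x₀ y) (∑ k, c k • coordVec x₀ y k)
      (coordVec x₀ y i) = A.mulVec c i := by
    intro c i
    simp only [map_sum, _root_.sum_apply, map_smul, _root_.smul_apply,
      smul_eq_mul, Matrix.mulVec, dotProduct]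
    refine Finset.sum_congr rfl fun k _ => ?_
    rw [mul_comm, hs i k]; rfl
  simp only [hc]
  rw [inner_sum_sum]
  have h1 : ∀ i, ∑ j, A⁻¹ i j * A.mulVec a i * A.mulVec b j = A.mulVec a i * b i := by
    intro i
    have : A⁻¹.mulVec (A.mulVec b) = b := by
      rw [Matrix.mulVec_mulVec, Matrix.nonsing_inv_mul _ hU, Matrix.one_mulVec]
    rw [← congrFun this i]
    simp only [Matrix.mulVec, dotProduct]
    rw [Finset.mul_sum]
    refine Finset.sum_congr rfl fun j _ => by ring
  simp only [h1]
  rw [Finset.sum_comm]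
  refine Finset.sum_congr rfl fun i _ => ?_
  simp only [Matrix.mulVec, dotProduct, Finset.sum_mul]
  refine Finset.sum_congr rfl fun j _ => ?_
  rw [hs i j]
  change _ = A j i * a j * b i
  simp only [hA, gram, Matrix.of_apply]; ring

/-- Definiteness makes `v ↦ ⟨v, ·⟩` injective, and equal finite dimensions make it onto. -/
lemma exists_riesz (x : M) (φ : TangentSpace (𝓡 n) x →L[ℝ] ℝ) :
    ∃ v : TangentSpace (𝓡 n) x, ∀ w, G.inner x v w = φ w := by
  let L : Eucl n →ₗ[ℝ] (Module.Dual ℝ (Eucl n)) :=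
    { toFun := fun v => (G.inner x v).toLinearMap
      map_add' := fun v w => congrArg _ ((G.inner x).map_add v w)
      map_smul' := fun c v => congrArg _ ((G.inner x).map_smul c v) }
  have hinj : Function.Injective L := by
    rw [← LinearMap.ker_eq_bot, LinearMap.ker_eq_bot']
    intro v hv
    exact inner_self_eq_zero G (x := x) (show L v v = 0 by rw [hv]; rfl)
  have hsurj := (LinearMap.injective_iff_surjective_of_finrank_eq_finrank
    (Subspace.dual_finrank_eq (K := ℝ) (V := Eucl n)).symm).1 hinj
  obtain ⟨v, hv⟩ := hsurj φ.toLinearMap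
  exact ⟨v, fun w => LinearMap.congr_fun hv w⟩

/-- The gradient of a function. -/
def grad (f : M → ℝ) (x : M) : TangentSpace (𝓡 n) x :=
  (exists_riesz G x (mfderiv (𝓡 n) 𝓘(ℝ, ℝ) f x)).choose

lemma inner_grad (f : M → ℝ) (x : M) (w : TangentSpace (𝓡 n) x) :
    G.inner x (grad G f x) w = mfderiv (𝓡 n) 𝓘(ℝ, ℝ) f x w :=
  (exists_riesz G x (mfderiv (𝓡 n) 𝓘(ℝ, ℝ) f x)).choose_spec w

lemma ext_inner {x : M} {v w : TangentSpace (𝓡 n) x} (h : ∀ z, G.inner x v z = G.inner x w z) :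
    v = w := by
  have : G.inner x (v - w) (v - w) = 0 := by
    rw [map_sub (G.inner x)]
    exact sub_eq_zero.2 (h _)
  exact sub_eq_zero.1 (inner_self_eq_zero G this)

/-- The pointwise inner product of two vector fields. -/
def ip (X Y : ∀ x : M, TangentSpace (𝓡 n) x) (x : M) : ℝ := G.inner x (X x) (Y x)

end Metric

/-! ### The Riemannian volume measure and its behaviour under conformal change. -/

section Volume

variable {n : ℕ} {M : Type*} [TopologicalSpace M] [ChartedSpace (Eucl n) M]
  [IsManifold (𝓡 n) ∞ M]

/-- The transition map between two charts, on its domain. -/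
def transition (x₀ x₁ : M) (y : Eucl n) : Eucl n := chartAt (Eucl n) x₁ (param x₀ y)

/-- The overlap of two chart domains, in the first chart. -/
def overlap (n : ℕ) {M : Type*} [TopologicalSpace M] [ChartedSpace (Eucl n) M] (x₀ x₁ : M) :
    Set (Eucl n) :=
  (chartAt (Eucl n) x₀).target ∩ param x₀ ⁻¹' (chartAt (Eucl n) x₁).source

lemma isOpen_overlap (x₀ x₁ : M) : IsOpen (overlap n x₀ x₁) :=
  (continuousOn_param x₀).isOpen_inter_preimage (chartAt (Eucl n) x₀).open_target
    (chartAt (Eucl n) x₁).open_source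

lemma param_transition (x₀ x₁ : M) {y : Eucl n} (hy : y ∈ overlap n x₀ x₁) :
    param x₁ (transition x₀ x₁ y) = param x₀ y :=
  param_chart x₁ hy.2

lemma transition_mem_target (x₀ x₁ : M) {y : Eucl n} (hy : y ∈ overlap n x₀ x₁) :
    transition x₀ x₁ y ∈ (chartAt (Eucl n) x₁).target :=
  (chartAt (Eucl n) x₁).map_source hy.2

lemma differentiableAt_transition (x₀ x₁ : M) {y : Eucl n} (hy : y ∈ overlap n x₀ x₁) :
    DifferentiableAt ℝ (transition (n := n) x₀ x₁) y := by
  rw [← mdifferentiableAt_iff_differentiableAt]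
  exact (mdifferentiableAt_atlas (I := 𝓡 n) (chart_mem_atlas _ x₁) hy.2).comp y
    (mdifferentiableAt_param x₀ hy.1)

lemma injOn_transition (x₀ x₁ : M) : InjOn (transition (n := n) x₀ x₁) (overlap n x₀ x₁) := by
  intro y hy z hz h
  have h1 := congrArg (param x₁) h
  rw [param_transition x₀ x₁ hy, param_transition x₀ x₁ hz] at h1
  rw [← chart_param x₀ hy.1, ← chart_param x₀ hz.1, h1]

/-- The Jacobian matrix of the transition map. -/
def jac (x₀ x₁ : M) (y : Eucl n) : Matrix (Fin n) (Fin n) ℝ :=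
  Matrix.of fun k i => fderiv ℝ (transition (n := n) x₀ x₁) y (EuclideanSpace.single i 1) k

lemma det_jac (x₀ x₁ : M) (y : Eucl n) :
    (jac x₀ x₁ y).det = (fderiv ℝ (transition (n := n) x₀ x₁) y).det := by
  rw [ContinuousLinearMap.det,
    ← LinearMap.det_toMatrix (EuclideanSpace.basisFun (Fin n) ℝ).toBasis]
  congr 1

/-- The chain rule for `param x₁ ∘ transition x₀ x₁`, which agrees with `param x₀` near `y`. -/
lemma coordVec_transition (x₀ x₁ : M) {y : Eucl n} (hy : y ∈ overlap n x₀ x₁) (i : Fin n) :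
    (coordVec x₀ y i : Eucl n)
      = ∑ k, jac x₀ x₁ y k i • (coordVec x₁ (transition x₀ x₁ y) k : Eucl n) := by
  have h1 : HasMFDerivAt (𝓡 n) (𝓡 n) (param x₁ ∘ transition x₀ x₁) y
      ((mfderiv (𝓡 n) (𝓡 n) (param x₁ : Eucl n → M) (transition x₀ x₁ y)).comp
        (fderiv ℝ (transition (n := n) x₀ x₁) y)) :=
    HasMFDerivAt.comp y
      (mdifferentiableAt_param x₁ (transition_mem_target x₀ x₁ hy)).hasMFDerivAt
      (differentiableAt_transition x₀ x₁ hy).hasFDerivAt.hasMFDerivAt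
  have h2 : (param x₁ ∘ transition x₀ x₁ : Eucl n → M) =ᶠ[𝓝 y] param x₀ := by
    filter_upwards [(isOpen_overlap x₀ x₁).mem_nhds hy] with z hz
    exact param_transition x₀ x₁ hz
  have h3 := h2.symm.mfderiv_eq (I := 𝓡 n) (I' := 𝓡 n)
  have h4 : (coordVec x₀ y i : Eucl n)
      = mfderiv (𝓡 n) (𝓡 n) (param x₁ : Eucl n → M) (transition x₀ x₁ y)
        (fderiv ℝ (transition (n := n) x₀ x₁) y (EuclideanSpace.single i 1)) := by
    have h5 := h3.trans h1.mfderiv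
    exact congrArg (fun L : Eucl n →L[ℝ] Eucl n => L (EuclideanSpace.single i 1)) h5
  rw [h4]
  set w : Eucl n := fderiv ℝ (transition (n := n) x₀ x₁) y (EuclideanSpace.single i 1) with hw
  have h6 : w = ∑ k, w k • EuclideanSpace.single k (1 : ℝ) := by
    have := (EuclideanSpace.basisFun (Fin n) ℝ).sum_repr w
    simpa using this.symm
  let L : Eucl n →L[ℝ] Eucl n := mfderiv (𝓡 n) (𝓡 n) (param x₁ : Eucl n → M) (transition x₀ x₁ y)
  change L w = ∑ k, w k • L (EuclideanSpace.single k (1 : ℝ))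
  conv_lhs => rw [h6]
  simp only [map_sum, map_smul]

lemma bilin_sum_sum {E ι : Type*} [NormedAddCommGroup E] [NormedSpace ℝ E] [Fintype ι]
    (B : E →L[ℝ] E →L[ℝ] ℝ) (a b : ι → ℝ) (e : ι → E) :
    B (∑ i, a i • e i) (∑ j, b j • e j) = ∑ i, ∑ j, a i * B (e i) (e j) * b j := by
  simp only [map_sum, _root_.sum_apply, map_smul, _root_.smul_apply, smul_eq_mul]
  simp only [Finset.mul_sum]
  rw [Finset.sum_comm]
  exact Finset.sum_congr rfl fun i _ => Finset.sum_congr rfl fun j _ => by ring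

lemma gram_transition (m : MetricField n M) (x₀ x₁ : M) {y : Eucl n} (hy : y ∈ overlap n x₀ x₁) :
    gram m x₀ y
      = (jac x₀ x₁ y).transpose * gram m x₁ (transition x₀ x₁ y) * jac x₀ x₁ y := by
  ext i j
  let m' : M → Eucl n →L[ℝ] Eucl n →L[ℝ] ℝ := m
  change m' (param x₀ y) (coordVec x₀ y i : Eucl n) (coordVec x₀ y j : Eucl n) = _
  rw [coordVec_transition x₀ x₁ hy i, coordVec_transition x₀ x₁ hy j,
    ← param_transition x₀ x₁ hy]
  refine (bilin_sum_sum (m' (param x₁ (transition x₀ x₁ y))) _ _ _).trans ?_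
  simp only [Matrix.mul_apply, Matrix.transpose_apply, Finset.sum_mul]
  rw [Finset.sum_comm]
  rfl

/-- Gram matrices transform by congruence with the Jacobian matrix, so the root of the determinant
picks up exactly the factor `|det|` of the change of variables formula. -/
lemma sqrt_det_transition (m : MetricField n M) (x₀ x₁ : M) {y : Eucl n}
    (hy : y ∈ overlap n x₀ x₁) :
    ENNReal.ofReal √(gram m x₀ y).det
      = ENNReal.ofReal |(fderiv ℝ (transition (n := n) x₀ x₁) y).det|
        * ENNReal.ofReal √(gram m x₁ (transition x₀ x₁ y)).det := by
  rw [← ENNReal.ofReal_mul (abs_nonneg _), gram_transition m x₀ x₁ hy, Matrix.det_mul,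
    Matrix.det_mul, Matrix.det_transpose, ← det_jac, mul_right_comm, ← sq,
    Real.sqrt_mul (sq_nonneg _), Real.sqrt_sq_eq_abs]

variable [MeasurableSpace M] [BorelSpace M]

lemma measurableSet_target_inter (x₀ : M) {B : Set M} (hB : MeasurableSet B) :
    MeasurableSet ((chartAt (Eucl n) x₀).target ∩ param x₀ ⁻¹' B) := by
  have h1 : Measurable ((chartAt (Eucl n) x₀).target.domRestrict (param x₀)) :=
    (continuousOn_iff_continuous_domRestrict.1 (continuousOn_param x₀)).measurable
  have h2 := (chartAt (Eucl n) x₀).open_target.measurableSet.subtype_image (h1 hB)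
  convert h2 using 1
  ext y
  simp [and_comm]

lemma aemeasurable_param (x₀ : M) :
    AEMeasurable (param x₀) (volume.restrict (chartAt (Eucl n) x₀).target) := by
  have h1 : Measurable ((chartAt (Eucl n) x₀).target.domRestrict (param x₀)) :=
    (continuousOn_iff_continuous_domRestrict.1 (continuousOn_param x₀)).measurable
  exact (aemeasurable_restrict_iff_comap_subtype
    (chartAt (Eucl n) x₀).open_target.measurableSet).2 h1.aemeasurable

lemma chartVolume_apply (m : MetricField n M) (x₀ : M) {B : Set M} (hB : MeasurableSet B) :
    chartVolume m x₀ B = ∫⁻ y in (chartAt (Eucl n) x₀).target ∩ param x₀ ⁻¹' B,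
      ENNReal.ofReal (√(gram m x₀ y).det) := by
  unfold chartVolume
  rw [Measure.map_apply_of_aemeasurable
    ((aemeasurable_param x₀).mono_ac (withDensity_absolutelyContinuous _ _)) hB,
    withDensity_apply', Measure.restrict_restrict' (chartAt (Eucl n) x₀).open_target.measurableSet,
    inter_comm]

/-- Change of variables along the transition map. This is the compatibility that lets the chart
measures be glued. -/
lemma chartVolume_congr (m : MetricField n M) (x₀ x₁ : M) {B : Set M} (hB : MeasurableSet B)
    (h₀ : B ⊆ (chartAt (Eucl n) x₀).source) (h₁ : B ⊆ (chartAt (Eucl n) x₁).source) :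
    chartVolume m x₀ B = chartVolume m x₁ B := by
  rw [chartVolume_apply m x₀ hB, chartVolume_apply m x₁ hB]
  set A := (chartAt (Eucl n) x₀).target ∩ param x₀ ⁻¹' B with hA
  have hAo : A ⊆ overlap n x₀ x₁ := fun y hy => ⟨hy.1, h₁ hy.2⟩
  have himg : (chartAt (Eucl n) x₁).target ∩ param x₁ ⁻¹' B = transition x₀ x₁ '' A := by
    ext z
    constructor
    · rintro ⟨hz, hzB⟩
      refine ⟨chartAt (Eucl n) x₀ (param x₁ z),
        ⟨(chartAt (Eucl n) x₀).map_source (h₀ hzB), ?_⟩, ?_⟩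
      · rw [mem_preimage, param_chart x₀ (h₀ hzB)]; exact hzB
      · rw [transition, param_chart x₀ (h₀ hzB), chart_param x₁ hz]
    · rintro ⟨y, hy, rfl⟩
      refine ⟨transition_mem_target x₀ x₁ (hAo hy), ?_⟩
      rw [mem_preimage, param_transition x₀ x₁ (hAo hy)]; exact hy.2
  have hAm : MeasurableSet A := measurableSet_target_inter x₀ hB
  rw [himg, lintegral_image_eq_lintegral_abs_det_fderiv_mul volume hAm
    (fun y hy => (differentiableAt_transition x₀ x₁ (hAo hy)).hasFDerivAt.hasFDerivWithinAt)
    ((injOn_transition x₀ x₁).mono hAo)]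
  exact setLIntegral_congr_fun hAm fun y hy => sqrt_det_transition m x₀ x₁ (hAo hy)

lemma chartVolume_inter_source (m : MetricField n M) (x₀ : M) {B : Set M}
    (hB : MeasurableSet B) :
    chartVolume m x₀ B = chartVolume m x₀ (B ∩ (chartAt (Eucl n) x₀).source) := by
  rw [chartVolume_apply m x₀ hB,
    chartVolume_apply m x₀ (hB.inter (chartAt (Eucl n) x₀).open_source.measurableSet)]
  congr 2
  ext y
  simp only [mem_inter_iff, mem_preimage]
  exact ⟨fun h => ⟨h.1, h.2, param_mem_source x₀ h.1⟩, fun h => ⟨h.1, h.2.1⟩⟩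

variable [SecondCountableTopology M]

/-- A measurable partition of `M` into countably many pieces, each contained in a chart domain. -/
lemma exists_chart_partition (n : ℕ) (M : Type*) [TopologicalSpace M] [ChartedSpace (Eucl n) M]
    [MeasurableSpace M] [BorelSpace M] [SecondCountableTopology M] :
    ∃ (ι : Type) (_ : Countable ι) (c : ι → M) (A : ι → Set M), (∀ i, MeasurableSet (A i)) ∧
      (∀ i, A i ⊆ (chartAt (Eucl n) (c i)).source) ∧ Pairwise (Function.onFun Disjoint A) ∧
      ⋃ i, A i = univ := by
  rcases isEmpty_or_nonempty M with hM | hM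
  · exact ⟨Empty, inferInstance, fun i => i.elim, fun i => i.elim, fun i => i.elim,
      fun i => i.elim, fun i => i.elim, by ext x; exact hM.elim x⟩
  obtain ⟨s, hs, hsu⟩ := TopologicalSpace.countable_cover_nhds
    (fun x : M => (chartAt (Eucl n) x).open_source.mem_nhds (mem_chart_source _ x))
  have hne : s.Nonempty := by
    by_contra h
    rw [not_nonempty_iff_eq_empty] at h
    rw [h, biUnion_empty] at hsu
    exact empty_ne_univ hsu
  obtain ⟨f, hf⟩ := hs.exists_eq_range hne
  refine ⟨ℕ, inferInstance, f, disjointed fun i => (chartAt (Eucl n) (f i)).source,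
    fun i => MeasurableSet.disjointed (fun j => (chartAt (Eucl n) (f j)).open_source.measurableSet) i,
    fun i => disjointed_subset _ i, disjoint_disjointed _, ?_⟩
  rw [iUnion_disjointed, ← hsu, hf]
  simp

/-- A measure that dominates all chart volumes and agrees with the corresponding chart volume on
the pieces of a partition is the volume measure. -/
lemma vol_apply_eq_chartVolume (m : MetricField n M) (x₀ : M) {B : Set M} (hB : MeasurableSet B)
    (h₀ : B ⊆ (chartAt (Eucl n) x₀).source) : vol m B = chartVolume m x₀ B := by
  obtain ⟨ι, _, c, A, hA, hAc, hd, hu⟩ := exists_chart_partition n M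
  -- The glued measure agrees with every chart volume inside the corresponding chart domain. It
  -- therefore dominates the supremum that defines `vol`, and on chart domains it gives the upper
  -- bound.
  let ν : Measure M := Measure.sum fun i => (chartVolume m (c i)).restrict (A i)
  have hν : ∀ x B, MeasurableSet B → B ⊆ (chartAt (Eucl n) x).source →
      ν B = chartVolume m x B := by
    intro x B hB hx
    have h1 : chartVolume m x B = ∑' i, chartVolume m x (B ∩ A i) := by
      rw [← measure_iUnion (fun i j hij => (hd hij).mono inter_subset_right inter_subset_right)
        (fun i => hB.inter (hA i)), ← inter_iUnion, hu, inter_univ]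
    rw [h1, Measure.sum_apply _ hB]
    refine tsum_congr fun i => ?_
    rw [Measure.restrict_apply hB]
    exact chartVolume_congr m _ _ (hB.inter (hA i)) (inter_subset_right.trans (hAc i))
      (inter_subset_left.trans hx)
  have hle : vol m ≤ ν := by
    refine iSup_le fun x => Measure.le_iff.2 fun B hB => ?_
    rw [chartVolume_inter_source m x hB, ← hν x _
      (hB.inter (chartAt (Eucl n) x).open_source.measurableSet) inter_subset_right]
    exact measure_mono inter_subset_left
  refine le_antisymm ((hle B).trans_eq (hν x₀ B hB h₀)) ?_
  exact le_iSup (fun x => chartVolume m x) x₀ B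

lemma vol_restrict_source (m : MetricField n M) (x₀ : M) :
    (vol m).restrict (chartAt (Eucl n) x₀).source = chartVolume m x₀ := by
  ext B hB
  rw [Measure.restrict_apply hB, chartVolume_inter_source m x₀ hB]
  exact vol_apply_eq_chartVolume m x₀
    (hB.inter (chartAt (Eucl n) x₀).open_source.measurableSet) inter_subset_right

lemma vol_ext {μ ν : Measure M}
    (h : ∀ x₀ : M, ∀ B, MeasurableSet B → B ⊆ (chartAt (Eucl n) x₀).source → μ B = ν B) :
    μ = ν := by
  obtain ⟨ι, _, c, A, hA, hAc, hd, hu⟩ := exists_chart_partition n M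
  ext B hB
  have h1 : ∀ κ : Measure M, κ B = ∑' i, κ (B ∩ A i) := fun κ => by
    rw [← measure_iUnion (fun i j hij => (hd hij).mono inter_subset_right inter_subset_right)
        (fun i => hB.inter (hA i)), ← inter_iUnion, hu, inter_univ]
  rw [h1 μ, h1 ν]
  exact tsum_congr fun i => h (c i) _ (hB.inter (hA i)) (inter_subset_right.trans (hAc i))

variable (G : Bundle.ContMDiffRiemannianMetric (𝓡 n) ∞ (Eucl n)
  (fun x : M => TangentSpace (𝓡 n) x))

lemma continuousOn_gram_det (x₀ : M) :
    ContinuousOn (fun y => √(gram G.inner x₀ y).det) (chartAt (Eucl n) x₀).target := by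
  refine ContinuousOn.sqrt ?_
  simp only [Matrix.det_apply]
  refine continuousOn_finsetSum _ fun σ _ => ContinuousOn.const_smul ?_ _
  exact continuousOn_finsetProd _ fun i _ => (contDiffOn_gram G x₀ _ _).continuousOn

lemma aemeasurable_density (x₀ : M) :
    AEMeasurable (fun y => ENNReal.ofReal (√(gram G.inner x₀ y).det))
      (volume.restrict (chartAt (Eucl n) x₀).target) :=
  ((continuousOn_gram_det G x₀).aemeasurable
    (chartAt (Eucl n) x₀).open_target.measurableSet).ennreal_ofReal

lemma setLIntegral_chart (x₀ : M) {B : Set M} (hB : MeasurableSet B)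
    (hB₀ : B ⊆ (chartAt (Eucl n) x₀).source) {f : M → ℝ≥0∞} (hf : Measurable f) :
    ∫⁻ x in B, f x ∂(vol G.inner) = ∫⁻ y in (chartAt (Eucl n) x₀).target ∩ param x₀ ⁻¹' B,
      ENNReal.ofReal (√(gram G.inner x₀ y).det) * f (param x₀ y) := by
  have hac := withDensity_absolutelyContinuous
    (volume.restrict (chartAt (Eucl n) x₀).target)
    (fun y => ENNReal.ofReal (√(gram G.inner x₀ y).det))
  have h1 : (vol G.inner).restrict B = (chartVolume G.inner x₀).restrict B := by
    rw [← vol_restrict_source, Measure.restrict_restrict hB, inter_eq_left.2 hB₀]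
  rw [h1, ← lintegral_indicator hB, chartVolume,
    lintegral_map' (hf.indicator hB).aemeasurable ((aemeasurable_param x₀).mono_ac hac),
    lintegral_withDensity_eq_lintegral_mul₀ (aemeasurable_density G x₀)
      (g := fun y => B.indicator f (param x₀ y))
      ((hf.indicator hB).comp_aemeasurable (aemeasurable_param x₀))]
  have h2 : MeasurableSet ((chartAt (Eucl n) x₀).target ∩ param x₀ ⁻¹' B) :=
    measurableSet_target_inter x₀ hB
  rw [← lintegral_indicator h2,
    ← lintegral_indicator (chartAt (Eucl n) x₀).open_target.measurableSet]
  congr 1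
  ext y
  by_cases h3 : y ∈ (chartAt (Eucl n) x₀).target <;> by_cases h4 : param x₀ y ∈ B <;>
    simp [indicator, h3, h4]

/-- The volume measure of a conformal metric. -/
lemma vol_conformal (hn : 3 ≤ n) {w : M → ℝ} (hw : ∀ x, 0 < w x) (hwm : Measurable w) :
    vol (conformal G.inner w) = (vol G.inner).withDensity
      (fun x => ENNReal.ofReal (w x ^ (2 * (n : ℝ) / ((n : ℝ) - 2)))) := by
  have hn2 : (0 : ℝ) < (n : ℝ) - 2 := by
    have : (3 : ℝ) ≤ n := by exact_mod_cast hn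
    linarith
  refine vol_ext (n := n) fun x₀ B hB hB₀ => ?_
  have hmeas : Measurable fun x => ENNReal.ofReal (w x ^ (2 * (n : ℝ) / ((n : ℝ) - 2))) :=
    (hwm.pow_const _).ennreal_ofReal
  rw [vol_apply_eq_chartVolume _ x₀ hB hB₀, withDensity_apply _ hB,
    setLIntegral_chart G x₀ hB hB₀ hmeas, chartVolume_apply _ _ hB]
  refine setLIntegral_congr_fun (measurableSet_target_inter x₀ hB) fun y hy => ?_
  have h2 : gram (conformal G.inner w) x₀ y
      = (w (param x₀ y) ^ (4 / ((n : ℝ) - 2))) • gram G.inner x₀ y := by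
    ext i j
    rfl
  have hwp := hw (param x₀ y)
  simp only [h2, Matrix.det_smul, Fintype.card_fin]
  rw [Real.sqrt_mul (by positivity), ENNReal.ofReal_mul (Real.sqrt_nonneg _), mul_comm]
  congr 2
  -- The determinant scales by the `n`-th power of `w^{4/(n-2)}`, and the square root turns this
  -- into `w^{2n/(n-2)}`.
  rw [Real.sqrt_eq_rpow, ← Real.rpow_natCast, ← Real.rpow_mul hwp.le, ← Real.rpow_mul hwp.le]
  congr 1
  field_simp
  norm_num

end Volume

/-! ### Null sets and measurability, passed between the manifold and its charts. -/

section Transfer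

variable {n : ℕ} {M : Type*} [TopologicalSpace M] [ChartedSpace (Eucl n) M]
  [IsManifold (𝓡 n) ∞ M] [MeasurableSpace M] [BorelSpace M] [SecondCountableTopology M]
  (G : Bundle.ContMDiffRiemannianMetric (𝓡 n) ∞ (Eucl n) (fun x : M => TangentSpace (𝓡 n) x))

lemma ae_restrict_source_of_chart (x₀ : M) {p : M → Prop}
    (h : ∀ᵐ y ∂(volume.restrict (chartAt (Eucl n) x₀).target), p (param x₀ y)) :
    ∀ᵐ x ∂((vol G.inner).restrict (chartAt (Eucl n) x₀).source), p x := by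
  have ht := (chartAt (Eucl n) x₀).open_target.measurableSet
  have hs := (chartAt (Eucl n) x₀).open_source.measurableSet
  set N := {y : Eucl n | ¬ p (param x₀ y)}
  have hN : volume.restrict (chartAt (Eucl n) x₀).target N = 0 := h
  -- The exceptional set need not be measurable. It is enlarged to a measurable null set before the
  -- volume formula is applied.
  set N' := toMeasurable (volume.restrict (chartAt (Eucl n) x₀).target) N
  have hN' : volume.restrict (chartAt (Eucl n) x₀).target N' = 0 := by
    rw [measure_toMeasurable, hN]
  have hN'm : MeasurableSet N' := measurableSet_toMeasurable _ _
  set B := (chartAt (Eucl n) x₀).source ∩ chartAt (Eucl n) x₀ ⁻¹' N'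
  have hBm : MeasurableSet B := by
    have h1 : Measurable ((chartAt (Eucl n) x₀).source.domRestrict (chartAt (Eucl n) x₀)) :=
      (continuousOn_iff_continuous_domRestrict.1
        (chartAt (Eucl n) x₀).continuousOn).measurable
    have h2 := hs.subtype_image (h1 hN'm)
    convert h2 using 1
    ext y
    simp [B, and_comm]
  have hB : vol G.inner B = 0 := by
    rw [vol_apply_eq_chartVolume _ x₀ hBm inter_subset_left, chartVolume_apply _ _ hBm]
    refine setLIntegral_measure_zero _ _ ?_
    rw [Measure.restrict_apply hN'm] at hN'
    refine measure_mono_null ?_ hN'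
    rintro y ⟨hy, hy2, hy3⟩
    rw [mem_preimage, chart_param x₀ hy] at hy3
    exact ⟨hy3, hy⟩
  rw [ae_restrict_iff' hs]
  refine measure_mono_null ?_ hB
  intro x hx
  have hx' : ¬ (x ∈ (chartAt (Eucl n) x₀).source → p x) := hx
  push Not at hx'
  refine ⟨hx'.1, subset_toMeasurable _ _ ?_⟩
  change ¬ p (param x₀ (chartAt (Eucl n) x₀ x))
  rw [param_chart x₀ hx'.1]
  exact hx'.2

lemma exists_countable_charts (n : ℕ) (M : Type*) [TopologicalSpace M] [ChartedSpace (Eucl n) M]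
    [SecondCountableTopology M] :
    ∃ s : Set M, s.Countable ∧ ⋃ x ∈ s, (chartAt (Eucl n) x).source = univ :=
  TopologicalSpace.countable_cover_nhds
    (fun x : M => (chartAt (Eucl n) x).open_source.mem_nhds (mem_chart_source _ x))

lemma ae_of_chart {p : M → Prop}
    (h : ∀ x₀ : M, ∀ᵐ y ∂(volume.restrict (chartAt (Eucl n) x₀).target), p (param x₀ y)) :
    ∀ᵐ x ∂(vol G.inner), p x := by
  obtain ⟨s, hs, hsu⟩ := exists_countable_charts n M
  rw [← Measure.restrict_univ (μ := vol G.inner), ← hsu, ae_restrict_biUnion_iff _ hs]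
  exact fun x _ => ae_restrict_source_of_chart G x (h x)

/-- The density `√det` is positive, so a set that is null for the volume is Lebesgue null in
coordinates. -/
lemma ae_chart {p : M → Prop} (h : ∀ᵐ x ∂(vol G.inner), p x) (x₀ : M) :
    ∀ᵐ y ∂(volume.restrict (chartAt (Eucl n) x₀).target), p (param x₀ y) := by
  have ht := (chartAt (Eucl n) x₀).open_target.measurableSet
  set N' := toMeasurable (vol G.inner) {x | ¬ p x}
  have hN' : vol G.inner N' = 0 := by
    rw [measure_toMeasurable]; exact h
  have hN'm : MeasurableSet N' := measurableSet_toMeasurable _ _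
  have h1 : chartVolume G.inner x₀ N' = 0 :=
    le_antisymm ((le_iSup (fun x => chartVolume G.inner x) x₀ N').trans_eq hN') bot_le
  rw [chartVolume_apply _ _ hN'm, lintegral_eq_zero_iff'
    ((aemeasurable_density G x₀).mono_measure (Measure.restrict_mono inter_subset_left le_rfl)),
    Filter.EventuallyEq, ae_restrict_iff' (measurableSet_target_inter x₀ hN'm)] at h1
  rw [ae_restrict_iff' ht]
  filter_upwards [h1] with y hy hyt
  by_contra hp
  have h2 := hy ⟨hyt, subset_toMeasurable _ _ hp⟩
  have h3 := Real.sqrt_pos.2 (gram_det_pos G x₀ hyt)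
  simp only [Pi.zero_apply, ENNReal.ofReal_eq_zero] at h2
  exact absurd h3 (not_lt.2 h2)

lemma aestronglyMeasurable_of_chart {f : M → ℝ}
    (h : ∀ x₀ : M, AEStronglyMeasurable (fun y => f (param x₀ y))
      (volume.restrict (chartAt (Eucl n) x₀).target)) :
    AEStronglyMeasurable f (vol G.inner) := by
  obtain ⟨s, hs, hsu⟩ := exists_countable_charts n M
  rw [← Measure.restrict_univ (μ := vol G.inner), ← hsu, biUnion_eq_iUnion]
  have := hs.to_subtype
  refine AEStronglyMeasurable.iUnion fun ⟨x₀, _⟩ => ?_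
  obtain ⟨k, hk, hfk⟩ := h x₀
  have h1 : ∀ᵐ x ∂((vol G.inner).restrict (chartAt (Eucl n) x₀).source),
      f x = k (chartAt (Eucl n) x₀ x) := by
    refine ae_restrict_source_of_chart G x₀ ?_
    filter_upwards [hfk, ae_restrict_mem (chartAt (Eucl n) x₀).open_target.measurableSet]
      with y hy hyt
    rw [hy, chart_param x₀ hyt]
  have h2 : AEMeasurable (chartAt (Eucl n) x₀)
      ((vol G.inner).restrict (chartAt (Eucl n) x₀).source) :=
    (aemeasurable_restrict_iff_comap_subtype
      (chartAt (Eucl n) x₀).open_source.measurableSet).2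
      (continuousOn_iff_continuous_domRestrict.1
        (chartAt (Eucl n) x₀).continuousOn).measurable.aemeasurable
  exact ((hk.measurable.comp_aemeasurable h2).aestronglyMeasurable).congr
    (h1.mono fun x hx => hx.symm)

lemma aestronglyMeasurable_chart {f : M → ℝ} (h : AEStronglyMeasurable f (vol G.inner)) (x₀ : M) :
    AEStronglyMeasurable (fun y => f (param x₀ y))
      (volume.restrict (chartAt (Eucl n) x₀).target) := by
  obtain ⟨k, hk, hfk⟩ := h
  exact (hk.measurable.comp_aemeasurable (aemeasurable_param x₀)).aestronglyMeasurable.congr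
    ((ae_chart G hfk x₀).mono fun y hy => hy.symm)

/-- Vector fields with measurable components in all charts. -/
def MeasField (X : ∀ x : M, TangentSpace (𝓡 n) x) : Prop :=
  ∀ (x₀ : M) (i : Fin n), AEStronglyMeasurable
    (fun y => G.inner (param x₀ y) (X (param x₀ y)) (coordVec x₀ y i))
    (volume.restrict (chartAt (Eucl n) x₀).target)

variable {G} {X Y : ∀ x : M, TangentSpace (𝓡 n) x}

lemma MeasField.sub (hX : MeasField G X) (hY : MeasField G Y) :
    MeasField G (fun x => X x - Y x) := fun x₀ i => by
  refine ((hX x₀ i).sub (hY x₀ i)).congr (ae_of_all _ fun y => ?_)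
  simp

lemma MeasField.smul (hX : MeasField G X) {φ : M → ℝ} (hφ : AEStronglyMeasurable φ (vol G.inner)) :
    MeasField G (fun x => φ x • X x) := fun x₀ i => by
  refine ((aestronglyMeasurable_chart G hφ x₀).mul (hX x₀ i)).congr (ae_of_all _ fun y => ?_)
  simp

lemma continuousOn_gram_inv (x₀ : M) (i j : Fin n) :
    ContinuousOn (fun y => (gram G.inner x₀ y)⁻¹ i j) (chartAt (Eucl n) x₀).target := by
  have h1 : ContinuousOn (fun y => gram G.inner x₀ y) (chartAt (Eucl n) x₀).target :=
    continuousOn_pi.2 fun i => continuousOn_pi.2 fun j => (contDiffOn_gram G x₀ i j).continuousOn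
  have h2 : ContinuousOn (fun y => (gram G.inner x₀ y).det⁻¹ * (gram G.inner x₀ y).adjugate i j)
      (chartAt (Eucl n) x₀).target := by
    refine ContinuousOn.mul (ContinuousOn.inv₀ ?_ fun y hy => (gram_det_pos G x₀ hy).ne') ?_
    · exact (Continuous.matrix_det continuous_id).comp_continuousOn h1
    · exact ((Continuous.matrix_adjugate continuous_id).matrix_elem i j).comp_continuousOn h1
  refine h2.congr fun y _ => ?_
  simp [Matrix.inv_def]

/-- In coordinates the pairing is a combination of the measurable covariant components with
continuous coefficients, the entries of the inverse metric. -/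
lemma MeasField.ip (hX : MeasField G X) (hY : MeasField G Y) :
    AEStronglyMeasurable (ip G X Y) (vol G.inner) := by
  refine aestronglyMeasurable_of_chart G fun x₀ => ?_
  have ht := (chartAt (Eucl n) x₀).open_target.measurableSet
  have h1 : AEStronglyMeasurable (fun y => ∑ i, ∑ j, (gram G.inner x₀ y)⁻¹ i j *
      G.inner (param x₀ y) (X (param x₀ y)) (coordVec x₀ y i) *
      G.inner (param x₀ y) (Y (param x₀ y)) (coordVec x₀ y j))
      (volume.restrict (chartAt (Eucl n) x₀).target) := by
    refine Finset.aestronglyMeasurable_fun_sum _ fun i _ =>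
      Finset.aestronglyMeasurable_fun_sum _ fun j _ => ?_
    exact (((continuousOn_gram_inv x₀ i j).aestronglyMeasurable ht).mul (hX x₀ i)).mul (hY x₀ j)
  refine h1.congr ?_
  filter_upwards [ae_restrict_mem ht] with y hy
  exact (inner_eq_sum_inv_gram G x₀ hy _ _).symm

end Transfer

/-! ### Weak gradients: linearity, uniqueness, conformal change. -/

section WeakGradient

variable {n : ℕ} {M : Type*} [TopologicalSpace M] [ChartedSpace (Eucl n) M]
  [IsManifold (𝓡 n) ∞ M] [MeasurableSpace M] [BorelSpace M] [SecondCountableTopology M]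
  {G : Bundle.ContMDiffRiemannianMetric (𝓡 n) ∞ (Eucl n) (fun x : M => TangentSpace (𝓡 n) x)}
  {v w : M → ℝ} {X Y : ∀ x : M, TangentSpace (𝓡 n) x}

lemma IsWeakGradient.measField (h : IsWeakGradient G.inner v X) : MeasField G X :=
  fun x₀ i => ((h x₀).2 i).1.aestronglyMeasurable

lemma IsWeakGradient.aestronglyMeasurable (h : IsWeakGradient G.inner v X) :
    AEStronglyMeasurable v (vol G.inner) :=
  aestronglyMeasurable_of_chart G fun x₀ => (h x₀).1.aestronglyMeasurable

lemma integrable_mul_of_hasCompactSupport {E : Type*} [NormedAddCommGroup E]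
    [MeasurableSpace E] [BorelSpace E] {μ : Measure E} {U : Set E} {f η : E → ℝ}
    (hf : LocallyIntegrableOn f U μ) (hη : Continuous η) (hc : HasCompactSupport η)
    (hU : tsupport η ⊆ U) : Integrable (fun y => f y * η y) μ := by
  have h1 : IntegrableOn f (tsupport η) μ := hf.integrableOn_compact_subset hU hc
  have h2 : IntegrableOn (fun y => f y * η y) (tsupport η) μ :=
    h1.mul_continuousOn hη.continuousOn hc
  refine (integrableOn_iff_integrable_of_support_subset ?_).1 h2
  intro y hy
  exact subset_tsupport η (right_ne_zero_of_mul hy)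

lemma continuous_partialD {η : Eucl n → ℝ} (hη : ContDiff ℝ 1 η) (i : Fin n) :
    Continuous (partialD i η) :=
  (hη.continuous_fderiv one_ne_zero).clm_apply continuous_const

lemma hasCompactSupport_partialD {η : Eucl n → ℝ} (hc : HasCompactSupport η) (i : Fin n) :
    HasCompactSupport (partialD i η) :=
  (hc.fderiv_apply (𝕜 := ℝ) _)

lemma tsupport_partialD_subset {η : Eucl n → ℝ} (i : Fin n) :
    tsupport (partialD i η) ⊆ tsupport η :=
  tsupport_fderiv_apply_subset ℝ _

lemma IsWeakGradient.sub (hv : IsWeakGradient G.inner v X) (hw : IsWeakGradient G.inner w Y) :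
    IsWeakGradient G.inner (v - w) (fun x => X x - Y x) := by
  intro x₀
  have hc : ∀ i : Fin n, (fun y => G.inner (param x₀ y) (X (param x₀ y) - Y (param x₀ y))
      (coordVec x₀ y i)) = fun y => G.inner (param x₀ y) (X (param x₀ y)) (coordVec x₀ y i)
        - G.inner (param x₀ y) (Y (param x₀ y)) (coordVec x₀ y i) := by
    intro i; ext y; simp
  refine ⟨(hv x₀).1.sub (hw x₀).1, fun i => ⟨?_, fun η h1 h2 h3 => ?_⟩⟩
  · rw [hc i]
    exact ((hv x₀).2 i).1.sub ((hw x₀).2 i).1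
  · have e1 := ((hv x₀).2 i).2 η h1 h2 h3
    have e2 := ((hw x₀).2 i).2 η h1 h2 h3
    have hp := continuous_partialD (h1.of_le (by simp)) i
    have hpc := hasCompactSupport_partialD h2 i
    have hps := (tsupport_partialD_subset (η := η) i).trans h3
    have i1 := integrable_mul_of_hasCompactSupport (hv x₀).1 hp hpc hps
    have i2 := integrable_mul_of_hasCompactSupport (hw x₀).1 hp hpc hps
    have i3 := integrable_mul_of_hasCompactSupport ((hv x₀).2 i).1 h1.continuous h2 h3
    have i4 := integrable_mul_of_hasCompactSupport ((hw x₀).2 i).1 h1.continuous h2 h3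
    have := congrFun (hc i)
    simp only [this, Pi.sub_apply, sub_mul]
    rw [integral_sub i1 i2, integral_sub i3 i4, e1, e2]
    ring

/-- Weak gradients are unique almost everywhere. -/
lemma IsWeakGradient.ae_eq (hX : IsWeakGradient G.inner v X) (hY : IsWeakGradient G.inner v Y) :
    ∀ᵐ x ∂(vol G.inner), X x = Y x := by
  refine ae_of_chart G fun x₀ => ?_
  have ho := (chartAt (Eucl n) x₀).open_target
  have h1 : ∀ i : Fin n, ∀ᵐ y ∂(volume : Measure (Eucl n)), y ∈ (chartAt (Eucl n) x₀).target →
      G.inner (param x₀ y) (X (param x₀ y)) (coordVec x₀ y i)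
        - G.inner (param x₀ y) (Y (param x₀ y)) (coordVec x₀ y i) = 0 := by
    intro i
    refine ho.ae_eq_zero_of_integral_contDiff_smul_eq_zero
      (((hX x₀).2 i).1.sub ((hY x₀).2 i).1) fun η a1 a2 a3 => ?_
    have i3 := integrable_mul_of_hasCompactSupport ((hX x₀).2 i).1 a1.continuous a2 a3
    have i4 := integrable_mul_of_hasCompactSupport ((hY x₀).2 i).1 a1.continuous a2 a3
    have e1 := ((hX x₀).2 i).2 η a1 a2 a3
    have e2 := ((hY x₀).2 i).2 η a1 a2 a3
    simp only [smul_eq_mul, mul_comm (η _), sub_mul]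
    rw [integral_sub i3 i4]
    linarith
  rw [ae_restrict_iff' ho.measurableSet]
  filter_upwards [ae_all_iff.2 h1] with y hy hyt
  refine ext_inner G fun z => ?_
  obtain ⟨a, rfl⟩ := exists_coordVec_sum x₀ hyt z
  simp only [map_sum, map_smul]
  exact Finset.sum_congr rfl fun i _ => by rw [sub_eq_zero.1 (hy i hyt)]

lemma IsWeakGradient.congr_field (hX : IsWeakGradient G.inner v X)
    (h : ∀ x, X x = Y x) : IsWeakGradient G.inner v Y := by
  rwa [← funext h]

/-- Only the covector `m(X, ·)` enters the definition of a weak gradient, and it must consist of the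
weak partial derivatives whatever the metric is. A conformal factor can thus be moved from the
metric to the field. -/
lemma isWeakGradient_conformal_iff {θ : M → ℝ} :
    IsWeakGradient (conformal G.inner θ) v X ↔
      IsWeakGradient G.inner v (fun x => (θ x ^ (4 / ((n : ℝ) - 2))) • X x) := by
  have h : ∀ x z, conformal G.inner θ x (X x) z
      = G.inner x ((θ x ^ (4 / ((n : ℝ) - 2))) • X x) z := by
    intro x z; simp [conformal]
  unfold IsWeakGradient
  simp only [h]

end WeakGradient

/-! ### Calculus of gradients of `C¹` functions. -/

section Gradient

variable {n : ℕ} {M : Type*} [TopologicalSpace M] [ChartedSpace (Eucl n) M]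
  [IsManifold (𝓡 n) ∞ M]
  {G : Bundle.ContMDiffRiemannianMetric (𝓡 n) ∞ (Eucl n) (fun x : M => TangentSpace (𝓡 n) x)}

lemma contDiffOn_comp_param {k : ℕ∞ω} {f : M → ℝ} (hk : k ≤ (∞ : ℕ∞ω))
    (hf : ContMDiff (𝓡 n) 𝓘(ℝ, ℝ) k f) (x₀ : M) :
    ContDiffOn ℝ k (fun y : Eucl n => f (param x₀ y)) (chartAt (Eucl n) x₀).target := by
  rw [← contMDiffOn_iff_contDiffOn]
  exact hf.comp_contMDiffOn ((contMDiffOn_param x₀).of_le hk)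

lemma continuousOn_partialD {f : Eucl n → ℝ} {U : Set (Eucl n)} (hU : IsOpen U)
    (hf : ContDiffOn ℝ 1 f U) (i : Fin n) : ContinuousOn (partialD i f) U :=
  (hf.continuousOn_fderiv_of_isOpen hU le_rfl).clm_apply continuousOn_const

lemma inner_grad_coordVec {f : M → ℝ} (hf : ContMDiff (𝓡 n) 𝓘(ℝ, ℝ) 1 f) (x₀ : M) {y : Eucl n}
    (hy : y ∈ (chartAt (Eucl n) x₀).target) (i : Fin n) :
    G.inner (param x₀ y) (grad G f (param x₀ y)) (coordVec x₀ y i)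
      = partialD i (fun z => f (param x₀ z)) y := by
  rw [inner_grad]
  exact mfderiv_coordVec x₀ hy (hf.mdifferentiableAt one_ne_zero) i

lemma grad_mul {f h : M → ℝ} (hf : ContMDiff (𝓡 n) 𝓘(ℝ, ℝ) 1 f)
    (hh : ContMDiff (𝓡 n) 𝓘(ℝ, ℝ) 1 h) (x : M) :
    grad G (fun x => f x * h x) x = f x • grad G h x + h x • grad G f x := by
  refine ext_inner G fun z => ?_
  have := (((hf x).mdifferentiableAt one_ne_zero).hasMFDerivAt.mul
    ((hh x).mdifferentiableAt one_ne_zero).hasMFDerivAt).mfderiv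
  rw [inner_grad]
  have h2 := congrArg (fun L : Eucl n →L[ℝ] ℝ => L z) this
  refine h2.trans ?_
  simp only [map_add, map_smul, _root_.add_apply, _root_.smul_apply, inner_grad]
  rfl

lemma grad_sub {f h : M → ℝ} (hf : ContMDiff (𝓡 n) 𝓘(ℝ, ℝ) 1 f)
    (hh : ContMDiff (𝓡 n) 𝓘(ℝ, ℝ) 1 h) (x : M) :
    grad G (fun x => f x - h x) x = grad G f x - grad G h x := by
  refine ext_inner G fun z => ?_
  have := (((hf x).mdifferentiableAt one_ne_zero).hasMFDerivAt.sub
    ((hh x).mdifferentiableAt one_ne_zero).hasMFDerivAt).mfderiv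
  rw [inner_grad]
  have h2 := congrArg (fun L : Eucl n →L[ℝ] ℝ => L z) this
  refine h2.trans ?_
  simp only [map_sub, _root_.sub_apply, inner_grad]
  rfl

lemma grad_comp {f : M → ℝ} (hf : ContMDiff (𝓡 n) 𝓘(ℝ, ℝ) 1 f) {F : ℝ → ℝ} {F' : ℝ} (x : M)
    (hF : HasDerivAt F F' (f x)) :
    grad G (fun x => F (f x)) x = F' • grad G f x := by
  refine ext_inner G fun z => ?_
  have := (HasMFDerivAt.comp x hF.hasFDerivAt.hasMFDerivAt
    ((hf x).mdifferentiableAt one_ne_zero).hasMFDerivAt).mfderiv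
  rw [inner_grad]
  have h2 := congrArg (fun L : Eucl n →L[ℝ] ℝ => L z) this
  refine h2.trans ?_
  simp only [map_smul, _root_.smul_apply, inner_grad]
  exact mul_comm _ _

lemma grad_const (c : ℝ) (x : M) : grad G (fun _ => c) x = 0 := by
  refine ext_inner G fun z => ?_
  rw [inner_grad, mfderiv_const, map_zero]
  rfl

lemma grad_const_mul {f : M → ℝ} (hf : ContMDiff (𝓡 n) 𝓘(ℝ, ℝ) 1 f) (c : ℝ) (x : M) :
    grad G (fun x => c * f x) x = c • grad G f x := by
  simpa using grad_comp (G := G) hf (F := fun s => c * s) x ((hasDerivAt_id (f x)).const_mul c)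

lemma grad_eq_zero_of_eventuallyEq {f : M → ℝ} {x : M} (h : f =ᶠ[𝓝 x] fun _ => 0) :
    grad G f x = 0 := by
  refine ext_inner G fun z => ?_
  rw [inner_grad, h.mfderiv_eq, mfderiv_const, map_zero]
  rfl

lemma grad_eq_zero_of_notMem_tsupport {f : M → ℝ} {x : M} (h : x ∉ tsupport f) :
    grad G f x = 0 :=
  grad_eq_zero_of_eventuallyEq (notMem_tsupport_iff_eventuallyEq.1 h)

lemma ip_grad_eq {f h : M → ℝ} (hf : ContMDiff (𝓡 n) 𝓘(ℝ, ℝ) 1 f)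
    (hh : ContMDiff (𝓡 n) 𝓘(ℝ, ℝ) 1 h) (x₀ : M) {y : Eucl n}
    (hy : y ∈ (chartAt (Eucl n) x₀).target) :
    ip G (grad G f) (grad G h) (param x₀ y) = ∑ i, ∑ j, (gram G.inner x₀ y)⁻¹ i j *
      partialD i (fun z => f (param x₀ z)) y * partialD j (fun z => h (param x₀ z)) y := by
  rw [ip, inner_eq_sum_inv_gram G x₀ hy]
  simp only [inner_grad_coordVec hf x₀ hy, inner_grad_coordVec hh x₀ hy]

lemma contDiffOn_gram_inv (x₀ : M) (i j : Fin n) :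
    ContDiffOn ℝ ∞ (fun y => (gram G.inner x₀ y)⁻¹ i j) (chartAt (Eucl n) x₀).target := by
  have hdet : ∀ A : Eucl n → Matrix (Fin n) (Fin n) ℝ,
      (∀ k l, ContDiffOn ℝ ∞ (fun y => A y k l) (chartAt (Eucl n) x₀).target) →
      ContDiffOn ℝ ∞ (fun y => (A y).det) (chartAt (Eucl n) x₀).target := by
    intro A hA
    simp only [Matrix.det_apply]
    exact ContDiffOn.sum fun σ _ => ContDiffOn.const_smul _ (contDiffOn_prod fun i _ => hA _ _)
  have h2 : ContDiffOn ℝ ∞ (fun y => (gram G.inner x₀ y).det⁻¹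
      * (gram G.inner x₀ y).adjugate i j) (chartAt (Eucl n) x₀).target := by
    refine ContDiffOn.mul (ContDiffOn.inv (hdet _ fun k l => contDiffOn_gram G x₀ k l)
      fun y hy => (gram_det_pos G x₀ hy).ne') ?_
    simp only [Matrix.adjugate_apply]
    refine hdet _ fun k l => ?_
    by_cases h : k = j
    · subst h
      simp only [Matrix.updateRow_self]
      exact contDiffOn_const
    · simp only [Matrix.updateRow_ne h]
      exact contDiffOn_gram G x₀ k l
  refine h2.congr fun y _ => ?_
  simp [Matrix.inv_def]

lemma contDiffOn_sqrt_gram_det (x₀ : M) :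
    ContDiffOn ℝ ∞ (fun y => √(gram G.inner x₀ y).det) (chartAt (Eucl n) x₀).target := by
  refine ContDiffOn.sqrt ?_ fun y hy => (gram_det_pos G x₀ hy).ne'
  simp only [Matrix.det_apply]
  exact ContDiffOn.sum fun σ _ => ContDiffOn.const_smul _
    (contDiffOn_prod fun i _ => contDiffOn_gram G x₀ _ _)

lemma continuous_ip_grad {f h : M → ℝ} (hf : ContMDiff (𝓡 n) 𝓘(ℝ, ℝ) 1 f)
    (hh : ContMDiff (𝓡 n) 𝓘(ℝ, ℝ) 1 h) : Continuous (ip G (grad G f) (grad G h)) := by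
  refine continuous_iff_continuousAt.2 fun x₀ => ?_
  have ho := (chartAt (Eucl n) x₀).open_target
  have h1 : ContinuousOn (fun y => ∑ i, ∑ j, (gram G.inner x₀ y)⁻¹ i j *
      partialD i (fun z => f (param x₀ z)) y * partialD j (fun z => h (param x₀ z)) y)
      (chartAt (Eucl n) x₀).target := by
    refine continuousOn_finsetSum _ fun i _ => continuousOn_finsetSum _ fun j _ => ?_
    exact ((contDiffOn_gram_inv x₀ i j).continuousOn.mul
      (continuousOn_partialD ho (contDiffOn_comp_param (by simp) hf x₀) i)).mul
      (continuousOn_partialD ho (contDiffOn_comp_param (by simp) hh x₀) j)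
  have hx : x₀ ∈ (chartAt (Eucl n) x₀).source := mem_chart_source _ _
  have h2 := (h1.continuousAt (ho.mem_nhds ((chartAt (Eucl n) x₀).map_source hx))).comp
    ((chartAt (Eucl n) x₀).continuousAt hx)
  refine h2.congr ?_
  filter_upwards [(chartAt (Eucl n) x₀).open_source.mem_nhds hx] with x hxs
  have h3 := ip_grad_eq (G := G) hf hh x₀ ((chartAt (Eucl n) x₀).map_source hxs)
  rw [param_chart x₀ hxs] at h3
  exact h3.symm

variable [MeasurableSpace M] [BorelSpace M] [SecondCountableTopology M]

lemma isWeakGradient_grad {f : M → ℝ} (hf : ContMDiff (𝓡 n) 𝓘(ℝ, ℝ) 1 f) :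
    IsWeakGradient G.inner f (grad G f) := by
  intro x₀
  have ho := (chartAt (Eucl n) x₀).open_target
  have hc := contDiffOn_comp_param (by simp) hf x₀
  have h1 : LocallyIntegrableOn (fun y => f (param x₀ y)) (chartAt (Eucl n) x₀).target volume :=
    hc.continuousOn.locallyIntegrableOn ho.measurableSet
  refine ⟨h1, fun i => ?_⟩
  have h2 : LocallyIntegrableOn (partialD i (fun y => f (param x₀ y)))
      (chartAt (Eucl n) x₀).target volume :=
    (continuousOn_partialD ho hc i).locallyIntegrableOn ho.measurableSet
  have h3 : ∀ y ∈ (chartAt (Eucl n) x₀).target, partialD i (fun y => f (param x₀ y)) y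
      = G.inner (param x₀ y) (grad G f (param x₀ y)) (coordVec x₀ y i) :=
    fun y hy => (inner_grad_coordVec hf x₀ hy i).symm
  constructor
  · refine h2.congr ?_
    filter_upwards [ae_restrict_mem ho.measurableSet] with y hy using h3 y hy
  · intro η a1 a2 a3
    have i1 := integrable_mul_of_hasCompactSupport h1
      (continuous_partialD (a1.of_le (by simp)) i) (hasCompactSupport_partialD a2 i)
      ((tsupport_partialD_subset i).trans a3)
    have i2 := integrable_mul_of_hasCompactSupport h1 a1.continuous a2 a3
    have i3 := integrable_mul_of_hasCompactSupport h2 a1.continuous a2 a3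
    -- Differentiability is needed only on the support of the other factor, so the values of `f ∘
    -- param x₀` outside the chart target do not matter.
    have h4 := integral_mul_fderiv_eq_neg_fderiv_mul_of_integrable i3 i1 i2
      (fun y hy => (hc.contDiffAt (ho.mem_nhds (a3 hy))).differentiableAt one_ne_zero)
      (fun y _ => (a1.differentiable (by simp)) y)
    refine h4.trans ?_
    congr 1
    refine integral_congr_ae (ae_of_all _ fun y => ?_)
    by_cases hy : y ∈ tsupport η
    · exact congrArg (· * η y) (h3 y (a3 hy))
    · simp [image_eq_zero_of_notMem_tsupport hy]

lemma measField_grad {f : M → ℝ} (hf : ContMDiff (𝓡 n) 𝓘(ℝ, ℝ) 1 f) :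
    MeasField G (grad G f) :=
  (isWeakGradient_grad hf).measField

end Gradient

/-! ### The Laplacian of a test function and Green's formula against `C¹` functions. -/

section Laplacian

lemma indicator_eventuallyEq {X : Type*} [TopologicalSpace X] [T2Space X] {U K : Set X}
    (hK : IsCompact K) {F : X → ℝ} (hF : ∀ y ∈ U, y ∉ K → F y = 0) {y : X} (hy : y ∉ K) :
    U.indicator F =ᶠ[𝓝 y] fun _ => 0 := by
  filter_upwards [hK.isClosed.isOpen_compl.mem_nhds hy] with z hz
  by_cases hzU : z ∈ U
  · rw [indicator_of_mem hzU, hF z hzU hz]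
  · rw [indicator_of_notMem hzU]

lemma contDiff_indicator {E : Type*} [NormedAddCommGroup E] [NormedSpace ℝ E] {U K : Set E}
    (hU : IsOpen U) (hK : IsCompact K) (hKU : K ⊆ U) {F : E → ℝ} {k : ℕ∞ω}
    (hFc : ContDiffOn ℝ k F U) (hF : ∀ y ∈ U, y ∉ K → F y = 0) :
    ContDiff ℝ k (U.indicator F) := by
  refine contDiff_iff_contDiffAt.2 fun y => ?_
  by_cases hy : y ∈ K
  · refine (hFc.contDiffAt (hU.mem_nhds (hKU hy))).congr_of_eventuallyEq ?_
    filter_upwards [hU.mem_nhds (hKU hy)] with z hz using indicator_of_mem hz F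
  · exact contDiffAt_const.congr_of_eventuallyEq (indicator_eventuallyEq hK hF hy)

lemma continuous_indicator {X : Type*} [TopologicalSpace X] [T2Space X] {U K : Set X}
    (hU : IsOpen U) (hK : IsCompact K) (hKU : K ⊆ U) {F : X → ℝ}
    (hFc : ContinuousOn F U) (hF : ∀ y ∈ U, y ∉ K → F y = 0) :
    Continuous (U.indicator F) := by
  refine continuous_iff_continuousAt.2 fun y => ?_
  by_cases hy : y ∈ K
  · refine (hFc.continuousAt (hU.mem_nhds (hKU hy))).congr ?_
    filter_upwards [hU.mem_nhds (hKU hy)] with z hz using (indicator_of_mem hz F).symm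
  · exact continuousAt_const.congr (indicator_eventuallyEq hK hF hy).symm

lemma tsupport_indicator_subset {X : Type*} [TopologicalSpace X] [T2Space X] {U K : Set X}
    (hK : IsCompact K) {F : X → ℝ} (hF : ∀ y ∈ U, y ∉ K → F y = 0) :
    tsupport (U.indicator F) ⊆ K := by
  intro y hy
  by_contra h
  exact notMem_tsupport_iff_eventuallyEq.2 (indicator_eventuallyEq hK hF h) hy

variable {n : ℕ} {M : Type*} [TopologicalSpace M] [ChartedSpace (Eucl n) M]
  [IsManifold (𝓡 n) ∞ M] [MeasurableSpace M] [BorelSpace M] [SecondCountableTopology M]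
  {G : Bundle.ContMDiffRiemannianMetric (𝓡 n) ∞ (Eucl n) (fun x : M => TangentSpace (𝓡 n) x)}

lemma setIntegral_chart (x₀ : M) {F : M → ℝ} (hF : AEStronglyMeasurable F (vol G.inner)) :
    ∫ x in (chartAt (Eucl n) x₀).source, F x ∂(vol G.inner)
      = ∫ y in (chartAt (Eucl n) x₀).target, √(gram G.inner x₀ y).det * F (param x₀ y) := by
  have h1 := hF.mono_measure (Measure.restrict_le_self (s := (chartAt (Eucl n) x₀).source))
  rw [vol_restrict_source] at h1 ⊢
  unfold chartVolume at h1 ⊢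
  rw [integral_map ((aemeasurable_param x₀).mono_ac (withDensity_absolutelyContinuous _ _)) h1,
    integral_withDensity_eq_integral_toReal_smul₀ (aemeasurable_density G x₀)
      (ae_of_all _ fun _ => ENNReal.ofReal_lt_top)]
  simp only [ENNReal.toReal_ofReal (Real.sqrt_nonneg _), smul_eq_mul]

lemma integral_chart (x₀ : M) {F : M → ℝ} (hF : AEStronglyMeasurable F (vol G.inner))
    (hs : ∀ x ∉ (chartAt (Eucl n) x₀).source, F x = 0) :
    ∫ x, F x ∂(vol G.inner)
      = ∫ y in (chartAt (Eucl n) x₀).target, √(gram G.inner x₀ y).det * F (param x₀ y) := by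
  rw [← setIntegral_chart x₀ hF, setIntegral_eq_integral_of_forall_compl_eq_zero hs]

lemma grad_add {f h : M → ℝ} (hf : ContMDiff (𝓡 n) 𝓘(ℝ, ℝ) 1 f)
    (hh : ContMDiff (𝓡 n) 𝓘(ℝ, ℝ) 1 h) (x : M) :
    grad G (fun x => f x + h x) x = grad G f x + grad G h x := by
  have h1 := grad_sub (G := G) hf (h := fun x => -1 * h x) (contMDiff_const.mul hh) x
  rw [grad_const_mul hh] at h1
  simpa using h1

lemma grad_finsetSum {ι : Type*} (s : Finset ι) {f : ι → M → ℝ}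
    (hf : ∀ i, ContMDiff (𝓡 n) 𝓘(ℝ, ℝ) 1 (f i)) (x : M) :
    grad G (fun x => ∑ i ∈ s, f i x) x = ∑ i ∈ s, grad G (f i) x := by
  classical
  induction s using Finset.induction_on with
  | empty => simpa using grad_const (G := G) 0 x
  | insert i s hi ih =>
    simp only [Finset.sum_insert hi]
    rw [grad_add (hf i) (contMDiff_finsetSum fun j _ => hf j), ih]

variable [T2Space M]

/-- The classical formula `L = det^{-1/2} ∑ⱼ ∂ⱼ(√det ∑ᵢ g^{ij} ∂ᵢψ)`. The fluxes in the brackets are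
smooth with compact support in the chart. They can serve as test functions for the weak gradient of
`f`, so `f` itself needs only one derivative. -/
lemma exists_laplacian_of_subset_source {ψ : M → ℝ} (hψ : IsTest n ψ) (x₀ : M)
    (hs : tsupport ψ ⊆ (chartAt (Eucl n) x₀).source) :
    ∃ L : M → ℝ, Continuous L ∧ HasCompactSupport L ∧
      ∀ f : M → ℝ, ContMDiff (𝓡 n) 𝓘(ℝ, ℝ) 1 f →
        ∫ x, ip G (grad G ψ) (grad G f) x ∂(vol G.inner) = - ∫ x, f x * L x ∂(vol G.inner) := by
  set e := chartAt (Eucl n) x₀ with he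
  have ho : IsOpen e.target := e.open_target
  have hψ1 : ContMDiff (𝓡 n) 𝓘(ℝ, ℝ) 1 ψ := hψ.1.of_le (by simp)
  set K : Set (Eucl n) := e '' tsupport ψ with hKdef
  have hK : IsCompact K := hψ.2.isCompact.image_of_continuousOn (e.continuousOn.mono hs)
  have hKU : K ⊆ e.target := by
    rintro _ ⟨x, hx, rfl⟩
    exact e.map_source (hs hx)
  have hψK : ∀ y ∈ e.target, y ∉ K → param x₀ y ∉ tsupport ψ := by
    intro y hy hyK h
    exact hyK ⟨param x₀ y, h, chart_param x₀ hy⟩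
  have hψc : ContDiffOn ℝ ∞ (fun y => ψ (param x₀ y)) e.target :=
    contDiffOn_comp_param le_rfl hψ.1 x₀
  have hd : ∀ i, ContDiffOn ℝ ∞ (partialD i fun y => ψ (param x₀ y)) e.target := fun i =>
    (hψc.fderiv_of_isOpen ho (by simp)).clm_apply contDiffOn_const
  have hd0 : ∀ i, ∀ y ∈ e.target, y ∉ K → partialD i (fun y => ψ (param x₀ y)) y = 0 := by
    intro i y hy hyK
    rw [← inner_grad_coordVec (G := G) hψ1 x₀ hy,
      grad_eq_zero_of_notMem_tsupport (hψK y hy hyK)]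
    simp
  -- The `j`-th component of the flux, supported in the image `K` of the support of `ψ`. Cutting it
  -- off outside the chart target leaves it smooth.
  let F : Fin n → Eucl n → ℝ := fun j y => √(gram G.inner x₀ y).det *
    ∑ i, (gram G.inner x₀ y)⁻¹ i j * partialD i (fun y => ψ (param x₀ y)) y
  have hFc : ∀ j, ContDiffOn ℝ ∞ (F j) e.target := fun j =>
    (contDiffOn_sqrt_gram_det x₀).mul
      (ContDiffOn.sum fun i _ => (contDiffOn_gram_inv x₀ i j).mul (hd i))
  have hF0 : ∀ j, ∀ y ∈ e.target, y ∉ K → F j y = 0 := by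
    intro j y hy hyK
    simp only [F, hd0 _ y hy hyK, mul_zero, Finset.sum_const_zero]
  let η : Fin n → Eucl n → ℝ := fun j => e.target.indicator (F j)
  have hη : ∀ j, ContDiff ℝ ∞ (η j) := fun j => contDiff_indicator ho hK hKU (hFc j) (hF0 j)
  have hηs : ∀ j, tsupport (η j) ⊆ K := fun j => tsupport_indicator_subset hK (hF0 j)
  have hηc : ∀ j, HasCompactSupport (η j) := fun j =>
    HasCompactSupport.of_support_subset_isCompact hK ((subset_tsupport _).trans (hηs j))
  have hη1 : ∀ j, Continuous (partialD j (η j)) := fun j =>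
    continuous_partialD ((hη j).of_le (by simp)) j
  have hη0 : ∀ j, ∀ y ∉ K, partialD j (η j) y = 0 := fun j y hy =>
    image_eq_zero_of_notMem_tsupport fun h => hy (hηs j (tsupport_partialD_subset j h))
  -- The divergence of the flux divided by the volume density, so that the density cancels in the
  -- integral over the chart.
  let Q : M → ℝ := fun x => (√(gram G.inner x₀ (e x)).det)⁻¹ * ∑ j, partialD j (η j) (e x)
  have hQ0 : ∀ x ∈ e.source, x ∉ tsupport ψ → Q x = 0 := by
    intro x hx hxs
    have hxK : e x ∉ K := by
      rintro ⟨z, hz, hzx⟩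
      exact hxs (e.injOn (hs hz) hx hzx ▸ hz)
    simp only [Q, hη0 _ _ hxK, Finset.sum_const_zero, mul_zero]
  have hQc : ContinuousOn Q e.source := by
    refine ContinuousOn.mul (ContinuousOn.inv₀ ?_ fun x hx => ?_) ?_
    · exact (contDiffOn_sqrt_gram_det (G := G) x₀).continuousOn.comp e.continuousOn e.mapsTo
    · exact (Real.sqrt_pos.2 (gram_det_pos G x₀ (e.map_source hx))).ne'
    · exact continuousOn_finsetSum _ fun j _ => (hη1 j).comp_continuousOn e.continuousOn
  have hLc := continuous_indicator e.open_source hψ.2.isCompact hs hQc hQ0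
  refine ⟨e.source.indicator Q, hLc,
    HasCompactSupport.of_support_subset_isCompact hψ.2.isCompact
      ((subset_tsupport _).trans (tsupport_indicator_subset hψ.2.isCompact hQ0)),
    fun f hf => ?_⟩
  have hfc := contDiffOn_comp_param (by simp) hf x₀
  have hw := isWeakGradient_grad (G := G) hf x₀
  have hip := continuous_ip_grad (G := G) hψ1 hf
  have ip0 : ∀ x ∉ e.source, ip G (grad G ψ) (grad G f) x = 0 := by
    intro x hx
    rw [ip, grad_eq_zero_of_notMem_tsupport fun h => hx (hs h)]
    simp
  have q0 : ∀ x ∉ e.source, f x * e.source.indicator Q x = 0 := by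
    intro x hx
    rw [indicator_of_notMem hx, mul_zero]
  have hfm : Continuous fun x => f x * e.source.indicator Q x := hf.continuous.mul hLc
  rw [integral_chart x₀ hip.measurable.aestronglyMeasurable ip0,
    integral_chart x₀ hfm.measurable.aestronglyMeasurable q0]
  have e1 : ∫ y in e.target, √(gram G.inner x₀ y).det * ip G (grad G ψ) (grad G f) (param x₀ y)
      = ∑ j, ∫ y, G.inner (param x₀ y) (grad G f (param x₀ y)) (coordVec x₀ y j) * η j y := by
    rw [← integral_finsetSum _ fun j _ => integrable_mul_of_hasCompactSupport ((hw.2 j).1)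
      (hη j).continuous (hηc j) ((hηs j).trans hKU), ← integral_indicator ho.measurableSet]
    refine integral_congr_ae (ae_of_all _ fun y => ?_)
    by_cases hy : y ∈ e.target
    · simp only [indicator_of_mem hy, η, F, ip_grad_eq hψ1 hf x₀ hy,
        inner_grad_coordVec hf x₀ hy, Finset.mul_sum]
      rw [Finset.sum_comm]
      exact Finset.sum_congr rfl fun i _ => Finset.sum_congr rfl fun j _ => by ring
    · simp only [indicator_of_notMem hy, η, mul_zero, Finset.sum_const_zero]
  have e2 : ∫ y in e.target, √(gram G.inner x₀ y).det *
      (f (param x₀ y) * e.source.indicator Q (param x₀ y))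
      = ∑ j, ∫ y, f (param x₀ y) * partialD j (η j) y := by
    rw [← integral_finsetSum _ fun j _ => integrable_mul_of_hasCompactSupport hw.1
      (hη1 j) (hasCompactSupport_partialD (hηc j) j)
      ((tsupport_partialD_subset j).trans ((hηs j).trans hKU)),
      ← integral_indicator ho.measurableSet]
    refine integral_congr_ae (ae_of_all _ fun y => ?_)
    by_cases hy : y ∈ e.target
    · have h3 := (Real.sqrt_pos.2 (gram_det_pos G x₀ hy)).ne'
      have h4 : e.source.indicator Q (param x₀ y)
          = (√(gram G.inner x₀ y).det)⁻¹ * ∑ j, partialD j (η j) y := by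
        rw [indicator_of_mem (param_mem_source x₀ hy)]
        simp only [Q, show e (param x₀ y) = y from chart_param x₀ hy]
      rw [indicator_of_mem hy, h4]
      simp only [← Finset.mul_sum]
      field_simp
    · have : ∀ j, partialD j (η j) y = 0 := fun j => hη0 j y fun h => hy (hKU h)
      simp only [indicator_of_notMem hy, this, mul_zero, Finset.sum_const_zero]
  rw [e1, e2, ← Finset.sum_neg_distrib]
  refine Finset.sum_congr rfl fun j _ => ?_
  rw [(hw.2 j).2 (η j) (hη j) (hηc j) ((hηs j).trans hKU), neg_neg]

lemma IsTest.mul {ψ f : M → ℝ} (hψ : IsTest n ψ) (hf : ContMDiff (𝓡 n) 𝓘(ℝ, ℝ) ∞ f) :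
    IsTest n (fun x => f x * ψ x) :=
  ⟨hf.mul hψ.1, hψ.2.mul_left⟩

/-- The Laplacian of a test function, in the weak sense. -/
lemma exists_laplacian [IsFiniteMeasure (vol G.inner)] {ψ : M → ℝ} (hψ : IsTest n ψ) :
    ∃ L : M → ℝ, Continuous L ∧ HasCompactSupport L ∧
      ∀ f : M → ℝ, ContMDiff (𝓡 n) 𝓘(ℝ, ℝ) 1 f →
        ∫ x, ip G (grad G ψ) (grad G f) x ∂(vol G.inner) = - ∫ x, f x * L x ∂(vol G.inner) := by
  have := ChartedSpace.locallyCompactSpace (Eucl n) M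
  -- Only finitely many members of the partition meet the compact support of `ψ`, so `ψ` is a finite
  -- sum of test functions that each live in one chart.
  obtain ⟨ρ, hρ⟩ := SmoothPartitionOfUnity.exists_isSubordinate_chartAt_source (𝓡 n) M
  have hfin := ρ.locallyFinite.finite_nonempty_inter_compact hψ.2.isCompact
  set s := hfin.toFinset with hsdef
  have hsum : ∀ x, ψ x = ∑ i ∈ s, ρ i x * ψ x := by
    intro x
    by_cases hx : x ∈ tsupport ψ
    · have h1 := ρ.sum_eq_one (mem_univ x)
      have h2 : (Function.support fun i => ρ i x) ⊆ s := by
        intro i hi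
        simp only [hsdef, Finite.coe_toFinset, mem_ofPred_eq]
        exact ⟨x, hi, hx⟩
      rw [finsum_eq_sum_of_support_subset _ h2] at h1
      rw [← Finset.sum_mul, h1, one_mul]
    · rw [image_eq_zero_of_notMem_tsupport hx]; simp
  have ht : ∀ i, IsTest n (fun x => ρ i x * ψ x) := fun i => hψ.mul (ρ i).contMDiff
  have hloc : ∀ i, tsupport (fun x => ρ i x * ψ x) ⊆ (chartAt (Eucl n) i).source := fun i =>
    (tsupport_mul_subset_left).trans (hρ i)
  choose L hLc hLs hL using fun i => exists_laplacian_of_subset_source (G := G) (ht i) i (hloc i)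
  refine ⟨fun x => ∑ i ∈ s, L i x, continuous_finsetSum _ fun i _ => hLc i, ?_, fun f hf => ?_⟩
  · have : (fun x => ∑ i ∈ s, L i x) = ∑ i ∈ s, L i := by ext x; simp
    rw [this]
    exact Finset.sum_induction _ (HasCompactSupport (α := M) (β := ℝ))
      (fun a b ha hb => ha.add hb) HasCompactSupport.zero (fun i _ => hLs i)
  · have h1 : ∀ i, ContMDiff (𝓡 n) 𝓘(ℝ, ℝ) 1 fun x => ρ i x * ψ x := fun i =>
      (ht i).1.of_le (by simp)
    have hg : ∀ x, ip G (grad G ψ) (grad G f) x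
        = ∑ i ∈ s, ip G (grad G fun x => ρ i x * ψ x) (grad G f) x := by
      intro x
      have h2 : ψ = fun x => ∑ i ∈ s, ρ i x * ψ x := funext hsum
      conv_lhs => rw [h2]
      simp only [ip, grad_finsetSum s h1, map_sum, _root_.sum_apply]
    simp only [hg, Finset.mul_sum]
    rw [integral_finsetSum, integral_finsetSum, ← Finset.sum_neg_distrib]
    · exact Finset.sum_congr rfl fun i _ => hL i f hf
    · intro i _
      exact (hf.continuous.mul (hLc i)).integrable_of_hasCompactSupport (hLs i).mul_left
    · intro i _
      refine (continuous_ip_grad (h1 i) hf).integrable_of_hasCompactSupport ?_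
      refine HasCompactSupport.of_support_subset_isCompact (ht i).2.isCompact fun x hx => ?_
      by_contra h
      refine hx ?_
      rw [ip, grad_eq_zero_of_notMem_tsupport h]
      simp

end Laplacian

/-! ### Pointwise Cauchy–Schwarz and triangle inequalities for vector fields. -/

section Norm

variable {n : ℕ} {M : Type*} [TopologicalSpace M] [ChartedSpace (Eucl n) M]
  [IsManifold (𝓡 n) ∞ M]
  (G : Bundle.ContMDiffRiemannianMetric (𝓡 n) ∞ (Eucl n) (fun x : M => TangentSpace (𝓡 n) x))

lemma inner_mul_inner_le (x : M) (v w : TangentSpace (𝓡 n) x) :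
    G.inner x v w ^ 2 ≤ G.inner x v v * G.inner x w w := by
  by_cases hv : v = 0
  · subst hv; simp
  have hp := G.pos x v hv
  have h := inner_self_nonneg G x (w - (G.inner x v w / G.inner x v v) • v)
  simp only [map_sub, map_smul, _root_.sub_apply, _root_.smul_apply, smul_eq_mul,
    G.symm x w v] at h
  have h2 : G.inner x v w / G.inner x v v * G.inner x v v = G.inner x v w := by field_simp
  have h3 : 0 ≤ G.inner x w w - G.inner x v w / G.inner x v v * G.inner x v w := by
    linarith [congrArg (fun r => G.inner x v w / G.inner x v v * r) h2]
  have h4 : G.inner x v v * (G.inner x v w / G.inner x v v * G.inner x v w)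
      = G.inner x v w ^ 2 := by
    rw [← h2]; field_simp
  nlinarith [mul_nonneg hp.le h3]

/-- The pointwise norm of a vector field. -/
def nrm (X : ∀ x : M, TangentSpace (𝓡 n) x) (x : M) : ℝ := √(ip G X X x)

variable {G} (X Y : ∀ x : M, TangentSpace (𝓡 n) x) (x : M)

lemma ip_comm : ip G X Y x = ip G Y X x := G.symm x _ _

lemma nrm_nonneg : 0 ≤ nrm G X x := Real.sqrt_nonneg _

lemma nrm_sq : nrm G X x ^ 2 = ip G X X x := Real.sq_sqrt (inner_self_nonneg G x _)

lemma abs_ip_le : |ip G X Y x| ≤ nrm G X x * nrm G Y x := by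
  refine abs_le_of_sq_le_sq ?_ (mul_nonneg (nrm_nonneg X x) (nrm_nonneg Y x))
  rw [mul_pow, nrm_sq, nrm_sq]
  exact inner_mul_inner_le G x _ _

lemma nrm_add_le : nrm G (fun x => X x + Y x) x ≤ nrm G X x + nrm G Y x := by
  refine abs_le_of_sq_le_sq' ?_ (add_nonneg (nrm_nonneg X x) (nrm_nonneg Y x)) |>.2
  have h := (abs_le.1 (abs_ip_le (G := G) X Y x)).2
  have h2 : ip G (fun x => X x + Y x) (fun x => X x + Y x) x
      = ip G X X x + 2 * ip G X Y x + ip G Y Y x := by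
    simp only [ip, map_add, _root_.add_apply, G.symm x (Y x) (X x)]; ring
  rw [nrm_sq, h2, add_sq, nrm_sq, nrm_sq]
  linarith

lemma nrm_smul (φ : M → ℝ) : nrm G (fun x => φ x • X x) x = |φ x| * nrm G X x := by
  have h : ip G (fun x => φ x • X x) (fun x => φ x • X x) x = φ x ^ 2 * ip G X X x := by
    simp only [ip, map_smul, _root_.smul_apply, smul_eq_mul]; ring
  rw [nrm, h, Real.sqrt_mul (sq_nonneg _), Real.sqrt_sq_eq_abs, nrm]

lemma nrm_sub_comm : nrm G (fun x => X x - Y x) x = nrm G (fun x => Y x - X x) x := by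
  have : ip G (fun x => X x - Y x) (fun x => X x - Y x) x
      = ip G (fun x => Y x - X x) (fun x => Y x - X x) x := by
    simp only [ip, map_sub, _root_.sub_apply]; ring
  rw [nrm, this, nrm]

variable {X Y} [MeasurableSpace M] [BorelSpace M] [SecondCountableTopology M]

lemma MeasField.nrm (hX : MeasField G X) : AEStronglyMeasurable (nrm G X) (vol G.inner) :=
  Real.continuous_sqrt.comp_aestronglyMeasurable (hX.ip hX)

end Norm

/-! ### Limits of integrals of products in which two factors converge in `L²`. -/

section Pairing

variable {α : Type*} {m0 : MeasurableSpace α} {μ : Measure α}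

lemma lintegral_ofReal_sq (f : α → ℝ) :
    ∫⁻ x, ENNReal.ofReal (f x ^ 2) ∂μ = eLpNorm f 2 μ ^ 2 := by
  have h := eLpNorm_nnreal_pow_eq_lintegral (f := f) (μ := μ) (p := (2 : ℝ≥0)) (by norm_num)
  have e : ((2 : ℝ≥0) : ℝ≥0∞) = 2 := by norm_num
  simp only [e, NNReal.coe_ofNat, ENNReal.rpow_ofNat] at h
  rw [h]
  refine lintegral_congr fun x => ?_
  rw [← sq_abs, ENNReal.ofReal_pow (abs_nonneg _), ← Real.norm_eq_abs, ofReal_norm]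

lemma lintegral_enorm_mul_le {f g : α → ℝ} (hf : AEStronglyMeasurable f μ)
    (hg : AEStronglyMeasurable g μ) :
    ∫⁻ x, ‖f x‖ₑ * ‖g x‖ₑ ∂μ ≤ eLpNorm f 2 μ * eLpNorm g 2 μ := by
  have h := eLpNorm_smul_le_mul_eLpNorm (p := 2) (q := 2) (r := 1) hg hf
  rw [eLpNorm_one_eq_lintegral_enorm] at h
  simpa [enorm_mul] using h

lemma integrable_mul_mul {a f g : α → ℝ} {K : ℝ} (ha : AEStronglyMeasurable a μ)
    (hK : ∀ᵐ x ∂μ, |a x| ≤ K) (hf : MemLp f 2 μ) (hg : MemLp g 2 μ) :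
    Integrable (fun x => a x * f x * g x) μ := by
  have := (hf.integrable_mul hg).bdd_mul (c := K) ha hK
  exact this.congr (ae_of_all _ fun x => by simp [mul_assoc])

lemma tendsto_zero_of_sq {ι : Type*} {l : Filter ι} {f : ι → ℝ≥0∞}
    (h : Tendsto (fun i => f i ^ 2) l (𝓝 0)) : Tendsto f l (𝓝 0) := by
  rw [ENNReal.tendsto_nhds_zero] at h ⊢
  intro ε hε
  filter_upwards [h (ε ^ 2) (ENNReal.pow_pos hε 2)] with i hi
  exact (ENNReal.pow_le_pow_left_iff two_ne_zero).1 hi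

/-- The common core of the limit theorems for products of functions and for inner products of
fields. The terms with `p` or `q` tend to zero in `L¹` by Cauchy–Schwarz. The coefficient error `d`
is bounded and tends to zero only almost everywhere, and it is handled by dominated convergence with
the majorant `D |P| |Q|`. -/
lemma tendsto_integral_of_pairing {ι : Type*} {l : Filter ι} [l.IsCountablyGenerated]
    {h : ι → α → ℝ} {h₀ P Q : α → ℝ} {p q d : ι → α → ℝ} {K D : ℝ} (hK : 0 ≤ K)
    (hhm : ∀ᶠ i in l, AEStronglyMeasurable (h i) μ) (hh₀ : Integrable h₀ μ)
    (hP : MemLp P 2 μ) (hQ : MemLp Q 2 μ)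
    (hpm : ∀ᶠ i in l, AEStronglyMeasurable (p i) μ) (hqm : ∀ᶠ i in l, AEStronglyMeasurable (q i) μ)
    (hdm : ∀ᶠ i in l, AEStronglyMeasurable (d i) μ)
    (hp : Tendsto (fun i => eLpNorm (p i) 2 μ) l (𝓝 0))
    (hq : Tendsto (fun i => eLpNorm (q i) 2 μ) l (𝓝 0))
    (hdD : ∀ᶠ i in l, ∀ᵐ x ∂μ, |d i x| ≤ D)
    (hd : ∀ᵐ x ∂μ, Tendsto (fun i => d i x) l (𝓝 0))
    (hb : ∀ᶠ i in l, ∀ᵐ x ∂μ, |h i x - h₀ x|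
      ≤ K * (|p i x| * |Q x| + |P x| * |q i x| + |p i x| * |q i x|) + |d i x| * (|P x| * |Q x|)) :
    Tendsto (fun i => ∫ x, h i x ∂μ) l (𝓝 (∫ x, h₀ x ∂μ)) := by
  have hPQ : Integrable (fun x => |P x| * |Q x|) μ := by
    simpa [abs_mul] using (hP.integrable_mul hQ).abs
  have hd0 : Tendsto (fun i => ∫⁻ x, ENNReal.ofReal (|d i x| * (|P x| * |Q x|)) ∂μ) l (𝓝 0) := by
    have := tendsto_lintegral_filter_of_dominated_convergence' (μ := μ) (l := l)
      (F := fun i x => ENNReal.ofReal (|d i x| * (|P x| * |Q x|))) (f := fun _ => 0)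
      (fun x => ENNReal.ofReal (D * (|P x| * |Q x|))) ?_ ?_ ?_ ?_
    · simpa using this
    · filter_upwards [hdm] with i hi
      exact ((hi.norm.mul hPQ.1).aemeasurable).ennreal_ofReal
    · filter_upwards [hdD] with i hi
      filter_upwards [hi] with x hx
      exact ENNReal.ofReal_le_ofReal (mul_le_mul_of_nonneg_right hx (by positivity))
    · exact ((hPQ.const_mul D).lintegral_lt_top).ne
    · filter_upwards [hd] with x hx
      have := ENNReal.tendsto_ofReal ((hx.abs).mul_const (|P x| * |Q x|))
      simpa using this
  have hlim : Tendsto (fun i => ENNReal.ofReal K * (eLpNorm (p i) 2 μ * eLpNorm Q 2 μ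
      + eLpNorm P 2 μ * eLpNorm (q i) 2 μ + eLpNorm (p i) 2 μ * eLpNorm (q i) 2 μ)
      + ∫⁻ x, ENNReal.ofReal (|d i x| * (|P x| * |Q x|)) ∂μ) l (𝓝 0) := by
    have h1 := ENNReal.Tendsto.mul_const (b := eLpNorm Q 2 μ) hp (Or.inr hQ.2.ne)
    have h2 := ENNReal.Tendsto.const_mul (a := eLpNorm P 2 μ) hq (Or.inr hP.2.ne)
    have h3 := ENNReal.Tendsto.mul hp (Or.inr ENNReal.zero_ne_top) hq (Or.inr ENNReal.zero_ne_top)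
    have h4 := (ENNReal.Tendsto.const_mul (a := ENNReal.ofReal K) ((h1.add h2).add h3)
      (Or.inr ENNReal.ofReal_ne_top)).add hd0
    simpa using h4
  have key : ∀ᶠ i in l, ∫⁻ x, ‖h i x - h₀ x‖ₑ ∂μ
      ≤ ENNReal.ofReal K * (eLpNorm (p i) 2 μ * eLpNorm Q 2 μ
      + eLpNorm P 2 μ * eLpNorm (q i) 2 μ + eLpNorm (p i) 2 μ * eLpNorm (q i) 2 μ)
      + ∫⁻ x, ENNReal.ofReal (|d i x| * (|P x| * |Q x|)) ∂μ := by
    filter_upwards [hb, hpm, hqm, hdm] with i hi hpi hqi hdi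
    have hm1 : AEMeasurable (fun x => ‖p i x‖ₑ * ‖Q x‖ₑ) μ := hpi.enorm.mul hQ.1.enorm
    have hm2 : AEMeasurable (fun x => ‖P x‖ₑ * ‖q i x‖ₑ) μ := hP.1.enorm.mul hqi.enorm
    have hm3 : AEMeasurable (fun x => ‖p i x‖ₑ * ‖q i x‖ₑ) μ := hpi.enorm.mul hqi.enorm
    have hm4 : AEMeasurable (fun x => ENNReal.ofReal (|d i x| * (|P x| * |Q x|))) μ :=
      ((hdi.norm.mul hPQ.1).aemeasurable).ennreal_ofReal
    calc ∫⁻ x, ‖h i x - h₀ x‖ₑ ∂μ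
        ≤ ∫⁻ x, (ENNReal.ofReal K * (‖p i x‖ₑ * ‖Q x‖ₑ + ‖P x‖ₑ * ‖q i x‖ₑ
          + ‖p i x‖ₑ * ‖q i x‖ₑ) + ENNReal.ofReal (|d i x| * (|P x| * |Q x|))) ∂μ := by
          refine lintegral_mono_ae ?_
          filter_upwards [hi] with x hx
          rw [← ofReal_norm, Real.norm_eq_abs]
          refine (ENNReal.ofReal_le_ofReal hx).trans ?_
          rw [ENNReal.ofReal_add (by positivity) (by positivity), ENNReal.ofReal_mul hK,
            ENNReal.ofReal_add (by positivity) (by positivity),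
            ENNReal.ofReal_add (by positivity) (by positivity)]
          simp only [ENNReal.ofReal_mul (abs_nonneg _)]
          simp only [← Real.norm_eq_abs, ofReal_norm]
          exact le_rfl
      _ = ENNReal.ofReal K * ((∫⁻ x, ‖p i x‖ₑ * ‖Q x‖ₑ ∂μ) + (∫⁻ x, ‖P x‖ₑ * ‖q i x‖ₑ ∂μ)
          + (∫⁻ x, ‖p i x‖ₑ * ‖q i x‖ₑ ∂μ)) + ∫⁻ x, ENNReal.ofReal (|d i x| * (|P x| * |Q x|)) ∂μ := by
          rw [lintegral_add_right' _ hm4, lintegral_const_mul' _ _ ENNReal.ofReal_ne_top,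
            lintegral_add_right' _ hm3, lintegral_add_right' _ hm2]
      _ ≤ _ := by
          gcongr
          · exact lintegral_enorm_mul_le hpi hQ.1
          · exact lintegral_enorm_mul_le hP.1 hqi
          · exact lintegral_enorm_mul_le hpi hqi
  have hfin : Tendsto (fun i => ∫⁻ x, ‖h i x - h₀ x‖ₑ ∂μ) l (𝓝 0) :=
    tendsto_of_tendsto_of_tendsto_of_le_of_le' tendsto_const_nhds hlim
      (Eventually.of_forall fun _ => zero_le) key
  refine tendsto_integral_of_L1 h₀ hh₀.1 ?_ hfin
  filter_upwards [hhm, hfin.eventually (gt_mem_nhds ENNReal.zero_lt_top)] with i hi hlt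
  have : Integrable (fun x => h i x - h₀ x) μ := ⟨hi.sub hh₀.1, hlt⟩
  exact (this.add hh₀).congr (ae_of_all _ fun x => by simp)

/-- Limits of trilinear pairings: bounded and pointwise almost everywhere in the first slot, `L²` in
the others. -/
lemma tendsto_integral_mul_mul {ι : Type*} {l : Filter ι} [l.IsCountablyGenerated]
    {a f g : ι → α → ℝ} {a₀ f₀ g₀ : α → ℝ} {K : ℝ}
    (ham : ∀ᶠ i in l, AEStronglyMeasurable (a i) μ) (ha₀ : AEStronglyMeasurable a₀ μ)
    (haK : ∀ᶠ i in l, ∀ᵐ x ∂μ, |a i x| ≤ K) (ha₀K : ∀ᵐ x ∂μ, |a₀ x| ≤ K)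
    (ha : ∀ᵐ x ∂μ, Tendsto (fun i => a i x) l (𝓝 (a₀ x)))
    (hfm : ∀ᶠ i in l, AEStronglyMeasurable (f i) μ) (hf₀ : MemLp f₀ 2 μ)
    (hf : Tendsto (fun i => eLpNorm (fun x => f i x - f₀ x) 2 μ) l (𝓝 0))
    (hgm : ∀ᶠ i in l, AEStronglyMeasurable (g i) μ) (hg₀ : MemLp g₀ 2 μ)
    (hg : Tendsto (fun i => eLpNorm (fun x => g i x - g₀ x) 2 μ) l (𝓝 0)) :
    Tendsto (fun i => ∫ x, a i x * f i x * g i x ∂μ) l (𝓝 (∫ x, a₀ x * f₀ x * g₀ x ∂μ)) := by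
  refine tendsto_integral_of_pairing (K := |K|) (D := K + K) (P := f₀) (Q := g₀)
    (p := fun i x => f i x - f₀ x) (q := fun i x => g i x - g₀ x) (d := fun i x => a i x - a₀ x)
    (abs_nonneg _) ?_ (integrable_mul_mul ha₀ ha₀K hf₀ hg₀) hf₀ hg₀ ?_ ?_ ?_ hf hg ?_ ?_ ?_
  · filter_upwards [ham, hfm, hgm] with i h1 h2 h3 using (h1.mul h2).mul h3
  · filter_upwards [hfm] with i h using h.sub hf₀.1
  · filter_upwards [hgm] with i h using h.sub hg₀.1
  · filter_upwards [ham] with i h using h.sub ha₀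
  · filter_upwards [haK] with i h
    filter_upwards [h, ha₀K] with x h1 h2 using (abs_sub _ _).trans (add_le_add h1 h2)
  · filter_upwards [ha] with x h
    simpa using h.sub_const (a₀ x)
  · filter_upwards [haK] with i h
    filter_upwards [h] with x h1
    have e : a i x * f i x * g i x - a₀ x * f₀ x * g₀ x
        = a i x * ((f i x - f₀ x) * g₀ x + f₀ x * (g i x - g₀ x)
          + (f i x - f₀ x) * (g i x - g₀ x)) + (a i x - a₀ x) * (f₀ x * g₀ x) := by ring
    rw [e]
    refine (abs_add_le _ _).trans (add_le_add ?_ (by rw [abs_mul, abs_mul (f₀ x)]))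
    rw [abs_mul]
    refine mul_le_mul (h1.trans (le_abs_self K)) ?_ (abs_nonneg _) (abs_nonneg _)
    refine (abs_add_le _ _).trans (add_le_add ((abs_add_le _ _).trans ?_) (by rw [abs_mul]))
    rw [abs_mul, abs_mul]

/-- Products of functions that are bounded and converge almost everywhere with functions that
converge in `L²`. -/
lemma tendsto_eLpNorm_mul_sub {ι : Type*} {l : Filter ι} [l.IsCountablyGenerated]
    {a f : ι → α → ℝ} {a₀ f₀ : α → ℝ} {K : ℝ}
    (ham : ∀ᶠ i in l, AEStronglyMeasurable (a i) μ) (ha₀ : AEStronglyMeasurable a₀ μ)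
    (haK : ∀ᶠ i in l, ∀ᵐ x ∂μ, |a i x| ≤ K) (ha₀K : ∀ᵐ x ∂μ, |a₀ x| ≤ K)
    (ha : ∀ᵐ x ∂μ, Tendsto (fun i => a i x) l (𝓝 (a₀ x)))
    (hfm : ∀ᶠ i in l, AEStronglyMeasurable (f i) μ) (hf₀ : MemLp f₀ 2 μ)
    (hf : Tendsto (fun i => eLpNorm (fun x => f i x - f₀ x) 2 μ) l (𝓝 0)) :
    Tendsto (fun i => eLpNorm (fun x => a i x * f i x - a₀ x * f₀ x) 2 μ) l (𝓝 0) := by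
  have h1 : Tendsto (fun i => ENNReal.ofReal K * eLpNorm (fun x => f i x - f₀ x) 2 μ) l (𝓝 0) := by
    simpa using ENNReal.Tendsto.const_mul (a := ENNReal.ofReal K) hf (Or.inr ENNReal.ofReal_ne_top)
  have h2 : Tendsto (fun i => eLpNorm (fun x => (a i x - a₀ x) * f₀ x) 2 μ) l (𝓝 0) := by
    have : Tendsto (fun i => ∫⁻ x, ENNReal.ofReal (((a i x - a₀ x) * f₀ x) ^ 2) ∂μ) l (𝓝 0) := by
      have := tendsto_lintegral_filter_of_dominated_convergence' (μ := μ) (l := l)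
        (F := fun i x => ENNReal.ofReal (((a i x - a₀ x) * f₀ x) ^ 2)) (f := fun _ => 0)
        (fun x => ENNReal.ofReal ((K + K) ^ 2 * f₀ x ^ 2)) ?_ ?_ ?_ ?_
      · simpa using this
      · filter_upwards [ham] with i hi
        exact ((((hi.sub ha₀).mul hf₀.1).pow 2).aemeasurable).ennreal_ofReal
      · filter_upwards [haK] with i hi
        filter_upwards [hi, ha₀K] with x hx hx0
        refine ENNReal.ofReal_le_ofReal ?_
        rw [mul_pow]
        refine mul_le_mul_of_nonneg_right ?_ (sq_nonneg _)
        rw [← sq_abs]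
        exact pow_le_pow_left₀ (abs_nonneg _) ((abs_sub _ _).trans (add_le_add hx hx0)) 2
      · exact ((hf₀.integrable_sq.const_mul _).lintegral_lt_top).ne
      · filter_upwards [ha] with x hx
        have := ENNReal.tendsto_ofReal ((((hx.sub_const (a₀ x)).mul_const (f₀ x))).pow 2)
        simpa using this
    simp only [lintegral_ofReal_sq] at this
    exact tendsto_zero_of_sq this
  have h3 := h1.add h2
  rw [add_zero] at h3
  refine tendsto_of_tendsto_of_tendsto_of_le_of_le' tendsto_const_nhds h3
    (Eventually.of_forall fun _ => zero_le) ?_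
  filter_upwards [ham, haK, hfm] with i hi hiK hfi
  have e : (fun x => a i x * f i x - a₀ x * f₀ x)
      = (fun x => a i x * (f i x - f₀ x)) + fun x => (a i x - a₀ x) * f₀ x := by
    ext x; simp only [Pi.add_apply]; ring
  rw [e]
  refine (eLpNorm_add_le (hi.mul (hfi.sub hf₀.1)) ((hi.sub ha₀).mul hf₀.1) (by norm_num)).trans ?_
  refine add_le_add ?_ le_rfl
  refine eLpNorm_le_mul_eLpNorm_of_ae_le_mul ?_ 2
  filter_upwards [hiK] with x hx
  simp only [Pi.mul_apply, Pi.sub_apply, norm_mul]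
  exact mul_le_mul_of_nonneg_right hx (norm_nonneg _)

end Pairing

/-! ### The same limits for inner products of vector fields. -/

section FieldPairing

variable {n : ℕ} {M : Type*} [TopologicalSpace M] [ChartedSpace (Eucl n) M]
  [IsManifold (𝓡 n) ∞ M] [MeasurableSpace M] [BorelSpace M] [SecondCountableTopology M]
  {G : Bundle.ContMDiffRiemannianMetric (𝓡 n) ∞ (Eucl n) (fun x : M => TangentSpace (𝓡 n) x)}

lemma lintegral_ip_eq_eLpNorm (X : ∀ x : M, TangentSpace (𝓡 n) x) :
    ∫⁻ x, ENNReal.ofReal (G.inner x (X x) (X x)) ∂(vol G.inner)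
      = eLpNorm (nrm G X) 2 (vol G.inner) ^ 2 := by
  rw [← lintegral_ofReal_sq]
  simp only [nrm_sq]
  rfl

lemma integrable_mul_ip {a : M → ℝ} {X Y : ∀ x : M, TangentSpace (𝓡 n) x} {K : ℝ}
    (ha : AEStronglyMeasurable a (vol G.inner)) (hK : ∀ᵐ x ∂(vol G.inner), |a x| ≤ K)
    (hX : MeasField G X) (hX2 : MemLp (nrm G X) 2 (vol G.inner))
    (hY : MeasField G Y) (hY2 : MemLp (nrm G Y) 2 (vol G.inner)) :
    Integrable (fun x => a x * ip G X Y x) (vol G.inner) := by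
  refine (integrable_mul_mul ha hK hX2 hY2).mono (ha.mul (hX.ip hY)) (ae_of_all _ fun x => ?_)
  rw [mul_assoc, norm_mul, norm_mul (a x), norm_mul (nrm G X x)]
  gcongr
  simpa [abs_of_nonneg (nrm_nonneg _ _)] using abs_ip_le (G := G) X Y x

lemma tendsto_integral_mul_ip {ι : Type*} {l : Filter ι} [l.IsCountablyGenerated]
    {a : ι → M → ℝ} {a₀ : M → ℝ} {X Y : ι → ∀ x : M, TangentSpace (𝓡 n) x}
    {X₀ Y₀ : ∀ x : M, TangentSpace (𝓡 n) x} {K : ℝ}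
    (ham : ∀ᶠ i in l, AEStronglyMeasurable (a i) (vol G.inner))
    (ha₀ : AEStronglyMeasurable a₀ (vol G.inner))
    (haK : ∀ᶠ i in l, ∀ᵐ x ∂(vol G.inner), |a i x| ≤ K) (ha₀K : ∀ᵐ x ∂(vol G.inner), |a₀ x| ≤ K)
    (ha : ∀ᵐ x ∂(vol G.inner), Tendsto (fun i => a i x) l (𝓝 (a₀ x)))
    (hXm : ∀ᶠ i in l, MeasField G (X i)) (hX₀ : MeasField G X₀)
    (hX₀2 : MemLp (nrm G X₀) 2 (vol G.inner))
    (hX : Tendsto (fun i => eLpNorm (nrm G fun x => X i x - X₀ x) 2 (vol G.inner)) l (𝓝 0))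
    (hYm : ∀ᶠ i in l, MeasField G (Y i)) (hY₀ : MeasField G Y₀)
    (hY₀2 : MemLp (nrm G Y₀) 2 (vol G.inner))
    (hY : Tendsto (fun i => eLpNorm (nrm G fun x => Y i x - Y₀ x) 2 (vol G.inner)) l (𝓝 0)) :
    Tendsto (fun i => ∫ x, a i x * ip G (X i) (Y i) x ∂(vol G.inner)) l
      (𝓝 (∫ x, a₀ x * ip G X₀ Y₀ x ∂(vol G.inner))) := by
  refine tendsto_integral_of_pairing (K := |K|) (D := K + K) (P := nrm G X₀) (Q := nrm G Y₀)
    (p := fun i => nrm G fun x => X i x - X₀ x) (q := fun i => nrm G fun x => Y i x - Y₀ x)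
    (d := fun i x => a i x - a₀ x)
    (abs_nonneg _) ?_ (integrable_mul_ip ha₀ ha₀K hX₀ hX₀2 hY₀ hY₀2) hX₀2 hY₀2 ?_ ?_ ?_ hX hY ?_ ?_ ?_
  · filter_upwards [ham, hXm, hYm] with i h1 h2 h3 using h1.mul (h2.ip h3)
  · filter_upwards [hXm] with i h using (h.sub hX₀).nrm
  · filter_upwards [hYm] with i h using (h.sub hY₀).nrm
  · filter_upwards [ham] with i h using h.sub ha₀
  · filter_upwards [haK] with i h
    filter_upwards [h, ha₀K] with x h1 h2 using (abs_sub _ _).trans (add_le_add h1 h2)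
  · filter_upwards [ha] with x h
    simpa using h.sub_const (a₀ x)
  · filter_upwards [haK] with i h
    filter_upwards [h] with x h1
    have e : a i x * ip G (X i) (Y i) x - a₀ x * ip G X₀ Y₀ x
        = a i x * (ip G (fun x => X i x - X₀ x) Y₀ x + ip G X₀ (fun x => Y i x - Y₀ x) x
          + ip G (fun x => X i x - X₀ x) (fun x => Y i x - Y₀ x) x)
          + (a i x - a₀ x) * ip G X₀ Y₀ x := by
      simp only [ip, map_sub, _root_.sub_apply]; ring
    rw [e]
    have hn (Z W : ∀ x : M, TangentSpace (𝓡 n) x) : |ip G Z W x| ≤ |nrm G Z x| * |nrm G W x| := by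
      rw [abs_of_nonneg (nrm_nonneg _ _), abs_of_nonneg (nrm_nonneg _ _)]
      exact abs_ip_le Z W x
    refine (abs_add_le _ _).trans (add_le_add ?_ ?_)
    · rw [abs_mul]
      refine mul_le_mul (h1.trans (le_abs_self K)) ?_ (abs_nonneg _) (abs_nonneg _)
      exact (abs_add_le _ _).trans (add_le_add ((abs_add_le _ _).trans
        (add_le_add (hn _ _) (hn _ _))) (hn _ _))
    · rw [abs_mul]
      exact mul_le_mul_of_nonneg_left (hn _ _) (abs_nonneg _)

end FieldPairing

/-! ### Approximation of Sobolev functions, and of bounded ones, by test functions. -/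

section Approximation

variable {n : ℕ} {M : Type*} [TopologicalSpace M] [ChartedSpace (Eucl n) M]
  [IsManifold (𝓡 n) ∞ M] [MeasurableSpace M] [BorelSpace M] [SecondCountableTopology M]
  {G : Bundle.ContMDiffRiemannianMetric (𝓡 n) ∞ (Eucl n) (fun x : M => TangentSpace (𝓡 n) x)}
  {v w : M → ℝ} {X Y : ∀ x : M, TangentSpace (𝓡 n) x}

lemma IsWeakGradient.dirichlet_eq (h : IsWeakGradient G.inner v X) :
    dirichlet G.inner v = eLpNorm (nrm G X) 2 (vol G.inner) ^ 2 := by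
  refine le_antisymm ?_ ?_
  · refine (iInf₂_le X h).trans ?_
    rw [lintegral_ip_eq_eLpNorm]
  · refine le_iInf₂ fun Y hY => ?_
    rw [← lintegral_ip_eq_eLpNorm]
    refine lintegral_mono_ae ?_
    filter_upwards [h.ae_eq hY] with x hx
    rw [hx]

lemma IsWeakGradient.h1Norm_eq (h : IsWeakGradient G.inner v X) :
    h1Norm G.inner v ^ 2
      = eLpNorm v 2 (vol G.inner) ^ 2 + eLpNorm (nrm G X) 2 (vol G.inner) ^ 2 := by
  rw [h1Norm, h.dirichlet_eq, lintegral_ofReal_sq, ← ENNReal.rpow_natCast (_ ^ (1 / 2 : ℝ)),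
    ← ENNReal.rpow_mul]
  norm_num

lemma eLpNorm_le_h1Norm (m : MetricField n M) (v : M → ℝ) :
    eLpNorm v 2 (vol m) ≤ h1Norm m v := by
  rw [← ENNReal.pow_le_pow_left_iff two_ne_zero, h1Norm, ← ENNReal.rpow_natCast (_ ^ (1 / 2 : ℝ)),
    ← ENNReal.rpow_mul, lintegral_ofReal_sq]
  norm_num

lemma IsWeakGradient.eLpNorm_nrm_le (h : IsWeakGradient G.inner v X) :
    eLpNorm (nrm G X) 2 (vol G.inner) ≤ h1Norm G.inner v := by
  rw [← ENNReal.pow_le_pow_left_iff two_ne_zero, h.h1Norm_eq]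
  exact le_add_self

/-- An infimum over no competitors is `∞`, so a finite Sobolev norm forces a weak gradient to exist.
By uniqueness that gradient computes the norm. -/
lemma MemH1.exists_isWeakGradient (h : MemH1 G.inner v) :
    MemLp v 2 (vol G.inner) ∧ ∃ X, IsWeakGradient G.inner v X ∧
      MemLp (nrm G X) 2 (vol G.inner) := by
  have h1 : dirichlet G.inner v < ⊤ := by
    by_contra hc
    rw [not_lt_top_iff] at hc
    simp [MemH1, h1Norm, hc] at h
  obtain ⟨X, hX⟩ : ∃ X, IsWeakGradient G.inner v X := by
    by_contra hc
    push Not at hc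
    simp [dirichlet, hc] at h1
  exact ⟨⟨hX.aestronglyMeasurable, (eLpNorm_le_h1Norm _ v).trans_lt h⟩, X, hX,
    ⟨hX.measField.nrm, hX.eLpNorm_nrm_le.trans_lt h⟩⟩

lemma IsTest.contMDiff {ψ : M → ℝ} (hψ : IsTest n ψ) : ContMDiff (𝓡 n) 𝓘(ℝ, ℝ) 1 ψ :=
  hψ.1.of_le (by simp)

lemma IsTest.aestronglyMeasurable {ψ : M → ℝ} (hψ : IsTest n ψ) {μ : Measure M} :
    AEStronglyMeasurable ψ μ :=
  hψ.1.continuous.aestronglyMeasurable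

variable (G) in
/-- The test functions `ψ j` converge to `v` in `L²` and almost everywhere, and their gradients
converge to `X` in `L²`. -/
structure Approx (v : M → ℝ) (X : ∀ x : M, TangentSpace (𝓡 n) x) (ψ : ℕ → M → ℝ) : Prop where
  test : ∀ j, IsTest n (ψ j)
  memLp : MemLp v 2 (vol G.inner)
  field : MeasField G X
  memLp_nrm : MemLp (nrm G X) 2 (vol G.inner)
  tendsto : Tendsto (fun j => eLpNorm (fun x => ψ j x - v x) 2 (vol G.inner)) atTop (𝓝 0)
  tendsto_ae : ∀ᵐ x ∂(vol G.inner), Tendsto (fun j => ψ j x) atTop (𝓝 (v x))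
  tendsto_grad : Tendsto (fun j => eLpNorm (nrm G fun x => grad G (ψ j) x - X x) 2 (vol G.inner))
    atTop (𝓝 0)

variable (G) in
/-- The test functions `ψ j` are bounded and converge to `v` almost everywhere, and their gradients
converge to `X` in `L²`. -/
structure BApprox (v : M → ℝ) (X : ∀ x : M, TangentSpace (𝓡 n) x) (ψ : ℕ → M → ℝ) : Prop where
  test : ∀ j, IsTest n (ψ j)
  bound : ∃ K, ∀ j x, |ψ j x| ≤ K
  field : MeasField G X
  memLp_nrm : MemLp (nrm G X) 2 (vol G.inner)
  tendsto_ae : ∀ᵐ x ∂(vol G.inner), Tendsto (fun j => ψ j x) atTop (𝓝 (v x))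
  tendsto_grad : Tendsto (fun j => eLpNorm (nrm G fun x => grad G (ψ j) x - X x) 2 (vol G.inner))
    atTop (𝓝 0)

lemma exists_approx (hd : TestDenseInH1 G.inner) (hX : IsWeakGradient G.inner v X)
    (hv : MemLp v 2 (vol G.inner)) (hX2 : MemLp (nrm G X) 2 (vol G.inner)) :
    ∃ ψ, Approx G v X ψ := by
  have hm : MemH1 G.inner v := by
    have : h1Norm G.inner v ^ 2 < ⊤ := by
      rw [hX.h1Norm_eq]
      exact ENNReal.add_lt_top.2 ⟨ENNReal.pow_lt_top hv.2, ENNReal.pow_lt_top hX2.2⟩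
    exact (ENNReal.pow_lt_top_iff.1 this).resolve_right (by norm_num)
  -- The tolerance at `j = 0` is `∞`. This is harmless, since only positivity and the limit are
  -- used.
  obtain ⟨e, he0, he⟩ : ∃ e : ℕ → ℝ≥0∞, (∀ j, 0 < e j) ∧ Tendsto e atTop (𝓝 0) :=
    ⟨fun j => ((j : ℝ≥0∞))⁻¹, fun j => ENNReal.inv_pos.2 (ENNReal.natCast_ne_top j),
      ENNReal.tendsto_inv_nat_nhds_zero⟩
  choose ψ hψ hψe using fun j => hd v hm (e j) (he0 j)
  have hw : ∀ j, IsWeakGradient G.inner (v - ψ j) (fun x => X x - grad G (ψ j) x) :=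
    fun j => hX.sub (isWeakGradient_grad (hψ j).contMDiff)
  have t1 : Tendsto (fun j => eLpNorm (fun x => ψ j x - v x) 2 (vol G.inner)) atTop (𝓝 0) := by
    refine tendsto_of_tendsto_of_tendsto_of_le_of_le tendsto_const_nhds he
      (fun _ => zero_le) fun j => ?_
    refine le_trans ?_ ((eLpNorm_le_h1Norm _ _).trans (hψe j).le)
    rw [← eLpNorm_neg]
    exact le_of_eq (congrArg (fun f => eLpNorm f 2 (vol G.inner)) (by ext x; simp))
  have t2 : Tendsto (fun j => eLpNorm (nrm G fun x => grad G (ψ j) x - X x) 2 (vol G.inner))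
      atTop (𝓝 0) := by
    refine tendsto_of_tendsto_of_tendsto_of_le_of_le tendsto_const_nhds he
      (fun _ => zero_le) fun j => ?_
    refine le_trans ?_ ((hw j).eLpNorm_nrm_le.trans (hψe j).le)
    exact le_of_eq (congrArg (fun f => eLpNorm f 2 (vol G.inner))
      (funext fun x => nrm_sub_comm _ _ _))
  obtain ⟨ns, hns, hae⟩ := (tendstoInMeasure_of_tendsto_eLpNorm two_ne_zero
    (fun j => (hψ j).aestronglyMeasurable) hv.1 t1).exists_seq_tendsto_ae
  exact ⟨fun j => ψ (ns j), fun j => hψ _, hv, hX.measField, hX2, t1.comp hns.tendsto_atTop, hae,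
    t2.comp hns.tendsto_atTop⟩

lemma tendsto_eLpNorm_nrm_smul {ι : Type*} {l : Filter ι} [l.IsCountablyGenerated]
    {a : ι → M → ℝ} {a₀ : M → ℝ} {X : ι → ∀ x : M, TangentSpace (𝓡 n) x}
    {X₀ : ∀ x : M, TangentSpace (𝓡 n) x} {K : ℝ}
    (ham : ∀ i, AEStronglyMeasurable (a i) (vol G.inner))
    (ha₀ : AEStronglyMeasurable a₀ (vol G.inner))
    (haK : ∀ i, ∀ᵐ x ∂(vol G.inner), |a i x| ≤ K) (ha₀K : ∀ᵐ x ∂(vol G.inner), |a₀ x| ≤ K)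
    (ha : ∀ᵐ x ∂(vol G.inner), Tendsto (fun i => a i x) l (𝓝 (a₀ x)))
    (hXm : ∀ i, MeasField G (X i)) (hX₀ : MeasField G X₀)
    (hX₀2 : MemLp (nrm G X₀) 2 (vol G.inner))
    (hX : Tendsto (fun i => eLpNorm (nrm G fun x => X i x - X₀ x) 2 (vol G.inner)) l (𝓝 0)) :
    Tendsto (fun i => eLpNorm (nrm G fun x => a i x • X i x - a₀ x • X₀ x) 2 (vol G.inner))
      l (𝓝 0) := by
  have h1 := tendsto_eLpNorm_mul_sub (μ := vol G.inner) (f := fun _ => nrm G X₀) (f₀ := nrm G X₀)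
    (Eventually.of_forall ham) ha₀ (Eventually.of_forall haK) ha₀K ha
    (Eventually.of_forall fun _ => hX₀.nrm) hX₀2 (by simpa using tendsto_const_nhds)
  have h2 : Tendsto (fun i => ENNReal.ofReal K *
      eLpNorm (nrm G fun x => X i x - X₀ x) 2 (vol G.inner)) l (𝓝 0) := by
    simpa using ENNReal.Tendsto.const_mul (a := ENNReal.ofReal K) hX (Or.inr ENNReal.ofReal_ne_top)
  have h3 := h2.add h1
  rw [add_zero] at h3
  refine tendsto_of_tendsto_of_tendsto_of_le_of_le tendsto_const_nhds h3 (fun _ => zero_le)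
    fun i => ?_
  have hb : ∀ x, nrm G (fun x => a i x • X i x - a₀ x • X₀ x) x
      ≤ |a i x| * nrm G (fun x => X i x - X₀ x) x + |a i x * nrm G X₀ x - a₀ x * nrm G X₀ x| := by
    intro x
    have e : (fun x => a i x • X i x - a₀ x • X₀ x)
        = fun x => a i x • (X i x - X₀ x) + (a i x - a₀ x) • X₀ x := by
      funext x; rw [smul_sub, sub_smul]; abel
    rw [e]
    refine (nrm_add_le _ _ x).trans ?_
    rw [nrm_smul (fun x => X i x - X₀ x) x (a i), nrm_smul X₀ x (fun x => a i x - a₀ x), ← sub_mul,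
      abs_mul, abs_of_nonneg (nrm_nonneg X₀ x)]
  calc eLpNorm (nrm G fun x => a i x • X i x - a₀ x • X₀ x) 2 (vol G.inner)
      ≤ eLpNorm ((fun x => |a i x| * nrm G (fun x => X i x - X₀ x) x)
        + fun x => |a i x * nrm G X₀ x - a₀ x * nrm G X₀ x|) 2 (vol G.inner) := ?_
    _ ≤ eLpNorm (fun x => |a i x| * nrm G (fun x => X i x - X₀ x) x) 2 (vol G.inner)
        + eLpNorm (fun x => |a i x * nrm G X₀ x - a₀ x * nrm G X₀ x|) 2 (vol G.inner) :=
          eLpNorm_add_le ((ham i).norm.mul ((hXm i).sub hX₀).nrm)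
            (((ham i).mul hX₀.nrm).sub (ha₀.mul hX₀.nrm)).norm (by norm_num)
    _ ≤ _ := ?_
  · refine eLpNorm_mono_real fun x => ?_
    rw [Real.norm_eq_abs, abs_of_nonneg (nrm_nonneg _ _)]
    exact hb x
  · refine add_le_add (eLpNorm_le_mul_eLpNorm_of_ae_le_mul ?_ 2)
      (eLpNorm_norm (fun x => a i x * nrm G X₀ x - a₀ x * nrm G X₀ x)).le
    filter_upwards [haK i] with x hx
    rw [norm_mul, Real.norm_eq_abs, abs_abs]
    exact mul_le_mul_of_nonneg_right hx (norm_nonneg _)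

/-- The chain rule in `H¹`: `F'(ψⱼ)` is bounded and converges almost everywhere, while the gradients
converge in `L²`. The condition `F 0 = 0` preserves compact support, and boundedness of `F` makes
the approximants uniformly bounded. -/
lemma Approx.comp (h : Approx G v X ψ) {F : ℝ → ℝ} (hF : ContDiff ℝ ∞ F) (hF0 : F 0 = 0) {K C : ℝ}
    (hK : ∀ y, |F y| ≤ K) (hC : ∀ y, |deriv F y| ≤ C) :
    BApprox G (fun x => F (v x)) (fun x => deriv F (v x) • X x) (fun j x => F (ψ j x)) := by
  have hF' : Continuous (deriv F) := hF.continuous_deriv (by simp)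
  have hv : AEStronglyMeasurable (fun x => deriv F (v x)) (vol G.inner) :=
    hF'.comp_aestronglyMeasurable h.memLp.1
  have hg : ∀ j, grad G (fun x => F (ψ j x)) = fun x => deriv F (ψ j x) • grad G (ψ j) x :=
    fun j => funext fun x => grad_comp (h.test j).contMDiff x
      (hF.differentiable (by simp) _).hasDerivAt
  refine ⟨fun j => ⟨hF.contMDiff.comp (h.test j).1, (h.test j).2.comp_left hF0⟩,
    ⟨K, fun j x => hK _⟩, h.field.smul hv, ?_, ?_, ?_⟩
  · refine (h.memLp_nrm.const_mul C).mono (h.field.smul hv).nrm (ae_of_all _ fun x => ?_)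
    rw [nrm_smul X x (fun x => deriv F (v x)), Real.norm_eq_abs, Real.norm_eq_abs, abs_mul, abs_mul,
      abs_abs]
    exact mul_le_mul_of_nonneg_right ((hC _).trans (le_abs_self C)) (abs_nonneg _)
  · filter_upwards [h.tendsto_ae] with x hx
    exact (hF.continuous.tendsto _).comp hx
  · simp only [hg]
    refine tendsto_eLpNorm_nrm_smul (K := C) (fun j => ?_) hv (fun j => ae_of_all _ fun x => hC _)
      (ae_of_all _ fun x => hC _) ?_ (fun j => measField_grad (h.test j).contMDiff) h.field
      h.memLp_nrm h.tendsto_grad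
    · exact hF'.comp_aestronglyMeasurable (h.test j).aestronglyMeasurable
    · filter_upwards [h.tendsto_ae] with x hx
      exact (hF'.tendsto _).comp hx

lemma BApprox.aestronglyMeasurable (h : BApprox G v X ψ) :
    AEStronglyMeasurable v (vol G.inner) :=
  aestronglyMeasurable_of_tendsto_ae atTop (fun j => (h.test j).aestronglyMeasurable) h.tendsto_ae

lemma BApprox.ae_bound (h : BApprox G v X ψ) :
    ∃ K, 0 ≤ K ∧ (∀ j x, |ψ j x| ≤ K) ∧ ∀ᵐ x ∂(vol G.inner), |v x| ≤ K := by
  obtain ⟨K, hK⟩ := h.bound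
  refine ⟨|K|, abs_nonneg K, fun j x => (hK j x).trans (le_abs_self K), ?_⟩
  filter_upwards [h.tendsto_ae] with x hx
  exact le_of_tendsto hx.abs (Eventually.of_forall fun j => (hK j x).trans (le_abs_self K))

lemma memLp_nrm_grad [T2Space M] [IsFiniteMeasure (vol G.inner)] {f : M → ℝ}
    (hf : ContMDiff (𝓡 n) 𝓘(ℝ, ℝ) 1 f) {η : M → ℝ} (hη : IsTest n η) :
    MemLp (nrm G fun x => η x • grad G f x) 2 (vol G.inner) := by
  have e : (nrm G fun x => η x • grad G f x) = fun x => |η x| * nrm G (grad G f) x :=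
    funext fun x => nrm_smul _ x η
  rw [e]
  refine Continuous.memLp_of_hasCompactSupport ?_ (hη.2.abs.mul_right)
  exact hη.1.continuous.abs.mul (Real.continuous_sqrt.comp (continuous_ip_grad hf hf))

lemma memLp_nrm_grad_of_hasCompactSupport [T2Space M] [IsFiniteMeasure (vol G.inner)] {f : M → ℝ}
    (hf : ContMDiff (𝓡 n) 𝓘(ℝ, ℝ) 1 f) (hc : HasCompactSupport f) :
    MemLp (nrm G (grad G f)) 2 (vol G.inner) := by
  refine Continuous.memLp_of_hasCompactSupport
    (Real.continuous_sqrt.comp (continuous_ip_grad hf hf)) (HasCompactSupport.intro hc fun x hx => ?_)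
  simp [nrm, ip, grad_eq_zero_of_notMem_tsupport hx]

lemma exists_isTest_eq_one [T2Space M] {K : Set M} (hK : IsCompact K) :
    ∃ η, IsTest n η ∧ ∀ x ∈ K, η x = 1 := by
  have := ChartedSpace.locallyCompactSpace (Eucl n) M
  obtain ⟨K', hK', hKK'⟩ := exists_compact_superset hK
  obtain ⟨f, h1, h0, -⟩ := exists_contMDiffMap_one_nhds_of_subset_interior (n := ⊤) (𝓡 n)
    hK.isClosed hKK'
  exact ⟨f, ⟨f.contMDiff, HasCompactSupport.intro hK' h0⟩, fun x hx => h1.self_of_nhdsSet x hx⟩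

/-- Multiplying the identity by a bump function that is `1` near `[-R, R]` gives a smooth compactly
supported function. Composition with it makes approximants bounded without changing a limit bounded
by `R`. -/
lemma exists_truncation (R : ℝ) : ∃ F : ℝ → ℝ, ContDiff ℝ ∞ F ∧ F 0 = 0 ∧
    (∃ K, ∀ y, |F y| ≤ K) ∧ (∃ C, ∀ y, |deriv F y| ≤ C) ∧
    ∀ y, |y| ≤ R → F y = y ∧ deriv F y = 1 := by
  let b : ContDiffBump (0 : ℝ) := ⟨|R| + 1, |R| + 2, by positivity, by linarith⟩
  have hF : ContDiff ℝ ∞ fun y => y * b y := contDiff_id.mul b.contDiff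
  have hc : HasCompactSupport fun y => y * b y := b.hasCompactSupport.mul_left
  refine ⟨fun y => y * b y, hF, by simp, ?_, ?_, fun y hy => ?_⟩
  · exact hF.continuous.bounded_above_of_compact_support hc
  · exact (hF.continuous_deriv (by simp)).bounded_above_of_compact_support hc.deriv
  · have hy' : |y| < |R| + 1 := (hy.trans (le_abs_self R)).trans_lt (lt_add_one _)
    have h1 : (fun y => y * b y) =ᶠ[𝓝 y] id := by
      have : ∀ᶠ z in 𝓝 y, |z| < |R| + 1 := continuous_abs.continuousAt.eventually (gt_mem_nhds hy')
      filter_upwards [this] with z hz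
      rw [b.one_of_mem_closedBall (by simpa using hz.le)]
      simp
    exact ⟨h1.self_of_nhds, by rw [h1.deriv_eq]; simp⟩

/-- Density alone does not control the supports of the approximants. Multiplication by a cutoff `χ`
with `χ f = f` puts them into a fixed compact set, and the gradients still converge by the product
rule. The function `η`, equal to `1` on all the supports, lets one replace a gradient that is only
locally square integrable, such as that of `u`, by `η` times it. -/
lemma exists_bApprox_of_contMDiff [T2Space M] [IsFiniteMeasure (vol G.inner)]
    (hd : TestDenseInH1 G.inner) {f : M → ℝ}
    (hf : ContMDiff (𝓡 n) 𝓘(ℝ, ℝ) 1 f) (hc : HasCompactSupport f) :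
    ∃ ψ η, BApprox G f (grad G f) ψ ∧ IsTest n η ∧ (∀ x ∈ tsupport f, η x = 1) ∧
      ∀ j, ∀ x ∈ tsupport (ψ j), η x = 1 := by
  have hf2 := memLp_nrm_grad_of_hasCompactSupport (G := G) hf hc
  obtain ⟨χ, hχ, hχ1⟩ := exists_isTest_eq_one (n := n) hc.isCompact
  obtain ⟨η, hη, hη1⟩ := exists_isTest_eq_one (n := n) (hc.isCompact.union hχ.2.isCompact)
  obtain ⟨R, hR⟩ := hf.continuous.bounded_above_of_compact_support hc
  obtain ⟨F, hF, hF0, ⟨K, hK⟩, ⟨C, hC⟩, hFR⟩ := exists_truncation R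
  obtain ⟨ψ, hψ⟩ := exists_approx hd (isWeakGradient_grad (G := G) hf)
    (hf.continuous.memLp_of_hasCompactSupport hc) hf2
  have hB := hψ.comp hF hF0 hK hC
  have e1 : (fun x => F (f x)) = f := funext fun x => (hFR _ (hR x)).1
  have e2 : (fun x => deriv F (f x) • grad G f x) = grad G f :=
    funext fun x => by rw [(hFR _ (hR x)).2, one_smul]
  rw [e1, e2] at hB
  obtain ⟨Q, hQ⟩ := hχ.1.continuous.bounded_above_of_compact_support hχ.2
  have hχf : (fun x => χ x * f x) = f := by
    funext x
    by_cases hx : x ∈ tsupport f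
    · rw [hχ1 x hx, one_mul]
    · rw [image_eq_zero_of_notMem_tsupport hx, mul_zero]
  have hg : grad G f = fun x => χ x • grad G f x + f x • grad G χ x := by
    funext x
    conv_lhs => rw [← hχf]
    exact grad_mul hχ.contMDiff hf x
  have hfR : ∀ᵐ x ∂(vol G.inner), |f x| ≤ K :=
    ae_of_all _ fun x => by rw [← (hFR _ (hR x)).1]; exact hK _
  refine ⟨fun j x => χ x * F (ψ j x), η, ⟨fun j => (hB.test j).mul hχ.1, ⟨Q * K, fun j x => ?_⟩,
    hB.field, hB.memLp_nrm, ?_, ?_⟩, hη, fun x hx => hη1 x (Or.inl hx), fun j x hx => hη1 x (Or.inr ?_)⟩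
  · rw [abs_mul]
    exact mul_le_mul (hQ x) (hK _) (abs_nonneg _) ((norm_nonneg _).trans (hQ x))
  · filter_upwards [hB.tendsto_ae] with x hx
    have := hx.const_mul (χ x)
    rwa [congrFun hχf x] at this
  · have t1 := tendsto_eLpNorm_nrm_smul (K := Q) (a := fun _ : ℕ => χ) (a₀ := χ)
      (fun _ => hχ.aestronglyMeasurable) hχ.aestronglyMeasurable (fun _ => ae_of_all _ hQ)
      (ae_of_all _ hQ) (ae_of_all _ fun x => tendsto_const_nhds)
      (fun j => measField_grad (hB.test j).contMDiff) hB.field hB.memLp_nrm hB.tendsto_grad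
    have t2 := tendsto_eLpNorm_nrm_smul (K := K) (a := fun (j : ℕ) x => F (ψ j x)) (a₀ := f)
      (fun j => (hB.test j).aestronglyMeasurable) hf.continuous.aestronglyMeasurable
      (fun _ => ae_of_all _ fun x => hK _)
      hfR hB.tendsto_ae
      (fun j => measField_grad (G := G) hχ.contMDiff) (measField_grad hχ.contMDiff)
      (memLp_nrm_grad_of_hasCompactSupport hχ.contMDiff hχ.2) (by
        have : (nrm G fun x => (0 : TangentSpace (𝓡 n) x)) = 0 := by
          funext x; simp [nrm, ip]
        simp [this])
    have t3 := t1.add t2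
    rw [add_zero] at t3
    refine tendsto_of_tendsto_of_tendsto_of_le_of_le tendsto_const_nhds t3 (fun _ => zero_le)
      fun j => ?_
    have m1 := ((measField_grad (G := G) (hB.test j).contMDiff).smul
      (hχ.aestronglyMeasurable)).sub (hB.field.smul hχ.aestronglyMeasurable)
    have m2 := ((measField_grad (G := G) hχ.contMDiff).smul
      (hB.test j).aestronglyMeasurable).sub ((measField_grad (G := G) hχ.contMDiff).smul
      hf.continuous.aestronglyMeasurable)
    refine le_trans ?_ (eLpNorm_add_le m1.nrm m2.nrm (by norm_num))
    refine eLpNorm_mono_real fun x => ?_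
    rw [Real.norm_eq_abs, abs_of_nonneg (nrm_nonneg _ _)]
    refine le_trans (le_of_eq ?_) (nrm_add_le _ _ x)
    congr 1
    funext x
    rw [grad_mul hχ.contMDiff (hB.test j).contMDiff x]
    conv_lhs => rw [hg]
    dsimp only
    abel
  · exact (tsupport_mul_subset_left) hx

end Approximation

/-! ### Pointwise bounds of the conformal factor from equivalence of the Sobolev norms. -/

section ConformalBound

variable {n : ℕ} {M : Type*} [TopologicalSpace M] [ChartedSpace (Eucl n) M]
  [IsManifold (𝓡 n) ∞ M] [MeasurableSpace M] [BorelSpace M] [SecondCountableTopology M]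
  {G : Bundle.ContMDiffRiemannianMetric (𝓡 n) ∞ (Eucl n) (fun x : M => TangentSpace (𝓡 n) x)}

/-- Needed to infer that a continuous function vanishing almost everywhere is zero, and that a
nonnegative continuous bump has positive integral. -/
instance isOpenPosMeasure_vol : (vol G.inner).IsOpenPosMeasure := by
  refine ⟨fun U hU ⟨x₀, hx₀⟩ h0 => ?_⟩
  have h1 : ∀ᵐ x ∂(vol G.inner), x ∉ U := by
    rw [ae_iff]; simpa using h0
  have h2 := ae_chart G h1 x₀
  have ho := (chartAt (Eucl n) x₀).open_target
  have h3 : IsOpen ((chartAt (Eucl n) x₀).target ∩ param x₀ ⁻¹' U) :=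
    (continuousOn_param x₀).isOpen_inter_preimage ho hU
  have h4 : (volume : Measure (Eucl n)) ((chartAt (Eucl n) x₀).target ∩ param x₀ ⁻¹' U) = 0 := by
    rw [ae_restrict_iff' ho.measurableSet, ae_iff] at h2
    refine measure_mono_null (fun y hy => ?_) h2
    simpa using hy
  refine (h3.measure_pos volume ⟨chartAt (Eucl n) x₀ x₀, mem_chart_target _ x₀, ?_⟩).ne' h4
  rw [mem_preimage, param_chart x₀ (mem_chart_source _ x₀)]
  exact hx₀

lemma exists_isTest_subset [T2Space M] {K U : Set M} (hK : IsCompact K) (hU : IsOpen U)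
    (hKU : K ⊆ U) : ∃ η, IsTest n η ∧ (∀ x ∈ K, η x = 1) ∧ ∀ x ∉ U, η x = 0 := by
  have := ChartedSpace.locallyCompactSpace (Eucl n) M
  obtain ⟨K', hK', hKK', hKU'⟩ := exists_compact_between hK hU hKU
  obtain ⟨f, h1, h0, -⟩ := exists_contMDiffMap_one_nhds_of_subset_interior (n := ⊤) (𝓡 n)
    hK.isClosed hKK'
  exact ⟨f, ⟨f.contMDiff, HasCompactSupport.intro hK' h0⟩, fun x hx => h1.self_of_nhdsSet x hx,
    fun x hx => h0 x fun h => hx (hKU' h)⟩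

/-- A coordinate function, cut off by a bump function that is `1` near the point. It supplies the
phase of the oscillating test functions. -/
lemma exists_grad_ne_zero [T2Space M] (hn : 0 < n) (x₀ : M) :
    ∃ f : M → ℝ, ContMDiff (𝓡 n) 𝓘(ℝ, ℝ) ∞ f ∧ 0 < ip G (grad G f) (grad G f) x₀ := by
  let i : Fin n := ⟨0, hn⟩
  obtain ⟨b⟩ : Nonempty (SmoothBumpFunction (𝓡 n) x₀) := inferInstance
  have hy₀ := mem_chart_target (Eucl n) x₀
  have hf : ContMDiff (𝓡 n) 𝓘(ℝ, ℝ) ∞ fun x => b x • (chartAt (Eucl n) x₀ x) i := by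
    refine b.contMDiff_smul ?_
    have h1 : ContMDiffOn (𝓡 n) (𝓡 n) ∞ (chartAt (Eucl n) x₀) (chartAt (Eucl n) x₀).source :=
      contMDiffOn_chart
    have h2 : ContMDiff (𝓡 n) 𝓘(ℝ, ℝ) ∞ (fun y : Eucl n => y i) :=
      ((EuclideanSpace.proj (𝕜 := ℝ) i).contDiff).contMDiff
    exact h2.comp_contMDiffOn h1
  refine ⟨_, hf, ?_⟩
  have h1 := inner_grad_coordVec (G := G) (hf.of_le (by simp)) x₀ hy₀ i
  have h2 : partialD i (fun z => b (param x₀ z) • (chartAt (Eucl n) x₀ (param x₀ z)) i)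
      (chartAt (Eucl n) x₀ x₀) = 1 := by
    have hc : ContinuousAt (param x₀ : Eucl n → M) (chartAt (Eucl n) x₀ x₀) :=
      (continuousOn_param x₀).continuousAt ((chartAt (Eucl n) x₀).open_target.mem_nhds hy₀)
    have hb : ∀ᶠ z in 𝓝 (chartAt (Eucl n) x₀ x₀), b (param x₀ z) = 1 := by
      have h1 : Tendsto (param x₀) (𝓝 (chartAt (Eucl n) x₀ x₀)) (𝓝 x₀) := by
        simpa only [ContinuousAt, param_chart x₀ (mem_chart_source (Eucl n) x₀)] using hc
      exact h1.eventually b.eventuallyEq_one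
    have he : (fun z => b (param x₀ z) • (chartAt (Eucl n) x₀ (param x₀ z)) i)
        =ᶠ[𝓝 (chartAt (Eucl n) x₀ x₀)] EuclideanSpace.proj (𝕜 := ℝ) i := by
      filter_upwards [hb, (chartAt (Eucl n) x₀).open_target.mem_nhds hy₀] with z hz hzt
      rw [hz, chart_param x₀ hzt, one_smul]
      rfl
    rw [partialD, he.fderiv_eq, ContinuousLinearMap.fderiv]
    simp
  rw [h2, param_chart x₀ (mem_chart_source _ x₀)] at h1
  refine lt_of_le_of_ne (inner_self_nonneg G _ _) fun h0 => ?_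
  rw [inner_self_eq_zero G h0.symm, map_zero] at h1
  exact zero_ne_one h1

variable [T2Space M] [IsFiniteMeasure (vol G.inner)]

lemma integrable_mul_test {f ψ : M → ℝ} (hf : Continuous f) (hψ : IsTest n ψ) :
    Integrable (fun x => ψ x * f x) (vol G.inner) :=
  (hψ.1.continuous.mul hf).integrable_of_hasCompactSupport hψ.2.mul_right

lemma integrable_mul_grad_sq {f ψ : M → ℝ} (hf : Continuous f) (hψ : IsTest n ψ) :
    Integrable (fun x => f x * ip G (grad G ψ) (grad G ψ) x) (vol G.inner) := by
  refine (hf.mul (continuous_ip_grad hψ.contMDiff hψ.contMDiff)).integrable_of_hasCompactSupport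
    (HasCompactSupport.intro hψ.2 fun x hx => ?_)
  simp [ip, grad_eq_zero_of_notMem_tsupport hx]

/-- The squared length of the gradient scales by `w^{-4/(n-2)}` and the volume by `w^{2n/(n-2)}`, so
the Dirichlet integrand is multiplied by `w²`. -/
lemma h1Norm_conformal_sq (hn : 3 ≤ n) {w : M → ℝ} (hw : ∀ x, 0 < w x) (hwc : Continuous w)
    {ψ : M → ℝ} (hψ : IsTest n ψ) :
    h1Norm (conformal G.inner w) ψ ^ 2 = ENNReal.ofReal
      (∫ x, ψ x * (ψ x * w x ^ (2 * (n : ℝ) / ((n : ℝ) - 2))) ∂(vol G.inner)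
        + ∫ x, w x ^ 2 * ip G (grad G ψ) (grad G ψ) x ∂(vol G.inner)) := by
  have hn2 : (0 : ℝ) < (n : ℝ) - 2 := by
    have : (3 : ℝ) ≤ n := by exact_mod_cast hn
    linarith
  have hVc : ∀ a : ℝ, Continuous fun x => w x ^ a := fun a =>
    hwc.rpow_const fun x => Or.inl (hw x).ne'
  have hV := hVc (2 * (n : ℝ) / ((n : ℝ) - 2))
  have hVm : Measurable fun x => ENNReal.ofReal (w x ^ (2 * (n : ℝ) / ((n : ℝ) - 2))) :=
    hV.measurable.ennreal_ofReal
  have hvol := vol_conformal (G := G) hn hw hwc.measurable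
  have hdir : dirichlet (conformal G.inner w) ψ
      = ENNReal.ofReal (∫ x, w x ^ 2 * ip G (grad G ψ) (grad G ψ) x ∂(vol G.inner)) := by
    have hI : Integrable (fun x => w x ^ 2 * ip G (grad G ψ) (grad G ψ) x) (vol G.inner) :=
      integrable_mul_grad_sq (hwc.pow 2) hψ
    rw [ofReal_integral_eq_lintegral_ofReal hI
      (ae_of_all _ fun x => mul_nonneg (sq_nonneg _) (inner_self_nonneg G x _))]
    have key : ∀ X : ∀ x : M, TangentSpace (𝓡 n) x, IsWeakGradient (conformal G.inner w) ψ X →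
        ∫⁻ x, ENNReal.ofReal (conformal G.inner w x (X x) (X x)) ∂(vol (conformal G.inner w))
          = ∫⁻ x, ENNReal.ofReal (w x ^ 2 * ip G (grad G ψ) (grad G ψ) x) ∂(vol G.inner) := by
      intro X hX
      have h1 := (isWeakGradient_conformal_iff.1 hX).ae_eq (isWeakGradient_grad hψ.contMDiff)
      rw [hvol, lintegral_withDensity_eq_lintegral_mul_non_measurable₀ _ hVm.aemeasurable
        (ae_of_all _ fun x => ENNReal.ofReal_lt_top)]
      refine lintegral_congr_ae ?_
      filter_upwards [h1] with x hx
      simp only [Pi.mul_apply]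
      rw [← ENNReal.ofReal_mul (Real.rpow_nonneg (hw x).le _), ip, ← hx]
      congr 1
      simp only [conformal, map_smul, _root_.smul_apply, smul_eq_mul]
      have e : w x ^ (2 * (n : ℝ) / ((n : ℝ) - 2))
          = w x ^ 2 * w x ^ (4 / ((n : ℝ) - 2)) := by
        rw [← Real.rpow_natCast, ← Real.rpow_add (hw x)]
        congr 1
        field_simp
        norm_num
        ring
      rw [e]; ring
    refine le_antisymm ?_ (le_iInf₂ fun X hX => (key X hX).ge)
    have hX : IsWeakGradient (conformal G.inner w) ψ
        (fun x => (w x ^ (4 / ((n : ℝ) - 2)))⁻¹ • grad G ψ x) := by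
      rw [isWeakGradient_conformal_iff]
      refine (isWeakGradient_grad hψ.contMDiff).congr_field fun x => ?_
      rw [smul_smul, mul_inv_cancel₀ (Real.rpow_pos_of_pos (hw x) _).ne', one_smul]
    exact (iInf₂_le _ hX).trans (key _ hX).le
  have hL2 : ∫⁻ x, ENNReal.ofReal (ψ x ^ 2) ∂(vol (conformal G.inner w))
      = ENNReal.ofReal (∫ x, ψ x * (ψ x * w x ^ (2 * (n : ℝ) / ((n : ℝ) - 2))) ∂(vol G.inner)) := by
    have hI : Integrable (fun x => ψ x * (ψ x * w x ^ (2 * (n : ℝ) / ((n : ℝ) - 2))))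
        (vol G.inner) := integrable_mul_test (hψ.1.continuous.mul hV) hψ
    rw [ofReal_integral_eq_lintegral_ofReal hI
      (ae_of_all _ fun x => by
        simp only [Pi.zero_apply]
        rw [← mul_assoc]
        exact mul_nonneg (mul_self_nonneg _) (Real.rpow_nonneg (hw x).le _)), hvol,
      lintegral_withDensity_eq_lintegral_mul_non_measurable₀ _ hVm.aemeasurable
        (ae_of_all _ fun x => ENNReal.ofReal_lt_top)]
    refine lintegral_congr fun x => ?_
    simp only [Pi.mul_apply]
    rw [← ENNReal.ofReal_mul (Real.rpow_nonneg (hw x).le _)]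
    congr 1
    ring
  rw [h1Norm, ← ENNReal.rpow_natCast (_ ^ (1 / 2 : ℝ)), ← ENNReal.rpow_mul, hL2, hdir,
    ENNReal.ofReal_add]
  · norm_num
  · refine integral_nonneg fun x => ?_
    simp only [Pi.zero_apply]
    rw [← mul_assoc]
    exact mul_nonneg (mul_self_nonneg _) (Real.rpow_nonneg (hw x).le _)
  · exact integral_nonneg fun x => mul_nonneg (sq_nonneg _) (inner_self_nonneg G x _)

/-- The oscillating functions `ψ cos (r f)` and `ψ sin (r f)` have jointly the Sobolev norm
`A + r² ∫ w² ψ² |∇f|²`. -/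
lemma exists_oscillating (hn : 3 ≤ n) {ψ f : M → ℝ} (hψ : IsTest n ψ)
    (hf : ContMDiff (𝓡 n) 𝓘(ℝ, ℝ) ∞ f) (r : ℝ) : ∃ a b, IsTest n a ∧ IsTest n b ∧
      ∀ w : M → ℝ, (∀ x, 0 < w x) → Continuous w →
        h1Norm (conformal G.inner w) a ^ 2 + h1Norm (conformal G.inner w) b ^ 2
          = ENNReal.ofReal
            ((∫ x, ψ x * (ψ x * w x ^ (2 * (n : ℝ) / ((n : ℝ) - 2))) ∂(vol G.inner)
              + ∫ x, w x ^ 2 * ip G (grad G ψ) (grad G ψ) x ∂(vol G.inner))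
            + r ^ 2 * ∫ x, ψ x * (ψ x * (w x ^ 2 * ip G (grad G f) (grad G f) x))
                ∂(vol G.inner)) := by
  have hf1 : ContMDiff (𝓡 n) 𝓘(ℝ, ℝ) 1 f := hf.of_le (by simp)
  have hrf : ContMDiff (𝓡 n) 𝓘(ℝ, ℝ) ∞ fun x => r * f x := contMDiff_const.mul hf
  have hc : ContMDiff (𝓡 n) 𝓘(ℝ, ℝ) ∞ fun x => Real.cos (r * f x) :=
    Real.contDiff_cos.contMDiff.comp hrf
  have hs : ContMDiff (𝓡 n) 𝓘(ℝ, ℝ) ∞ fun x => Real.sin (r * f x) :=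
    Real.contDiff_sin.contMDiff.comp hrf
  have ha := hψ.mul hc
  have hb := hψ.mul hs
  refine ⟨_, _, ha, hb, fun w hw hwc => ?_⟩
  have hVc : Continuous fun x => w x ^ (2 * (n : ℝ) / ((n : ℝ) - 2)) :=
    hwc.rpow_const fun x => Or.inl (hw x).ne'
  have hpos : ∀ φ : M → ℝ, 0 ≤ ∫ x, φ x * (φ x * w x ^ (2 * (n : ℝ) / ((n : ℝ) - 2))) ∂(vol G.inner)
        + ∫ x, w x ^ 2 * ip G (grad G φ) (grad G φ) x ∂(vol G.inner) := fun φ =>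
    add_nonneg (integral_nonneg fun x => by
        simp only [Pi.zero_apply]
        rw [← mul_assoc]
        exact mul_nonneg (mul_self_nonneg _) (Real.rpow_nonneg (hw x).le _))
      (integral_nonneg fun x => mul_nonneg (sq_nonneg _) (inner_self_nonneg G x _))
  rw [h1Norm_conformal_sq hn hw hwc ha, h1Norm_conformal_sq hn hw hwc hb,
    ← ENNReal.ofReal_add (hpos _) (hpos _), add_add_add_comm]
  have hcm : ContMDiff (𝓡 n) 𝓘(ℝ, ℝ) 1 fun x => Real.cos (r * f x) := hc.of_le (by simp)
  have hsm : ContMDiff (𝓡 n) 𝓘(ℝ, ℝ) 1 fun x => Real.sin (r * f x) := hs.of_le (by simp)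
  have I0 : ∀ φ : M → ℝ, IsTest n φ →
      Integrable (fun x => φ x * (φ x * w x ^ (2 * (n : ℝ) / ((n : ℝ) - 2)))) (vol G.inner) :=
    fun φ hφ => integrable_mul_test (hφ.1.continuous.mul hVc) hφ
  have I1 : ∀ φ : M → ℝ, IsTest n φ →
      Integrable (fun x => w x ^ 2 * ip G (grad G φ) (grad G φ) x) (vol G.inner) :=
    fun φ hφ => integrable_mul_grad_sq (hwc.pow 2) hφ
  have I2 : Integrable (fun x => ψ x * (ψ x * (w x ^ 2 * ip G (grad G f) (grad G f) x)))
      (vol G.inner) := integrable_mul_test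
    (hψ.1.continuous.mul ((hwc.pow 2).mul (continuous_ip_grad hf1 hf1))) hψ
  rw [add_assoc (∫ x, ψ x * (ψ x * w x ^ (2 * (n : ℝ) / ((n : ℝ) - 2))) ∂(vol G.inner))]
  congr 2
  · rw [← integral_add (I0 _ ha) (I0 _ hb)]
    refine integral_congr_ae (ae_of_all _ fun x => ?_)
    dsimp only
    linear_combination (ψ x * (ψ x * w x ^ (2 * (n : ℝ) / ((n : ℝ) - 2))))
      * Real.sin_sq_add_cos_sq (r * f x)
  · rw [← integral_const_mul, ← integral_add (I1 _ ha) (I1 _ hb),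
      ← integral_add (I1 _ hψ) (I2.const_mul _)]
    refine integral_congr_ae (ae_of_all _ fun x => ?_)
    have h0 : HasDerivAt (fun s => r * s) r (f x) := by
      simpa using (hasDerivAt_id (f x)).const_mul r
    dsimp only [ip]
    rw [grad_mul hcm hψ.contMDiff x, grad_mul hsm hψ.contMDiff x,
      grad_comp (F := fun s => Real.cos (r * s)) hf1 x h0.cos,
      grad_comp (F := fun s => Real.sin (r * s)) hf1 x h0.sin]
    simp only [map_add, map_smul, _root_.add_apply, _root_.smul_apply, smul_eq_mul]
    -- Adding the two functions cancels the cross terms between `∇ψ` and `∇f`, because `sin² + cos²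
    -- = 1`.
    linear_combination (w x ^ 2 * G.inner x (grad G ψ x) (grad G ψ x)
      + ψ x ^ 2 * r ^ 2 * w x ^ 2 * G.inner x (grad G f x) (grad G f x))
      * Real.sin_sq_add_cos_sq (r * f x)

/-- At high frequency `r` the squared norm is dominated by `r² ∫ w² ψ² |∇f|²`, so norm domination
with constant `C` forces `∫ w₁² ψ² |∇f|² ≤ C² ∫ w₂² ψ² |∇f|²`. If the pointwise inequality failed at
`x`, then choosing `ψ` supported where it fails and `∇f ≠ 0` at `x` would contradict this. -/
lemma le_of_forall_h1Norm_le (hn : 3 ≤ n) {w₁ w₂ : M → ℝ} (h₁ : ∀ x, 0 < w₁ x)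
    (h₂ : ∀ x, 0 < w₂ x) (hc₁ : Continuous w₁) (hc₂ : Continuous w₂) {C : ℝ≥0}
    (h : ∀ v, h1Norm (conformal G.inner w₁) v ≤ C * h1Norm (conformal G.inner w₂) v) (x : M) :
    w₁ x ≤ C * w₂ x := by
  by_contra! hx
  have hU : IsOpen {x | C * w₂ x < w₁ x} := isOpen_lt (continuous_const.mul hc₂) hc₁
  obtain ⟨ψ, hψ, hψ1, hψ0⟩ := exists_isTest_subset (n := n) (isCompact_singleton (x := x)) hU
    (by simpa using hx)
  obtain ⟨f, hf, hfx⟩ := exists_grad_ne_zero (G := G) (by omega : 0 < n) x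
  have hf1 : ContMDiff (𝓡 n) 𝓘(ℝ, ℝ) 1 f := hf.of_le (by simp)
  set A : (M → ℝ) → ℝ := fun w =>
    (∫ x, ψ x * (ψ x * w x ^ (2 * (n : ℝ) / ((n : ℝ) - 2))) ∂(vol G.inner)
      + ∫ x, w x ^ 2 * ip G (grad G ψ) (grad G ψ) x ∂(vol G.inner)) with hA
  set B : (M → ℝ) → ℝ := fun w =>
    ∫ x, ψ x * (ψ x * (w x ^ 2 * ip G (grad G f) (grad G f) x)) ∂(vol G.inner) with hB
  have key : ∀ r : ℝ, A w₁ + r ^ 2 * B w₁ ≤ C ^ 2 * (A w₂ + r ^ 2 * B w₂) := by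
    intro r
    obtain ⟨a, b, ha, hb, hab⟩ := exists_oscillating (G := G) hn hψ hf r
    have e1 := hab w₁ h₁ hc₁
    have e2 := hab w₂ h₂ hc₂
    have h3 : h1Norm (conformal G.inner w₁) a ^ 2 + h1Norm (conformal G.inner w₁) b ^ 2
        ≤ C ^ 2 * (h1Norm (conformal G.inner w₂) a ^ 2 + h1Norm (conformal G.inner w₂) b ^ 2) := by
      rw [mul_add, ← mul_pow, ← mul_pow]
      exact add_le_add (pow_le_pow_left' (h a) 2) (pow_le_pow_left' (h b) 2)
    have hnn : 0 ≤ A w₂ + r ^ 2 * B w₂ := by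
      refine add_nonneg (add_nonneg (integral_nonneg fun x => ?_) (integral_nonneg fun x =>
        mul_nonneg (sq_nonneg _) (inner_self_nonneg G x _))) (mul_nonneg (sq_nonneg _)
        (integral_nonneg fun x => ?_))
      · simp only [Pi.zero_apply]
        rw [← mul_assoc]
        exact mul_nonneg (mul_self_nonneg _) (Real.rpow_nonneg (h₂ x).le _)
      · simp only [Pi.zero_apply]
        rw [← mul_assoc]
        exact mul_nonneg (mul_self_nonneg _) (mul_nonneg (sq_nonneg _) (inner_self_nonneg G x _))
    rw [e1, e2, ← ENNReal.ofReal_coe_nnreal, ← ENNReal.ofReal_pow (by positivity),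
      ← ENNReal.ofReal_mul (by positivity)] at h3
    exact (ENNReal.ofReal_le_ofReal_iff (mul_nonneg (by positivity) hnn)).1 h3
  have hpos : 0 < B w₁ - C ^ 2 * B w₂ := by
    have i2 : ∀ w : M → ℝ, Continuous w → Integrable (fun x => ψ x *
        (ψ x * (w x ^ 2 * ip G (grad G f) (grad G f) x))) (vol G.inner) := fun w hw =>
      integrable_mul_test (hψ.1.continuous.mul ((hw.pow 2).mul (continuous_ip_grad hf1 hf1))) hψ
    have i1 : ∀ w : M → ℝ, Continuous w →
        Continuous fun x => ψ x * (w x ^ 2 * ip G (grad G f) (grad G f) x) := fun w hw =>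
      hψ.1.continuous.mul ((hw.pow 2).mul (continuous_ip_grad hf1 hf1))
    rw [hB]
    dsimp only
    rw [← integral_const_mul, ← integral_sub (i2 w₁ hc₁) ((i2 w₂ hc₂).const_mul _)]
    have e : ∀ x, ψ x * (ψ x * (w₁ x ^ 2 * ip G (grad G f) (grad G f) x))
        - C ^ 2 * (ψ x * (ψ x * (w₂ x ^ 2 * ip G (grad G f) (grad G f) x)))
        = ψ x ^ 2 * (w₁ x ^ 2 - (C * w₂ x) ^ 2) * ip G (grad G f) (grad G f) x := fun x => by ring
    have hlt : ∀ y, C * w₂ y < w₁ y → 0 < w₁ y ^ 2 - (C * w₂ y) ^ 2 := fun y hy =>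
      sub_pos.2 (pow_lt_pow_left₀ hy (mul_nonneg C.2 (h₂ y).le) two_ne_zero)
    -- The integrand is nonnegative everywhere because `ψ` vanishes outside the open set where `C w₂
    -- < w₁`.
    refine Continuous.integral_pos_of_hasCompactSupport_nonneg_nonzero (x := x)
      ((hψ.1.continuous.mul (i1 w₁ hc₁)).sub (continuous_const.mul (hψ.1.continuous.mul (i1 w₂ hc₂))))
      (HasCompactSupport.intro hψ.2 fun y hy => ?_) (fun y => ?_) ?_
    · simp [image_eq_zero_of_notMem_tsupport hy]
    · simp only [Pi.zero_apply]
      rw [e]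
      by_cases hy : C * w₂ y < w₁ y
      · exact mul_nonneg (mul_nonneg (sq_nonneg _) (hlt y hy).le) (inner_self_nonneg G y _)
      · simp [hψ0 y hy]
    · rw [e, hψ1 x rfl]
      exact (mul_pos (mul_pos (by norm_num) (hlt x hx)) hfx).ne'
  set D := C ^ 2 * A w₂ - A w₁
  have h4 : ∀ r : ℝ, r ^ 2 * (B w₁ - C ^ 2 * B w₂) ≤ D := fun r => by
    have := key r; simp only [D]; nlinarith
  -- With this frequency the left side of `h4` equals `|D| + 1`, which exceeds `D`.
  have h5 := h4 (√((|D| + 1) / (B w₁ - C ^ 2 * B w₂)))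
  rw [Real.sq_sqrt (by positivity), div_mul_cancel₀ _ hpos.ne'] at h5
  linarith [le_abs_self D]

end ConformalBound

/-! ### Differentiation under the integral sign with derivatives controlled only in `L²`. -/

section TimeDerivative

variable {M : Type*} [TopologicalSpace M] [SecondCountableTopology M] [MeasurableSpace M]
  [BorelSpace M] {μ : Measure M} [IsFiniteMeasure μ] {T : ℝ}

/-- Joint measurability in time and space is what Fubini's theorem requires, while `W` is given
slice by slice. Clamping time to `[0, T]` makes `f` jointly continuous on the whole line, and the
derivative of a continuous family is jointly measurable. -/
lemma exists_measurable_deriv (hT : 0 < T) {f W : ℝ → M → ℝ}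
    (hf : ContinuousOn (fun q : ℝ × M => f q.1 q.2) (Icc 0 T ×ˢ univ))
    (hd : ∀ t ∈ Ioo 0 T, ∀ x, HasDerivAt (fun s => f s x) (W t x) t) :
    ∃ w : ℝ × M → ℝ, Measurable w ∧ ∀ t ∈ Ioo 0 T, ∀ x, w (t, x) = W t x := by
  have hc : Continuous (Function.uncurry fun (x : M) (t : ℝ) => f (projIcc 0 T hT.le t) x) := by
    have h1 : Continuous fun q : M × ℝ => (((projIcc 0 T hT.le q.2 : ℝ), q.1) : ℝ × M) :=
      (continuous_subtype_val.comp (continuous_projIcc.comp continuous_snd)).prodMk continuous_fst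
    exact hf.comp_continuous h1 fun q => ⟨(projIcc 0 T hT.le q.2).2, mem_univ _⟩
  refine ⟨_, (measurable_deriv_with_param hc).comp measurable_swap, fun t ht x => ?_⟩
  have h2 : (fun s => f (projIcc 0 T hT.le s) x) =ᶠ[𝓝 t] fun s => f s x := by
    filter_upwards [Ioo_mem_nhds ht.1 ht.2] with s hs
    rw [projIcc_of_mem hT.le (Ioo_subset_Icc_self hs)]
  exact h2.deriv_eq.trans (hd t ht x).deriv

lemma eLpNorm_two_lt_top_of_sub {f g : M → ℝ} (hf : MemLp f 2 μ)
    (hg : eLpNorm (fun x => g x - f x) 2 μ ≤ 1) (hgm : AEStronglyMeasurable g μ) :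
    eLpNorm g 2 μ ≤ 1 + eLpNorm f 2 μ := by
  have e : g = (fun x => g x - f x) + f := by ext x; simp
  calc eLpNorm g 2 μ ≤ eLpNorm (fun x => g x - f x) 2 μ + eLpNorm f 2 μ := by
        conv_lhs => rw [e]
        exact eLpNorm_add_le (hgm.sub hf.1) hf.1 (by norm_num)
    _ ≤ _ := by gcongr

/-- Differentiation under the integral sign, when the pointwise derivative is continuous in `L²`. -/
lemma hasDerivAt_integral_mul (hT : 0 < T) {f W : ℝ → M → ℝ} {φ : M → ℝ}
    (hf : ContinuousOn (fun q : ℝ × M => f q.1 q.2) (Icc 0 T ×ˢ univ))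
    (hd : ∀ t ∈ Ioo 0 T, ∀ x, HasDerivAt (fun s => f s x) (W t x) t)
    (hW : ∀ t ∈ Ioo 0 T, MemLp (W t) 2 μ)
    (hWc : ∀ t ∈ Ioo 0 T, Tendsto (fun s => eLpNorm (fun x => W s x - W t x) 2 μ) (𝓝 t) (𝓝 0))
    (hφ : MemLp φ 2 μ) (hφf : ∀ t ∈ Ioo 0 T, Integrable (fun x => φ x * f t x) μ)
    {t : ℝ} (ht : t ∈ Ioo 0 T) :
    HasDerivAt (fun s => ∫ x, φ x * f s x ∂μ) (∫ x, φ x * W t x ∂μ) t := by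
  obtain ⟨w, hwm, hw⟩ := exists_measurable_deriv hT hf hd
  set c : ℝ → ℝ := fun s => ∫ x, φ x * W s x ∂μ with hc
  have hcc : ∀ s ∈ Ioo 0 T, ContinuousAt c s := by
    intro s hs
    have := tendsto_integral_mul_mul (μ := μ) (l := 𝓝 s) (a := fun _ _ => 1) (a₀ := fun _ => 1)
      (f := fun _ => φ) (f₀ := φ) (g := W) (g₀ := W s) (K := 1)
      (Eventually.of_forall fun _ => aestronglyMeasurable_const) aestronglyMeasurable_const
      (Eventually.of_forall fun _ => ae_of_all _ fun _ => by simp) (ae_of_all _ fun _ => by simp)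
      (ae_of_all _ fun _ => tendsto_const_nhds) (Eventually.of_forall fun _ => hφ.1) hφ
      (by simp) ?_ (hW s hs) (hWc s hs)
    · simpa [hc, ContinuousAt] using this
    · filter_upwards [Ioo_mem_nhds hs.1 hs.2] with r hr using (hW r hr).1
  -- Near `t` the `L²` norm of `W r` is at most `1 + ‖W t‖`. This uniform bound gives the
  -- integrability for Fubini's theorem.
  have hI : ∀ᶠ s in 𝓝 t, uIcc t s ⊆ Ioo 0 T ∧
      ∀ r ∈ uIcc t s, eLpNorm (fun x => W r x - W t x) 2 μ ≤ 1 := by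
    have h1 := (hWc t ht).eventually (ge_mem_nhds (zero_lt_one : (0 : ℝ≥0∞) < 1))
    obtain ⟨ε, hε, hb⟩ := Metric.eventually_nhds_iff_ball.1 (h1.and (Ioo_mem_nhds ht.1 ht.2))
    filter_upwards [Metric.ball_mem_nhds t hε] with s hs
    have h3 : uIcc t s ⊆ Metric.ball t ε := by
      intro r hr
      rw [Metric.mem_ball, Real.dist_eq] at hs ⊢
      exact (abs_sub_left_of_mem_uIcc hr).trans_lt hs
    exact ⟨fun r hr => (hb r (h3 hr)).2, fun r hr => (hb r (h3 hr)).1⟩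
  -- The increment is written as a time integral of the continuous function `c`. For almost every
  -- `x` the derivative is integrable in time, so the fundamental theorem applies pointwise, and
  -- Fubini's theorem exchanges the integrals.
  have key : ∀ᶠ s in 𝓝 t, ∫ x, φ x * f s x ∂μ = (∫ r in t..s, c r) + ∫ x, φ x * f t x ∂μ := by
    filter_upwards [hI] with s hs
    obtain ⟨hs1, hs2⟩ := hs
    have hsm : s ∈ Ioo 0 T := hs1 right_mem_uIcc
    have hm : AEStronglyMeasurable (Function.uncurry fun r x => φ x * w (r, x))
        ((volume.restrict (uIoc t s)).prod μ) := by
      refine AEStronglyMeasurable.mul ?_ hwm.aestronglyMeasurable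
      exact hφ.1.comp_snd
    have hint : Integrable (Function.uncurry fun r x => φ x * w (r, x))
        ((volume.restrict (uIoc t s)).prod μ) := by
      refine ⟨hm, ?_⟩
      rw [HasFiniteIntegral, lintegral_prod _ hm.enorm]
      have hfin : eLpNorm φ 2 μ * (1 + eLpNorm (W t) 2 μ) ≠ ⊤ :=
        ENNReal.mul_ne_top hφ.2.ne (ENNReal.add_ne_top.2 ⟨ENNReal.one_ne_top, (hW t ht).2.ne⟩)
      calc ∫⁻ r in uIoc t s, ∫⁻ x, ‖φ x * w (r, x)‖ₑ ∂μ
          ≤ ∫⁻ r in uIoc t s, eLpNorm φ 2 μ * (1 + eLpNorm (W t) 2 μ) := by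
            refine setLIntegral_mono_ae' measurableSet_uIoc (ae_of_all _ fun r hr => ?_)
            have hr' := uIoc_subset_uIcc hr
            have e : ∀ x, w (r, x) = W r x := hw r (hs1 hr')
            simp only [e, enorm_mul]
            refine (lintegral_enorm_mul_le hφ.1 (hW r (hs1 hr')).1).trans ?_
            gcongr
            exact eLpNorm_two_lt_top_of_sub (hW t ht) (hs2 r hr') (hW r (hs1 hr')).1
        _ < ⊤ := by
            rw [lintegral_const]
            refine ENNReal.mul_lt_top hfin.lt_top ?_
            rw [Measure.restrict_apply_univ, uIoc_eq_union]
            refine (measure_union_le _ _).trans_lt ?_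
            simp
    have h1 : ∫ r in t..s, c r = ∫ r in t..s, ∫ x, φ x * w (r, x) ∂μ := by
      refine intervalIntegral.integral_congr fun r hr => ?_
      simp only [hc, hw r (hs1 hr)]
    rw [h1, intervalIntegral_integral_swap hint, ← sub_eq_iff_eq_add, ← integral_sub (hφf s hsm) (hφf t ht)]
    refine integral_congr_ae ?_
    filter_upwards [hint.prod_left_ae] with x hx
    symm
    refine intervalIntegral.integral_eq_sub_of_hasDerivAt (f := fun s => φ x * f s x)
      (fun r hr => ?_) (intervalIntegrable_iff.2 hx)
    rw [hw r (hs1 hr) x]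
    exact (hd r (hs1 hr) x).const_mul _
  have hc1 : ContinuousOn c (Ioo 0 T) := fun s hs => (hcc s hs).continuousWithinAt
  have h2 := intervalIntegral.integral_hasDerivAt_right (a := t) (b := t) (f := c) (by simp)
    (hc1.stronglyMeasurableAtFilter isOpen_Ioo t ht) (hcc t ht)
  exact (h2.add_const (∫ x, φ x * f t x ∂μ)).congr_of_eventuallyEq key

/-- The derivative of `∫ B(S) f`, when `S` is differentiable in `L²`. -/
lemma hasDerivAt_integral_comp_mul (hT : 0 < T) {f W S : ℝ → M → ℝ} {S' : M → ℝ} {B B' : ℝ → ℝ}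
    {K L C : ℝ}
    (hf : ContinuousOn (fun q : ℝ × M => f q.1 q.2) (Icc 0 T ×ˢ univ))
    (hfC : ∀ t ∈ Ioo 0 T, ∀ x, |f t x| ≤ C)
    (hd : ∀ t ∈ Ioo 0 T, ∀ x, HasDerivAt (fun s => f s x) (W t x) t)
    (hW : ∀ t ∈ Ioo 0 T, MemLp (W t) 2 μ)
    (hWc : ∀ t ∈ Ioo 0 T, Tendsto (fun s => eLpNorm (fun x => W s x - W t x) 2 μ) (𝓝 t) (𝓝 0))
    (hS : ∀ t ∈ Ioo 0 T, MemLp (S t) 2 μ)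
    (hB'm : Measurable B') (hB' : ∀ y, |B' y| ≤ K)
    (hBl : ∀ x y, |B y - B x - B' x * (y - x)| ≤ L * (y - x) ^ 2)
    (hBS : ∀ t ∈ Ioo 0 T, MemLp (fun x => B (S t x)) 2 μ)
    {t : ℝ} (ht : t ∈ Ioo 0 T) (hS'2 : MemLp S' 2 μ)
    (hS' : Tendsto (fun s => eLpNorm (fun x => (s - t)⁻¹ * (S s x - S t x) - S' x) 2 μ)
      (𝓝[≠] t) (𝓝 0)) :
    HasDerivAt (fun s => ∫ x, B (S s x) * f s x ∂μ)
      (∫ x, B' (S t x) * S' x * f t x ∂μ + ∫ x, B (S t x) * W t x ∂μ) t := by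
  have hL : 0 ≤ L := by simpa using (abs_nonneg _).trans (hBl 0 1)
  have hC : 0 ≤ |C| := abs_nonneg C
  have hfm : ∀ s ∈ Ioo 0 T, Continuous (f s) := fun s hs =>
    hf.comp_continuous (f := fun x : M => (s, x)) (Continuous.prodMk_right s)
      fun x => ⟨Ioo_subset_Icc_self hs, mem_univ _⟩
  have hft : ∀ x, Tendsto (fun s => f s x) (𝓝[≠] t) (𝓝 (f t x)) := fun x =>
    (hd t ht x).continuousAt.tendsto.mono_left nhdsWithin_le_nhds
  have hev : ∀ᶠ s in 𝓝[≠] t, s ∈ Ioo 0 T :=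
    mem_nhdsWithin_of_mem_nhds (Ioo_mem_nhds ht.1 ht.2)
  have hBf : ∀ s ∈ Ioo 0 T, ∀ r ∈ Ioo 0 T, Integrable (fun x => B (S s x) * f r x) μ :=
    fun s hs r hr => by
      have := (hBS s hs).integrable (by norm_num)
      refine (this.bdd_mul (c := C) (hfm r hr).aestronglyMeasurable (ae_of_all _ (hfC r hr))).congr
        (ae_of_all _ fun x => mul_comm _ _)
  have h1 := hasDerivAt_integral_mul hT hf hd hW hWc (hBS t ht) (fun s hs => hBf t ht s hs) ht
  set q : ℝ → M → ℝ := fun s x => (s - t)⁻¹ * (S s x - S t x) with hq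
  have hqL : ∀ s ∈ Ioo 0 T, MemLp (q s) 2 μ := fun s hs => ((hS s hs).sub (hS t ht)).const_mul _
  have hB'S : AEStronglyMeasurable (fun x => B' (S t x)) μ :=
    (hB'm.comp_aemeasurable (hS t ht).1.aemeasurable).aestronglyMeasurable
  have p1 : Tendsto (fun s => ∫ x, (B' (S t x) * f s x) * q s x * 1 ∂μ) (𝓝[≠] t)
      (𝓝 (∫ x, (B' (S t x) * f t x) * S' x * 1 ∂μ)) := by
    have hb : ∀ s ∈ Ioo 0 T, ∀ᵐ x ∂μ, |B' (S t x) * f s x| ≤ K * C := fun s hs =>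
      ae_of_all _ fun x => by
        rw [abs_mul]
        exact mul_le_mul (hB' _) (hfC s hs x) (abs_nonneg _) ((abs_nonneg _).trans (hB' 0))
    refine tendsto_integral_mul_mul (K := K * C) (a := fun s x => B' (S t x) * f s x) ?_
      (hB'S.mul (hfm t ht).aestronglyMeasurable) ?_ (hb t ht)
      (ae_of_all _ fun x => (hft x).const_mul _) ?_ hS'2 hS'
      (g := fun _ _ => 1) (Eventually.of_forall fun _ => aestronglyMeasurable_const)
      (memLp_const 1) (by simp)
    · filter_upwards [hev] with s hs using hB'S.mul (hfm s hs).aestronglyMeasurable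
    · filter_upwards [hev] with s hs using hb s hs
    · filter_upwards [hev] with s hs using (hqL s hs).1
  have p2 : Tendsto (fun s => ∫ x, 1 * q s x * q s x ∂μ) (𝓝[≠] t) (𝓝 (∫ x, 1 * S' x * S' x ∂μ)) := by
    have hqm : ∀ᶠ s in 𝓝[≠] t, AEStronglyMeasurable (q s) μ := by
      filter_upwards [hev] with s hs using (hqL s hs).1
    exact tendsto_integral_mul_mul (K := 1) (a := fun _ _ => 1) (a₀ := fun _ => 1)
      (Eventually.of_forall fun _ => aestronglyMeasurable_const) aestronglyMeasurable_const
      (Eventually.of_forall fun _ => ae_of_all _ fun _ => by simp) (ae_of_all _ fun _ => by simp)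
      (ae_of_all _ fun _ => tendsto_const_nhds) hqm hS'2 hS' hqm hS'2 hS'
  -- The Taylor remainder of `B` is at most `L (s - t)² q²`. After division by `s - t` a factor `|s
  -- - t|` is left over, while `∫ q²` stays bounded.
  have p3 : Tendsto (fun s => ∫ x, (s - t)⁻¹ * (B (S s x) - B (S t x) - B' (S t x) * (S s x - S t x))
      * f s x ∂μ) (𝓝[≠] t) (𝓝 0) := by
    have p4 : Tendsto (fun s => L * |C| * |s - t| * ∫ x, 1 * q s x * q s x ∂μ) (𝓝[≠] t) (𝓝 0) := by
      have : Tendsto (fun s => L * |C| * |s - t|) (𝓝[≠] t) (𝓝 (L * |C| * |t - t|)) :=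
        ((continuous_const.mul (continuous_id.sub continuous_const).abs).tendsto t).mono_left
          nhdsWithin_le_nhds
      simpa using this.mul p2
    refine squeeze_zero_norm' ?_ p4
    filter_upwards [hev, self_mem_nhdsWithin] with s hs hst
    have hst' : s - t ≠ 0 := sub_ne_zero.2 hst
    rw [← integral_const_mul]
    refine norm_integral_le_of_norm_le ?_ (ae_of_all _ fun x => ?_)
    · simpa using ((hqL s hs).integrable_mul (hqL s hs)).const_mul (L * |C| * |s - t|)
    · rw [norm_mul, norm_mul, Real.norm_eq_abs, Real.norm_eq_abs, Real.norm_eq_abs]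
      have e : L * |C| * |s - t| * (1 * q s x * q s x)
          = |(s - t)⁻¹| * (L * (S s x - S t x) ^ 2) * |C| := by
        have : q s x * q s x = |(s - t)⁻¹| * |(s - t)⁻¹| * (S s x - S t x) ^ 2 := by
          simp only [hq, abs_mul_abs_self]; ring
        have h2 : |s - t| * |(s - t)⁻¹| = 1 := by rw [← abs_mul, mul_inv_cancel₀ hst', abs_one]
        rw [one_mul, this]
        linear_combination (L * |C| * |(s - t)⁻¹| * (S s x - S t x) ^ 2) * h2
      rw [e]
      exact mul_le_mul (mul_le_mul_of_nonneg_left (hBl _ _) (abs_nonneg _))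
        ((hfC s hs x).trans (le_abs_self C)) (abs_nonneg _) (by positivity)
  -- The slope splits into the linear part `p1`, the Taylor remainder `p3` and the slope with `B(S)`
  -- frozen at time `t`.
  rw [hasDerivAt_iff_tendsto_slope] at h1 ⊢
  have h5 := (p1.add p3).add h1
  have e0 : ∫ x, (B' (S t x) * f t x) * S' x * 1 ∂μ + 0 + ∫ x, B (S t x) * W t x ∂μ
      = ∫ x, B' (S t x) * S' x * f t x ∂μ + ∫ x, B (S t x) * W t x ∂μ := by
    rw [add_zero]
    congr 2
    ext x; ring
  rw [e0] at h5
  refine h5.congr' ?_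
  filter_upwards [hev, self_mem_nhdsWithin] with s hs hst
  have hst' : s - t ≠ 0 := sub_ne_zero.2 hst
  have i1 : Integrable (fun x => (B' (S t x) * f s x) * q s x * 1) μ := by
    refine integrable_mul_mul (K := K * C) (hB'S.mul (hfm s hs).aestronglyMeasurable)
      (ae_of_all _ fun x => ?_) (hqL s hs) (memLp_const 1)
    rw [abs_mul]
    exact mul_le_mul (hB' _) (hfC s hs x) (abs_nonneg _) ((abs_nonneg _).trans (hB' 0))
  have i2 : Integrable (fun x => (s - t)⁻¹ * (B (S s x) - B (S t x)) * f s x) μ := by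
    refine (((hBf s hs s hs).sub (hBf t ht s hs)).const_mul (s - t)⁻¹).congr (ae_of_all _ fun x => ?_)
    simp only [Pi.sub_apply]; ring
  have e1 : ∀ x, (s - t)⁻¹ * (B (S s x) - B (S t x) - B' (S t x) * (S s x - S t x)) * f s x
      = (s - t)⁻¹ * (B (S s x) - B (S t x)) * f s x - (B' (S t x) * f s x) * q s x * 1 := fun x => by
    simp only [hq]; ring
  simp only [e1]
  rw [integral_sub i2 i1, add_sub_cancel, slope_def_field, slope_def_field,
    ← integral_sub (hBf t ht s hs) (hBf t ht t ht), ← integral_sub (hBf s hs s hs) (hBf t ht t ht),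
    div_eq_inv_mul, div_eq_inv_mul, ← integral_const_mul, ← integral_const_mul, ← integral_add i2]
  · refine integral_congr_ae (ae_of_all _ fun x => ?_)
    dsimp only
    ring
  · exact ((hBf t ht s hs).sub (hBf t ht t ht)).const_mul _

end TimeDerivative

/-! ### Conformal flows with bounded factors: powers of `u`, the average `ρ`, and the volume. -/

section Flow

variable {n : ℕ} {M : Type*} [TopologicalSpace M] [ChartedSpace (Eucl n) M]
  [IsManifold (𝓡 n) ∞ M] [MeasurableSpace M] [BorelSpace M] [SecondCountableTopology M]

/-- A conformal flow `∂ₜ u = (n-2)/4 (ρ - S) u` with bounded conformal factors, whose scalar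
curvature is a differentiable curve in `L²` (with derivative `S'`) of Sobolev functions (with
gradient `X`). The function `S₀` is the scalar curvature of the background metric. -/
structure ConformalFlow
    (G : Bundle.ContMDiffRiemannianMetric (𝓡 n) ∞ (Eucl n) (fun x : M => TangentSpace (𝓡 n) x))
    (T : ℝ) (u S S' : ℝ → M → ℝ) (X : ℝ → ∀ x : M, TangentSpace (𝓡 n) x) (S₀ : M → ℝ)
    (ρ : ℝ → ℝ) : Prop where
  dim : 3 ≤ n
  time : 0 < T
  vol_univ : vol G.inner univ = 1
  dense : TestDenseInH1 G.inner
  cont : ContinuousOn (fun q : ℝ × M => u q.1 q.2) (Icc 0 T ×ˢ univ)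
  contMDiff : ∀ t ∈ Icc 0 T, ContMDiff (𝓡 n) 𝓘(ℝ, ℝ) 1 (u t)
  bound : ∃ C, 0 < C ∧ ∀ t ∈ Icc 0 T, ∀ x, C⁻¹ ≤ u t x ∧ u t x ≤ C
  initial : ∀ x, u 0 x = 1
  deriv : ∀ t ∈ Ioo 0 T, ∀ x,
    HasDerivAt (fun s => u s x) (((n : ℝ) - 2) / 4 * (ρ t - S t x) * u t x) t
  memLp : ∀ t ∈ Icc 0 T, MemLp (S t) 2 (vol G.inner)
  contS : ∀ t ∈ Icc 0 T, Tendsto (fun s => eLpNorm (fun x => S s x - S t x) 2 (vol G.inner))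
    (𝓝[Icc 0 T] t) (𝓝 0)
  memLp' : ∀ t ∈ Ioo 0 T, MemLp (S' t) 2 (vol G.inner)
  derivS : ∀ t ∈ Ioo 0 T, Tendsto
    (fun s => eLpNorm (fun x => (s - t)⁻¹ * (S s x - S t x) - S' t x) 2 (vol G.inner))
    (𝓝[≠] t) (𝓝 0)
  contS' : ∀ t ∈ Ioo 0 T, Tendsto (fun s => eLpNorm (fun x => S' s x - S' t x) 2 (vol G.inner))
    (𝓝 t) (𝓝 0)
  approx : ∀ t ∈ Icc 0 T, ∃ σ, Approx G (S t) (X t) σ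
  rho_eq : ∀ t ∈ Icc 0 T, ρ t = (∫ x, u t x ^ (2 * (n : ℝ) / ((n : ℝ) - 2)) ∂(vol G.inner))⁻¹
    * ∫ x, S t x * u t x ^ (2 * (n : ℝ) / ((n : ℝ) - 2)) ∂(vol G.inner)
  memLp_zero : MemLp S₀ 2 (vol G.inner)
  weak : ∀ t ∈ Icc 0 T, ∀ ψ, IsTest n ψ →
    ∫ x, S t x * u t x ^ (((n : ℝ) + 2) / ((n : ℝ) - 2)) * ψ x ∂(vol G.inner)
      = confConst n * ∫ x, ip G (grad G ψ) (grad G (u t)) x ∂(vol G.inner)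
        + ∫ x, S₀ x * u t x * ψ x ∂(vol G.inner)
  yamabe : ∀ v, ContMDiff (𝓡 n) 𝓘(ℝ, ℝ) 1 v → HasCompactSupport v →
    0 ≤ confConst n * ∫ x, ip G (grad G v) (grad G v) x ∂(vol G.inner)
      + ∫ x, S₀ x * v x ^ 2 ∂(vol G.inner)

namespace ConformalFlow

variable {G : Bundle.ContMDiffRiemannianMetric (𝓡 n) ∞ (Eucl n) (fun x : M => TangentSpace (𝓡 n) x)}
  {T : ℝ} {u S S' : ℝ → M → ℝ} {X : ℝ → ∀ x : M, TangentSpace (𝓡 n) x} {S₀ : M → ℝ} {ρ : ℝ → ℝ}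
  {t : ℝ}

lemma tendsto_eLpNorm_sub_self {ι : Type*} {l : Filter ι} {f : M → ℝ} {μ : Measure M} :
    Tendsto (fun _ : ι => eLpNorm (fun x => f x - f x) 2 μ) l (𝓝 0) := by
  simpa using tendsto_const_nhds

lemma isProbabilityMeasure (h : ConformalFlow G T u S S' X S₀ ρ) :
    IsProbabilityMeasure (vol G.inner) := ⟨h.vol_univ⟩

lemma two_lt (h : ConformalFlow G T u S S' X S₀ ρ) : (0 : ℝ) < (n : ℝ) - 2 := by
  have : (3 : ℝ) ≤ n := by exact_mod_cast h.dim
  linarith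

lemma pos (h : ConformalFlow G T u S S' X S₀ ρ) (ht : t ∈ Icc 0 T) (x : M) : 0 < u t x := by
  obtain ⟨C, hC, hb⟩ := h.bound
  exact (inv_pos.2 hC).trans_le (hb t ht x).1

lemma continuousOn_rpow (h : ConformalFlow G T u S S' X S₀ ρ) (q : ℝ) :
    ContinuousOn (fun p : ℝ × M => u p.1 p.2 ^ q) (Icc 0 T ×ˢ univ) :=
  h.cont.rpow_const fun p hp => Or.inl (h.pos hp.1 p.2).ne'

lemma continuous_rpow (h : ConformalFlow G T u S S' X S₀ ρ) (q : ℝ) (ht : t ∈ Icc 0 T) :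
    Continuous fun x => u t x ^ q :=
  (h.continuousOn_rpow q).comp_continuous (f := fun x : M => (t, x)) (Continuous.prodMk_right t)
    fun _ => ⟨ht, mem_univ _⟩

lemma tendsto_rpow (h : ConformalFlow G T u S S' X S₀ ρ) (q : ℝ) (ht : t ∈ Icc 0 T) (x : M) :
    Tendsto (fun s => u s x ^ q) (𝓝[Icc 0 T] t) (𝓝 (u t x ^ q)) :=
  ((h.continuousOn_rpow q).comp (f := fun s : ℝ => (s, x)) (Continuous.prodMk_left x).continuousOn
    (fun _ hs => ⟨hs, mem_univ _⟩)) t ht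

lemma exists_rpow_bound (h : ConformalFlow G T u S S' X S₀ ρ) (q : ℝ) :
    ∃ K, 0 < K ∧ ∀ t ∈ Icc 0 T, ∀ x, K⁻¹ ≤ u t x ^ q ∧ u t x ^ q ≤ K := by
  obtain ⟨C, hC, hb⟩ := h.bound
  have hC1 : 1 ≤ C := by
    have := hb 0 ⟨le_rfl, h.time.le⟩
    by_contra! hlt
    have hM : Nonempty M := by
      by_contra hne
      rw [not_nonempty_iff] at hne
      have := h.vol_univ
      rw [univ_eq_empty_iff.2 hne, measure_empty] at this
      exact zero_ne_one this
    obtain ⟨x⟩ := hM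
    have h1 := this x
    rw [h.initial] at h1
    linarith [h1.2]
  refine ⟨C ^ |q|, Real.rpow_pos_of_pos hC _, fun t ht x => ?_⟩
  have hu := h.pos ht x
  have hb1 := hb t ht x
  have hi : (u t x)⁻¹ ≤ C := inv_le_of_inv_le₀ hC hb1.1
  have hle : ∀ q : ℝ, u t x ^ q ≤ C ^ |q| := by
    intro q
    rcases le_total 0 q with hq | hq
    · rw [abs_of_nonneg hq]
      exact Real.rpow_le_rpow hu.le hb1.2 hq
    · rw [abs_of_nonpos hq, ← neg_neg q, Real.rpow_neg hu.le, ← Real.inv_rpow hu.le, neg_neg]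
      exact Real.rpow_le_rpow (inv_nonneg.2 hu.le) hi (by linarith)
  refine ⟨?_, hle q⟩
  have := hle (-q)
  rw [abs_neg, Real.rpow_neg hu.le] at this
  exact inv_le_of_inv_le₀ (Real.rpow_pos_of_pos hu q) this

lemma hasDerivAt_rpow (h : ConformalFlow G T u S S' X S₀ ρ) (q : ℝ) (ht : t ∈ Ioo 0 T) (x : M) :
    HasDerivAt (fun s => u s x ^ q)
      ((q * (((n : ℝ) - 2) / 4) * u t x ^ q) * (ρ t - S t x)) t := by
  have hu := h.pos (Ioo_subset_Icc_self ht) x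
  convert! (h.deriv t ht x).rpow_const (p := q) (Or.inl hu.ne') using 1
  rw [Real.rpow_sub_one hu.ne']
  field_simp

lemma ae_bound_rpow (h : ConformalFlow G T u S S' X S₀ ρ) (q : ℝ) : ∃ K, 0 < K ∧
    ∀ t ∈ Icc 0 T, ∀ x, |u t x ^ q| ≤ K := by
  obtain ⟨K, hK, hb⟩ := h.exists_rpow_bound q
  refine ⟨K, hK, fun t ht x => ?_⟩
  rw [abs_of_pos (Real.rpow_pos_of_pos (h.pos ht x) q)]
  exact (hb t ht x).2

lemma tendsto_integral_mul_rpow (h : ConformalFlow G T u S S' X S₀ ρ) (q : ℝ) {f : ℝ → M → ℝ}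
    (hf : ∀ t ∈ Icc 0 T, MemLp (f t) 2 (vol G.inner)) (ht : t ∈ Icc 0 T)
    (hfc : Tendsto (fun s => eLpNorm (fun x => f s x - f t x) 2 (vol G.inner))
      (𝓝[Icc 0 T] t) (𝓝 0)) :
    Tendsto (fun s => ∫ x, f s x * u s x ^ q ∂(vol G.inner)) (𝓝[Icc 0 T] t)
      (𝓝 (∫ x, f t x * u t x ^ q ∂(vol G.inner))) := by
  have := h.isProbabilityMeasure
  obtain ⟨K, -, hK⟩ := h.ae_bound_rpow q
  have := tendsto_integral_mul_mul (μ := vol G.inner) (l := 𝓝[Icc 0 T] t) (K := K)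
    (a := fun s x => u s x ^ q) (a₀ := fun x => u t x ^ q) (f := f) (f₀ := f t)
    (g := fun _ _ => 1) (g₀ := fun _ => 1)
    (by filter_upwards [self_mem_nhdsWithin] with s hs
        exact (h.continuous_rpow q hs).aestronglyMeasurable)
    (h.continuous_rpow q ht).aestronglyMeasurable
    (by filter_upwards [self_mem_nhdsWithin] with s hs using ae_of_all _ (hK s hs))
    (ae_of_all _ (hK t ht)) (ae_of_all _ fun x => h.tendsto_rpow q ht x)
    (by filter_upwards [self_mem_nhdsWithin] with s hs using (hf s hs).1)
    (hf t ht) hfc (Eventually.of_forall fun _ => aestronglyMeasurable_const) (memLp_const 1)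
    tendsto_eLpNorm_sub_self
  simpa [mul_comm] using this

lemma integrable_rpow (h : ConformalFlow G T u S S' X S₀ ρ) (q : ℝ) (ht : t ∈ Icc 0 T)
    {f : M → ℝ} (hf : Integrable f (vol G.inner)) :
    Integrable (fun x => f x * u t x ^ q) (vol G.inner) := by
  obtain ⟨K, -, hK⟩ := h.ae_bound_rpow q
  exact (hf.bdd_mul (h.continuous_rpow q ht).aestronglyMeasurable (ae_of_all _ (hK t ht))).congr
    (ae_of_all _ fun x => mul_comm _ _)

lemma integrable (h : ConformalFlow G T u S S' X S₀ ρ) (ht : t ∈ Icc 0 T) :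
    Integrable (S t) (vol G.inner) :=
  have := h.isProbabilityMeasure
  (h.memLp t ht).integrable (by norm_num)

lemma integral_rpow_pos (h : ConformalFlow G T u S S' X S₀ ρ) (q : ℝ) (ht : t ∈ Icc 0 T) :
    0 < ∫ x, u t x ^ q ∂(vol G.inner) := by
  have := h.isProbabilityMeasure
  obtain ⟨K, hK, hb⟩ := h.exists_rpow_bound q
  have hi : Integrable (fun x => u t x ^ q) (vol G.inner) := by
    simpa using h.integrable_rpow q ht (integrable_const (1 : ℝ))
  calc (0 : ℝ) < K⁻¹ := inv_pos.2 hK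
    _ = ∫ x, K⁻¹ ∂(vol G.inner) := by simp
    _ ≤ _ := integral_mono (integrable_const _) hi fun x => (hb t ht x).1

lemma continuousOn_rho (h : ConformalFlow G T u S S' X S₀ ρ) : ContinuousOn ρ (Icc 0 T) := by
  have := h.isProbabilityMeasure
  intro t ht
  have h1 := h.tendsto_integral_mul_rpow (2 * (n : ℝ) / ((n : ℝ) - 2)) h.memLp ht (h.contS t ht)
  have h2 := h.tendsto_integral_mul_rpow (f := fun _ _ => 1) (2 * (n : ℝ) / ((n : ℝ) - 2))
    (fun _ _ => memLp_const 1) ht tendsto_eLpNorm_sub_self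
  simp only [one_mul] at h2
  have h3 := (h2.inv₀ (h.integral_rpow_pos _ ht).ne').mul h1
  rw [ContinuousWithinAt, h.rho_eq t ht]
  refine h3.congr' ?_
  filter_upwards [self_mem_nhdsWithin] with s hs using (h.rho_eq s hs).symm

lemma nhdsWithin_eq (ht : t ∈ Ioo 0 T) : 𝓝[Icc 0 T] t = 𝓝 t :=
  nhdsWithin_eq_nhds.2 (Icc_mem_nhds ht.1 ht.2)

lemma memLp_rho_sub (h : ConformalFlow G T u S S' X S₀ ρ) (ht : t ∈ Icc 0 T) :
    MemLp (fun x => ρ t - S t x) 2 (vol G.inner) :=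
  have := h.isProbabilityMeasure
  (memLp_const (ρ t)).sub (h.memLp t ht)

lemma tendsto_rho_sub (h : ConformalFlow G T u S S' X S₀ ρ) (ht : t ∈ Icc 0 T) :
    Tendsto (fun s => eLpNorm (fun x => (ρ s - S s x) - (ρ t - S t x)) 2 (vol G.inner))
      (𝓝[Icc 0 T] t) (𝓝 0) := by
  have := h.isProbabilityMeasure
  have h1 : Tendsto (fun s => eLpNorm (fun _ : M => ρ s - ρ t) 2 (vol G.inner))
      (𝓝[Icc 0 T] t) (𝓝 0) := by
    have e : ∀ s, eLpNorm (fun _ : M => ρ s - ρ t) 2 (vol G.inner) = ‖ρ s - ρ t‖ₑ := fun s => by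
      rw [eLpNorm_const _ two_ne_zero (NeZero.ne _)]; simp
    simp only [e]
    have := ((h.continuousOn_rho t ht).tendsto.sub_const (ρ t)).enorm
    simpa using this
  have h2 := h1.add (h.contS t ht)
  rw [add_zero] at h2
  refine tendsto_of_tendsto_of_tendsto_of_le_of_le' tendsto_const_nhds h2
    (Eventually.of_forall fun _ => zero_le) ?_
  filter_upwards [self_mem_nhdsWithin] with s hs
  have e : (fun x => (ρ s - S s x) - (ρ t - S t x))
      = (fun _ => ρ s - ρ t) - fun x => S s x - S t x := by ext x; simp only [Pi.sub_apply]; ring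
  rw [e]
  exact eLpNorm_sub_le aestronglyMeasurable_const ((h.memLp s hs).1.sub (h.memLp t ht).1)
    (by norm_num)

lemma memLp_rpow_deriv (h : ConformalFlow G T u S S' X S₀ ρ) (q : ℝ) (ht : t ∈ Icc 0 T) {η : M → ℝ}
    {K : ℝ} (hη : AEStronglyMeasurable η (vol G.inner)) (hK : ∀ x, |η x| ≤ K) :
    MemLp (fun x => η x * (q * (((n : ℝ) - 2) / 4) * u t x ^ q) * (ρ t - S t x))
      2 (vol G.inner) := by
  obtain ⟨C, hC, hb⟩ := h.ae_bound_rpow q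
  have hK0 : ∀ x : M, 0 ≤ K := fun x => (abs_nonneg _).trans (hK x)
  refine ((h.memLp_rho_sub ht).const_mul (K * (|q * (((n : ℝ) - 2) / 4)| * C))).mono
    ((hη.mul ((h.continuous_rpow q ht).aestronglyMeasurable.const_mul _)).mul
    (h.memLp_rho_sub ht).1) (ae_of_all _ fun x => ?_)
  rw [norm_mul, norm_mul (K * _)]
  gcongr
  rw [Real.norm_eq_abs, abs_mul, abs_mul (q * _), Real.norm_eq_abs,
    abs_of_nonneg (mul_nonneg (hK0 x) (mul_nonneg (abs_nonneg _) hC.le))]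
  exact mul_le_mul (hK x) (mul_le_mul_of_nonneg_left (hb t ht x) (abs_nonneg _))
    (mul_nonneg (abs_nonneg _) (abs_nonneg _)) (hK0 x)

lemma tendsto_rpow_deriv (h : ConformalFlow G T u S S' X S₀ ρ) (q : ℝ) (ht : t ∈ Icc 0 T)
    {η : M → ℝ} {K : ℝ} (hη : AEStronglyMeasurable η (vol G.inner)) (hK : ∀ x, |η x| ≤ K) :
    Tendsto (fun s => eLpNorm (fun x => η x * (q * (((n : ℝ) - 2) / 4) * u s x ^ q) * (ρ s - S s x)
      - η x * (q * (((n : ℝ) - 2) / 4) * u t x ^ q) * (ρ t - S t x)) 2 (vol G.inner))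
      (𝓝[Icc 0 T] t) (𝓝 0) := by
  obtain ⟨C, hC, hb⟩ := h.ae_bound_rpow q
  have hK0 : ∀ x : M, 0 ≤ K := fun x => (abs_nonneg _).trans (hK x)
  have hbd : ∀ s ∈ Icc 0 T, ∀ x, |η x * (q * (((n : ℝ) - 2) / 4) * u s x ^ q)|
      ≤ K * (|q * (((n : ℝ) - 2) / 4)| * C) := fun s hs x => by
    rw [abs_mul, abs_mul (q * _)]
    exact mul_le_mul (hK x) (mul_le_mul_of_nonneg_left (hb s hs x) (abs_nonneg _))
      (mul_nonneg (abs_nonneg _) (abs_nonneg _)) (hK0 x)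
  refine tendsto_eLpNorm_mul_sub (K := K * (|q * (((n : ℝ) - 2) / 4)| * C)) ?_
    (hη.mul ((h.continuous_rpow q ht).aestronglyMeasurable.const_mul _)) ?_
    (ae_of_all _ (hbd t ht)) (ae_of_all _ fun x => ?_) ?_ (h.memLp_rho_sub ht) (h.tendsto_rho_sub ht)
  · filter_upwards [self_mem_nhdsWithin] with s hs
    exact hη.mul ((h.continuous_rpow q hs).aestronglyMeasurable.const_mul _)
  · filter_upwards [self_mem_nhdsWithin] with s hs using ae_of_all _ (hbd s hs)
  · exact ((h.tendsto_rpow q ht x).const_mul _).const_mul _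
  · filter_upwards [self_mem_nhdsWithin] with s hs using (h.memLp_rho_sub hs).1

/-- The derivative of `∫ B(S) η u^q`. -/
lemma hasDerivAt_integral_comp (h : ConformalFlow G T u S S' X S₀ ρ) (q : ℝ) {η : M → ℝ} {K : ℝ}
    (hη : Continuous η) (hK : ∀ x, |η x| ≤ K) {B B' : ℝ → ℝ} {K' L : ℝ}
    (hB'm : Measurable B') (hB' : ∀ y, |B' y| ≤ K')
    (hBl : ∀ x y, |B y - B x - B' x * (y - x)| ≤ L * (y - x) ^ 2)
    (hBS : ∀ t ∈ Ioo 0 T, MemLp (fun x => B (S t x)) 2 (vol G.inner)) (ht : t ∈ Ioo 0 T) :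
    HasDerivAt (fun s => ∫ x, B (S s x) * (η x * u s x ^ q) ∂(vol G.inner))
      (∫ x, B' (S t x) * S' t x * (η x * u t x ^ q) ∂(vol G.inner)
        + ∫ x, B (S t x) * (η x * (q * (((n : ℝ) - 2) / 4) * u t x ^ q) * (ρ t - S t x))
          ∂(vol G.inner)) t := by
  have := h.isProbabilityMeasure
  obtain ⟨C, hC, hb⟩ := h.ae_bound_rpow q
  refine hasDerivAt_integral_comp_mul (f := fun t x => η x * u t x ^ q)
    (W := fun t x => η x * (q * (((n : ℝ) - 2) / 4) * u t x ^ q) * (ρ t - S t x))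
    (K := K') (L := L) (C := K * C) h.time ?_ ?_ ?_
    (fun t ht => h.memLp_rpow_deriv q (Ioo_subset_Icc_self ht) hη.aestronglyMeasurable hK) ?_
    (fun t ht => h.memLp t (Ioo_subset_Icc_self ht)) hB'm hB' hBl hBS ht (h.memLp' t ht)
    (h.derivS t ht)
  · exact (hη.comp_continuousOn continuousOn_snd).mul (h.continuousOn_rpow q)
  · intro t ht x
    rw [abs_mul]
    exact mul_le_mul (hK x) (hb t (Ioo_subset_Icc_self ht) x) (abs_nonneg _)
      ((abs_nonneg _).trans (hK x))
  · intro t ht x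
    convert! (h.hasDerivAt_rpow q ht x).const_mul (η x) using 1
    ring
  · intro t ht
    rw [← nhdsWithin_eq ht]
    exact h.tendsto_rpow_deriv q (Ioo_subset_Icc_self ht) hη.aestronglyMeasurable hK

/-- The derivative of `∫ φ η u^q`. -/
lemma hasDerivAt_integral_fixed (h : ConformalFlow G T u S S' X S₀ ρ) (q : ℝ) {η φ : M → ℝ} {K : ℝ}
    (hη : Continuous η) (hK : ∀ x, |η x| ≤ K) (hφ : MemLp φ 2 (vol G.inner)) (ht : t ∈ Ioo 0 T) :
    HasDerivAt (fun s => ∫ x, φ x * (η x * u s x ^ q) ∂(vol G.inner))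
      (∫ x, φ x * (η x * (q * (((n : ℝ) - 2) / 4) * u t x ^ q) * (ρ t - S t x)) ∂(vol G.inner))
      t := by
  have := h.isProbabilityMeasure
  refine hasDerivAt_integral_mul (f := fun t x => η x * u t x ^ q)
    (W := fun t x => η x * (q * (((n : ℝ) - 2) / 4) * u t x ^ q) * (ρ t - S t x))
    h.time ?_ ?_
    (fun t ht => h.memLp_rpow_deriv q (Ioo_subset_Icc_self ht) hη.aestronglyMeasurable hK) ?_
    hφ ?_ ht
  · exact (hη.comp_continuousOn continuousOn_snd).mul (h.continuousOn_rpow q)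
  · intro t ht x
    convert! (h.hasDerivAt_rpow q ht x).const_mul (η x) using 1
    ring
  · intro t ht
    rw [← nhdsWithin_eq ht]
    exact h.tendsto_rpow_deriv q (Ioo_subset_Icc_self ht) hη.aestronglyMeasurable hK
  · intro t ht
    have h1 : Integrable (fun x => φ x * η x) (vol G.inner) :=
      ((hφ.integrable (by norm_num)).bdd_mul hη.aestronglyMeasurable (ae_of_all _ hK)).congr
        (ae_of_all _ fun x => mul_comm _ _)
    exact (h.integrable_rpow q (Ioo_subset_Icc_self ht) h1).congr
      (ae_of_all _ fun x => mul_assoc _ _ _)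

/-- The derivative of the volume is `(n/2) (ρ Vol - ∫ S dVol)`, which is zero because `ρ` is the
mean of `S`. -/
lemma volume_eq_one (h : ConformalFlow G T u S S' X S₀ ρ) (ht : t ∈ Icc 0 T) :
    ∫ x, u t x ^ (2 * (n : ℝ) / ((n : ℝ) - 2)) ∂(vol G.inner) = 1 := by
  have := h.isProbabilityMeasure
  set q := 2 * (n : ℝ) / ((n : ℝ) - 2) with hq
  have hc : ContinuousOn (fun t => ∫ x, u t x ^ q ∂(vol G.inner)) (Icc 0 T) := by
    intro t ht
    have h2 := h.tendsto_integral_mul_rpow (f := fun _ _ => 1) q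
      (fun _ _ => memLp_const 1) ht tendsto_eLpNorm_sub_self
    simpa [ContinuousWithinAt] using h2
  have hd : ∀ t ∈ Ioo 0 T, HasDerivAt (fun t => ∫ x, u t x ^ q ∂(vol G.inner)) 0 t := by
    intro t ht
    have ht' := Ioo_subset_Icc_self ht
    have h1 := h.hasDerivAt_integral_fixed (η := fun _ => 1) (φ := fun _ => 1) (K := 1) q
      continuous_const (by simp) (memLp_const 1) ht
    simp only [one_mul] at h1
    convert! h1 using 1
    have i1 := h.integrable_rpow q ht' (h.integrable ht')
    have i2 := h.integrable_rpow q ht' (integrable_const (ρ t))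
    have e : ∀ x, q * (((n : ℝ) - 2) / 4) * u t x ^ q * (ρ t - S t x)
        = q * (((n : ℝ) - 2) / 4) * (ρ t * u t x ^ q - S t x * u t x ^ q) := fun x => by ring
    simp only [e]
    rw [integral_const_mul, integral_sub i2 i1, integral_const_mul, h.rho_eq t ht', ← hq, mul_comm (_⁻¹),
      mul_assoc (∫ x, S t x * u t x ^ q ∂(vol G.inner)), inv_mul_cancel₀ (h.integral_rpow_pos _ ht').ne', mul_one, sub_self, mul_zero]
  have h0 : ∫ x, u 0 x ^ q ∂(vol G.inner) = 1 := by simp [h.initial]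
  rw [← h0]
  have hdw : DifferentiableOn ℝ (fun t => ∫ x, u t x ^ q ∂(vol G.inner)) (interior (Icc 0 T)) := by
    rw [interior_Icc]
    exact fun s hs => (hd s hs).differentiableAt.differentiableWithinAt
  have h1 : ∀ s ∈ interior (Icc 0 T), _root_.deriv (fun t => ∫ x, u t x ^ q ∂(vol G.inner)) s = 0 := by
    rw [interior_Icc]
    exact fun s hs => (hd s hs).deriv
  exact le_antisymm
    (antitoneOn_of_deriv_nonpos (convex_Icc 0 T) hc hdw (fun s hs => (h1 s hs).le)
      ⟨le_rfl, h.time.le⟩ ht ht.1)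
    (monotoneOn_of_deriv_nonneg (convex_Icc 0 T) hc hdw (fun s hs => (h1 s hs).ge)
      ⟨le_rfl, h.time.le⟩ ht ht.1)

lemma rho_eq_integral (h : ConformalFlow G T u S S' X S₀ ρ) (ht : t ∈ Icc 0 T) :
    ρ t = ∫ x, S t x * u t x ^ (2 * (n : ℝ) / ((n : ℝ) - 2)) ∂(vol G.inner) := by
  rw [h.rho_eq t ht, h.volume_eq_one ht, inv_one, one_mul]

end ConformalFlow

end Flow

/-! ### The weak evolution equation of the scalar curvature, against test functions. -/

section SpatialIdentities

variable {n : ℕ} {M : Type*} [TopologicalSpace M] [T2Space M] [ChartedSpace (Eucl n) M]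
  [IsManifold (𝓡 n) ∞ M] [MeasurableSpace M] [BorelSpace M] [SecondCountableTopology M]
  {G : Bundle.ContMDiffRiemannianMetric (𝓡 n) ∞ (Eucl n) (fun x : M => TangentSpace (𝓡 n) x)}

lemma tendsto_integral_mul_of_L2 {α ι : Type*} {m0 : MeasurableSpace α} {μ : Measure α}
    {l : Filter ι} [l.IsCountablyGenerated]
    {a : α → ℝ} {f : ι → α → ℝ} {f₀ g₀ : α → ℝ} {K : ℝ}
    (ha : AEStronglyMeasurable a μ) (haK : ∀ᵐ x ∂μ, |a x| ≤ K)
    (hfm : ∀ i, AEStronglyMeasurable (f i) μ) (hf₀ : MemLp f₀ 2 μ)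
    (hf : Tendsto (fun i => eLpNorm (fun x => f i x - f₀ x) 2 μ) l (𝓝 0)) (hg₀ : MemLp g₀ 2 μ) :
    Tendsto (fun i => ∫ x, a x * f i x * g₀ x ∂μ) l (𝓝 (∫ x, a x * f₀ x * g₀ x ∂μ)) :=
  tendsto_integral_mul_mul (K := K) (Eventually.of_forall fun _ => ha) ha
    (Eventually.of_forall fun _ => haK) haK (ae_of_all _ fun _ => tendsto_const_nhds)
    (Eventually.of_forall hfm) hf₀ hf (Eventually.of_forall fun _ => hg₀.1) hg₀
    (by simpa using tendsto_const_nhds)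

lemma tendsto_integral_mul_ip_of_L2 {ι : Type*} {l : Filter ι} [l.IsCountablyGenerated]
    {a : M → ℝ} {X : ι → ∀ x : M, TangentSpace (𝓡 n) x}
    {X₀ Y₀ : ∀ x : M, TangentSpace (𝓡 n) x} {K : ℝ}
    (ha : AEStronglyMeasurable a (vol G.inner)) (haK : ∀ᵐ x ∂(vol G.inner), |a x| ≤ K)
    (hXm : ∀ i, MeasField G (X i)) (hX₀ : MeasField G X₀)
    (hX₀2 : MemLp (nrm G X₀) 2 (vol G.inner))
    (hX : Tendsto (fun i => eLpNorm (nrm G fun x => X i x - X₀ x) 2 (vol G.inner)) l (𝓝 0))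
    (hY₀ : MeasField G Y₀) (hY₀2 : MemLp (nrm G Y₀) 2 (vol G.inner)) :
    Tendsto (fun i => ∫ x, a x * ip G (X i) Y₀ x ∂(vol G.inner)) l
      (𝓝 (∫ x, a x * ip G X₀ Y₀ x ∂(vol G.inner))) := by
  refine tendsto_integral_mul_ip (K := K) (Eventually.of_forall fun _ => ha) ha
    (Eventually.of_forall fun _ => haK) haK (ae_of_all _ fun _ => tendsto_const_nhds)
    (Eventually.of_forall hXm) hX₀ hX₀2 hX (Eventually.of_forall fun _ => hY₀) hY₀ hY₀2 ?_
  have : (nrm G fun x => (0 : TangentSpace (𝓡 n) x)) = 0 := by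
    funext x; simp [nrm, ip]
  simpa [this] using tendsto_const_nhds

lemma BApprox.tendsto_integral {φ : M → ℝ} {Y : ∀ x : M, TangentSpace (𝓡 n) x} {ψ : ℕ → M → ℝ}
    (h : BApprox G φ Y ψ) {F : ℝ → ℝ} (hF : Continuous F) {U f g : M → ℝ} {K : ℝ}
    (hU : AEStronglyMeasurable U (vol G.inner)) (hUK : ∀ x, |U x| ≤ K)
    (hf : MemLp f 2 (vol G.inner)) (hg : MemLp g 2 (vol G.inner)) :
    Tendsto (fun j => ∫ x, U x * F (ψ j x) * f x * g x ∂(vol G.inner)) atTop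
      (𝓝 (∫ x, U x * F (φ x) * f x * g x ∂(vol G.inner))) := by
  obtain ⟨C, hC0, hC, hφC⟩ := h.ae_bound
  obtain ⟨D, hD⟩ := (isCompact_Icc (a := -C) (b := C)).exists_bound_of_continuousOn hF.continuousOn
  have hb : ∀ x y, |y| ≤ C → |U x * F y| ≤ |K| * |D| := fun x y hy => by
    rw [abs_mul]
    exact mul_le_mul ((hUK x).trans (le_abs_self K)) ((hD y (abs_le.1 hy)).trans (le_abs_self D))
      (abs_nonneg _) (abs_nonneg _)
  refine tendsto_integral_mul_mul (K := |K| * |D|) (Eventually.of_forall fun j => ?_) ?_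
    (Eventually.of_forall fun j => ae_of_all _ fun x => hb x _ (hC j x)) ?_ ?_
    (Eventually.of_forall fun _ => hf.1) hf (by simp)
    (Eventually.of_forall fun _ => hg.1) hg (by simp)
  · exact hU.mul (hF.comp_aestronglyMeasurable (h.test j).aestronglyMeasurable)
  · exact hU.mul (hF.comp_aestronglyMeasurable h.aestronglyMeasurable)
  · filter_upwards [hφC] with x hx using hb x _ hx
  · filter_upwards [h.tendsto_ae] with x hx
    exact ((hF.tendsto _).comp hx).const_mul _

namespace ConformalFlow

variable {T : ℝ} {u S S' : ℝ → M → ℝ} {X : ℝ → ∀ x : M, TangentSpace (𝓡 n) x} {S₀ : M → ℝ}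
  {ρ : ℝ → ℝ} {t : ℝ}

lemma measField (h : ConformalFlow G T u S S' X S₀ ρ) (ht : t ∈ Icc 0 T) : MeasField G (X t) :=
  (h.approx t ht).choose_spec.field

lemma memLp_nrm (h : ConformalFlow G T u S S' X S₀ ρ) (ht : t ∈ Icc 0 T) :
    MemLp (nrm G (X t)) 2 (vol G.inner) :=
  (h.approx t ht).choose_spec.memLp_nrm

lemma continuous (h : ConformalFlow G T u S S' X S₀ ρ) (ht : t ∈ Icc 0 T) : Continuous (u t) :=
  (h.contMDiff t ht).continuous

lemma abs_le (h : ConformalFlow G T u S S' X S₀ ρ) :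
    ∃ K, ∀ t ∈ Icc 0 T, ∀ x, |u t x| ≤ K := by
  obtain ⟨C, hC, hb⟩ := h.bound
  exact ⟨C, fun t ht x => by rw [abs_of_pos (h.pos ht x)]; exact (hb t ht x).2⟩

lemma continuous_ip_test (h : ConformalFlow G T u S S' X S₀ ρ) (ht : t ∈ Icc 0 T) {ψ : M → ℝ}
    (hψ : IsTest n ψ) : ∃ K, ∀ x, |ip G (grad G ψ) (grad G (u t)) x| ≤ K := by
  refine (continuous_ip_grad hψ.contMDiff (h.contMDiff t ht)).bounded_above_of_compact_support
    (HasCompactSupport.intro hψ.2 fun x hx => ?_)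
  simp [ip, grad_eq_zero_of_notMem_tsupport hx]

/-- Green's formula for the product `S u`. That product is not `C¹`, so the formula is applied to
`σⱼ u` with test functions `σⱼ → S`, and the limit is taken on both sides. -/
lemma integral_scalar_mul_laplacian (h : ConformalFlow G T u S S' X S₀ ρ) (ht : t ∈ Icc 0 T)
    {ψ L : M → ℝ} (hψ : IsTest n ψ) (hL : Continuous L) (hLc : HasCompactSupport L)
    (hLψ : ∀ f : M → ℝ, ContMDiff (𝓡 n) 𝓘(ℝ, ℝ) 1 f →
      ∫ x, ip G (grad G ψ) (grad G f) x ∂(vol G.inner) = - ∫ x, f x * L x ∂(vol G.inner)) :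
    ∫ x, ip G (grad G ψ) (grad G (u t)) x * S t x ∂(vol G.inner)
      + ∫ x, u t x * ip G (X t) (grad G ψ) x ∂(vol G.inner)
      = - ∫ x, L x * S t x * u t x ∂(vol G.inner) := by
  have := h.isProbabilityMeasure
  obtain ⟨σ, hσ⟩ := h.approx t ht
  obtain ⟨K, hK⟩ := h.abs_le
  have hu2 : MemLp (u t) 2 (vol G.inner) :=
    MemLp.of_bound (h.continuous ht).aestronglyMeasurable K (ae_of_all _ (hK t ht))
  obtain ⟨A, hA⟩ := h.continuous_ip_test ht hψ
  obtain ⟨B, hB⟩ := hL.bounded_above_of_compact_support hLc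
  have hip := (continuous_ip_grad (G := G) hψ.contMDiff (h.contMDiff t ht))
  have l1 := tendsto_integral_mul_of_L2 (g₀ := fun _ => 1) hip.aestronglyMeasurable
    (ae_of_all _ hA) (fun j => (hσ.test j).aestronglyMeasurable) hσ.memLp hσ.tendsto (memLp_const 1)
  have l2 := tendsto_integral_mul_ip_of_L2 (h.continuous ht).aestronglyMeasurable
    (ae_of_all _ (hK t ht)) (fun j => measField_grad (G := G) (hσ.test j).contMDiff) hσ.field
    hσ.memLp_nrm hσ.tendsto_grad (measField_grad hψ.contMDiff)
    (memLp_nrm_grad_of_hasCompactSupport hψ.contMDiff hψ.2)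
  have l3 := tendsto_integral_mul_of_L2 (g₀ := u t) hL.aestronglyMeasurable
    (ae_of_all _ hB) (fun j => (hσ.test j).aestronglyMeasurable) hσ.memLp hσ.tendsto hu2
  simp only [mul_one] at l1
  refine tendsto_nhds_unique (l1.add l2) (l3.neg.congr fun j => ?_)
  have hc := (hσ.test j).contMDiff
  have e := hLψ (fun x => σ j x * u t x) (hc.mul (h.contMDiff t ht))
  have e2 : ∀ x, ip G (grad G ψ) (grad G fun x => σ j x * u t x) x
      = ip G (grad G ψ) (grad G (u t)) x * σ j x
        + u t x * ip G (grad G (σ j)) (grad G ψ) x := by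
    intro x
    rw [ip_comm (grad G (σ j))]
    simp only [ip, grad_mul hc (h.contMDiff t ht) x, map_add, map_smul, smul_eq_mul]
    ring
  simp only [e2] at e
  rw [integral_add] at e
  · rw [e]
    congr 1
    exact integral_congr_ae (ae_of_all _ fun x => by ring)
  · exact (hip.mul (hσ.test j).1.continuous).integrable_of_hasCompactSupport (hσ.test j).2.mul_left
  · refine ((h.continuous ht).mul (continuous_ip_grad hc
      hψ.contMDiff)).integrable_of_hasCompactSupport (HasCompactSupport.intro hψ.2 fun x hx => ?_)
    simp [ip, grad_eq_zero_of_notMem_tsupport hx]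

/-- The weak curvature equation tested with `ψ S`, through the admissible test functions `σⱼ ψ`. It
eliminates the background curvature when the equation is differentiated in time. -/
lemma weak_scalar_mul (h : ConformalFlow G T u S S' X S₀ ρ) (ht : t ∈ Icc 0 T)
    {ψ : M → ℝ} (hψ : IsTest n ψ) :
    ∫ x, u t x ^ (((n : ℝ) + 2) / ((n : ℝ) - 2)) * ψ x * S t x * S t x ∂(vol G.inner)
      = confConst n * (∫ x, ip G (grad G ψ) (grad G (u t)) x * S t x ∂(vol G.inner)
        + ∫ x, ip G (X t) (fun x => ψ x • grad G (u t) x) x ∂(vol G.inner))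
        + ∫ x, u t x * ψ x * S t x * S₀ x ∂(vol G.inner) := by
  have := h.isProbabilityMeasure
  obtain ⟨σ, hσ⟩ := h.approx t ht
  obtain ⟨K, hK⟩ := h.abs_le
  obtain ⟨C, -, hC⟩ := h.ae_bound_rpow (((n : ℝ) + 2) / ((n : ℝ) - 2))
  obtain ⟨A, hA⟩ := h.continuous_ip_test ht hψ
  obtain ⟨B, hB⟩ := hψ.1.continuous.bounded_above_of_compact_support hψ.2
  have hcu := h.contMDiff t ht
  have hip := (continuous_ip_grad (G := G) hψ.contMDiff hcu)
  have hb : ∀ {U : M → ℝ} {K}, (∀ x, |U x| ≤ K) → ∀ x, |U x * ψ x| ≤ K * B := fun hU x => by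
    rw [abs_mul]
    exact mul_le_mul (hU x) (hB x) (abs_nonneg _) ((abs_nonneg _).trans (hU x))
  have l1 := tendsto_integral_mul_of_L2
    ((h.continuous_rpow (((n : ℝ) + 2) / ((n : ℝ) - 2)) ht).mul hψ.1.continuous).aestronglyMeasurable
    (ae_of_all _ (hb (hC t ht))) (fun j => (hσ.test j).aestronglyMeasurable)
    hσ.memLp hσ.tendsto (h.memLp t ht)
  have l2 := tendsto_integral_mul_of_L2 (g₀ := fun _ => 1) hip.aestronglyMeasurable
    (ae_of_all _ hA) (fun j => (hσ.test j).aestronglyMeasurable) hσ.memLp hσ.tendsto (memLp_const 1)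
  have l3 := tendsto_integral_mul_ip_of_L2 (a := fun _ => 1) (K := 1)
    (Y₀ := fun x => ψ x • grad G (u t) x)
    aestronglyMeasurable_const (by simp) (fun j => measField_grad (G := G) (hσ.test j).contMDiff)
    hσ.field hσ.memLp_nrm hσ.tendsto_grad ((measField_grad hcu).smul hψ.aestronglyMeasurable)
    (memLp_nrm_grad hcu hψ)
  have l4 := tendsto_integral_mul_of_L2
    ((h.continuous ht).mul hψ.1.continuous).aestronglyMeasurable
    (ae_of_all _ (hb (hK t ht))) (fun j => (hσ.test j).aestronglyMeasurable)
    hσ.memLp hσ.tendsto h.memLp_zero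
  simp only [mul_one, one_mul] at l2 l3
  simp only [Pi.mul_apply] at l1 l4
  refine tendsto_nhds_unique l1 ((((l2.add l3).const_mul (confConst n)).add l4).congr fun j => ?_)
  have hc := (hσ.test j).contMDiff
  have e := h.weak t ht _ (hψ.mul (hσ.test j).1)
  have e2 : ∀ x, ip G (grad G fun x => σ j x * ψ x) (grad G (u t)) x
      = ip G (grad G ψ) (grad G (u t)) x * σ j x
        + ip G (grad G (σ j)) (fun x => ψ x • grad G (u t) x) x := by
    intro x
    simp only [ip, grad_mul hc hψ.contMDiff x, map_add, map_smul, smul_eq_mul, _root_.add_apply,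
      _root_.smul_apply]
    ring
  simp only [e2] at e
  rw [integral_add] at e
  · rw [show (fun x => u t x ^ (((n : ℝ) + 2) / ((n : ℝ) - 2)) * ψ x * σ j x * S t x)
      = fun x => S t x * u t x ^ (((n : ℝ) + 2) / ((n : ℝ) - 2)) * (σ j x * ψ x) from
      funext fun x => by ring, e]
    congr 2
    funext x
    ring
  · exact (hip.mul (hσ.test j).1.continuous).integrable_of_hasCompactSupport (hσ.test j).2.mul_left
  · have : (ip G (grad G (σ j)) fun x => ψ x • grad G (u t) x)
        = fun x => ψ x * ip G (grad G (σ j)) (grad G (u t)) x := by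
      funext x; simp [ip]
    rw [this]
    exact (hψ.1.continuous.mul (continuous_ip_grad hc hcu)).integrable_of_hasCompactSupport
      hψ.2.mul_right

/-- The evolution equation of the scalar curvature, in weak form. -/
lemma integral_deriv_mul_test (h : ConformalFlow G T u S S' X S₀ ρ) (ht : t ∈ Ioo 0 T)
    {ψ : M → ℝ} (hψ : IsTest n ψ) :
    ∫ x, u t x ^ (((n : ℝ) + 2) / ((n : ℝ) - 2)) * ψ x * S' t x ∂(vol G.inner)
      = ∫ x, u t x ^ (((n : ℝ) + 2) / ((n : ℝ) - 2)) * ψ x * S t x * S t x ∂(vol G.inner)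
        - ρ t * ∫ x, u t x ^ (((n : ℝ) + 2) / ((n : ℝ) - 2)) * ψ x * S t x ∂(vol G.inner)
        + ((n : ℝ) - 1) * (∫ x, ip G (X t) (fun x => ψ x • grad G (u t) x) x ∂(vol G.inner)
          - ∫ x, u t x * ip G (X t) (grad G ψ) x ∂(vol G.inner)) := by
  have := h.isProbabilityMeasure
  have ht' := Ioo_subset_Icc_self ht
  have hn2 := h.two_lt
  set N := ((n : ℝ) + 2) / ((n : ℝ) - 2) with hN
  obtain ⟨B, hB⟩ := hψ.1.continuous.bounded_above_of_compact_support hψ.2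
  -- With the Laplacian on `ψ` the curvature equation contains only `u`, so no time derivative of
  -- the spatial gradient of `u` is needed.
  obtain ⟨L, hL, hLc, hLψ⟩ := exists_laplacian (G := G) hψ
  obtain ⟨D, hD⟩ := hL.bounded_above_of_compact_support hLc
  have d1 := h.hasDerivAt_integral_comp (B := id) (B' := fun _ => 1) (K' := 1) (L := 0) N
    hψ.1.continuous hB measurable_const (by simp) (by intros; simp)
    (fun s hs => h.memLp s (Ioo_subset_Icc_self hs)) ht
  have d2 := (h.hasDerivAt_integral_fixed (φ := fun _ => 1) 1 hL hD (memLp_const 1) ht).const_mul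
    (-confConst n)
  have d3 := h.hasDerivAt_integral_fixed 1 hψ.1.continuous hB h.memLp_zero ht
  -- Both sides of the weak curvature equation are differentiable in time; uniqueness of the
  -- derivative equates their derivatives.
  have e := d1.unique ((d2.add d3).congr_of_eventuallyEq (by
    filter_upwards [Ioo_mem_nhds ht.1 ht.2] with s hs
    have hs' := Ioo_subset_Icc_self hs
    have e1 := h.weak s hs' ψ hψ
    rw [hLψ _ (h.contMDiff s hs')] at e1
    simp only [id, Pi.add_apply, Real.rpow_one, one_mul]
    rw [show (fun x => S s x * (ψ x * u s x ^ N)) = fun x => S s x * u s x ^ N * ψ x from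
      funext fun x => by ring, e1]
    rw [mul_neg, neg_mul]
    congr 2
    · congr 2
      funext x; ring
    · funext x; ring))
  simp only [id, Real.rpow_one, one_mul] at e
  have w0 := h.weak t ht' ψ hψ
  rw [hLψ _ (h.contMDiff t ht')] at w0
  have w1 := h.integral_scalar_mul_laplacian ht' hψ hL hLc hLψ
  have w2 := h.weak_scalar_mul ht' hψ
  obtain ⟨K, hK⟩ := h.abs_le
  obtain ⟨C, -, hC⟩ := h.ae_bound_rpow N
  have hS := h.memLp t ht'
  have hb : ∀ {U : M → ℝ} {K}, (∀ x, |U x| ≤ K) → ∀ x, |U x * ψ x| ≤ K * B := fun hU x => by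
    rw [abs_mul]
    exact mul_le_mul (hU x) (hB x) (abs_nonneg _) ((abs_nonneg _).trans (hU x))
  have hP : AEStronglyMeasurable (fun x => u t x ^ N * ψ x) (vol G.inner) :=
    ((h.continuous_rpow N ht').mul hψ.1.continuous).aestronglyMeasurable
  have hQ : AEStronglyMeasurable (fun x => u t x * ψ x) (vol G.inner) :=
    ((h.continuous ht').mul hψ.1.continuous).aestronglyMeasurable
  have i1 : Integrable (fun x => u t x ^ N * ψ x * S t x * S t x) (vol G.inner) :=
    integrable_mul_mul hP (ae_of_all _ (hb (hC t ht'))) hS hS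
  have i2 : Integrable (fun x => u t x ^ N * ψ x * S t x) (vol G.inner) := by
    simpa using integrable_mul_mul hP (ae_of_all _ (hb (hC t ht'))) hS (memLp_const 1)
  have i3 : Integrable (fun x => L x * u t x) (vol G.inner) :=
    (hL.mul (h.continuous ht')).integrable_of_hasCompactSupport hLc.mul_right
  have i4 : Integrable (fun x => L x * S t x * u t x) (vol G.inner) :=
    integrable_mul_mul hL.aestronglyMeasurable (ae_of_all _ hD) hS
      (MemLp.of_bound (h.continuous ht').aestronglyMeasurable K (ae_of_all _ (hK t ht')))
  have i5 : Integrable (fun x => u t x * ψ x * S₀ x) (vol G.inner) := by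
    simpa using integrable_mul_mul hQ (ae_of_all _ (hb (hK t ht'))) h.memLp_zero (memLp_const 1)
  have i6 : Integrable (fun x => u t x * ψ x * S t x * S₀ x) (vol G.inner) :=
    integrable_mul_mul hQ (ae_of_all _ (hb (hK t ht'))) hS h.memLp_zero
  have f1 : ∫ x, S t x * (ψ x * (N * (((n : ℝ) - 2) / 4) * u t x ^ N) * (ρ t - S t x)) ∂(vol G.inner)
      = N * (((n : ℝ) - 2) / 4) * (ρ t * ∫ x, u t x ^ N * ψ x * S t x ∂(vol G.inner)
        - ∫ x, u t x ^ N * ψ x * S t x * S t x ∂(vol G.inner)) := by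
    rw [← integral_const_mul, ← integral_sub (i2.const_mul _) i1, ← integral_const_mul]
    exact integral_congr_ae (ae_of_all _ fun x => by ring)
  have f2 : ∫ x, L x * (((n : ℝ) - 2) / 4 * u t x) * (ρ t - S t x) ∂(vol G.inner)
      = (((n : ℝ) - 2) / 4) * (ρ t * ∫ x, L x * u t x ∂(vol G.inner)
        - ∫ x, L x * S t x * u t x ∂(vol G.inner)) := by
    rw [← integral_const_mul, ← integral_sub (i3.const_mul _) i4, ← integral_const_mul]
    exact integral_congr_ae (ae_of_all _ fun x => by ring)
  have f3 : ∫ x, S₀ x * (ψ x * (((n : ℝ) - 2) / 4 * u t x) * (ρ t - S t x)) ∂(vol G.inner)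
      = (((n : ℝ) - 2) / 4) * (ρ t * ∫ x, u t x * ψ x * S₀ x ∂(vol G.inner)
        - ∫ x, u t x * ψ x * S t x * S₀ x ∂(vol G.inner)) := by
    rw [← integral_const_mul, ← integral_sub (i5.const_mul _) i6, ← integral_const_mul]
    exact integral_congr_ae (ae_of_all _ fun x => by ring)
  have g1 : ∫ x, S t x * u t x ^ N * ψ x ∂(vol G.inner)
      = ∫ x, u t x ^ N * ψ x * S t x ∂(vol G.inner) :=
    integral_congr_ae (ae_of_all _ fun x => by ring)
  have g2 : ∫ x, S₀ x * u t x * ψ x ∂(vol G.inner) = ∫ x, u t x * ψ x * S₀ x ∂(vol G.inner) :=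
    integral_congr_ae (ae_of_all _ fun x => by ring)
  have g3 : ∫ x, u t x * L x ∂(vol G.inner) = ∫ x, L x * u t x ∂(vol G.inner) :=
    integral_congr_ae (ae_of_all _ fun x => by ring)
  have g4 : ∫ x, S' t x * (ψ x * u t x ^ N) ∂(vol G.inner)
      = ∫ x, u t x ^ N * ψ x * S' t x ∂(vol G.inner) :=
    integral_congr_ae (ae_of_all _ fun x => by ring)
  have hc : confConst n * (((n : ℝ) - 2) / 4) = (n : ℝ) - 1 := by
    rw [confConst]; field_simp
  have hN4 : N * (((n : ℝ) - 2) / 4) = ((n : ℝ) - 2) / 4 + 1 := by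
    rw [hN]; field_simp; ring
  rw [f1, f2, f3, g4, hN4] at e
  rw [g1, g2, g3] at w0
  -- `w0` removes the terms with `ρ` of weight `(n-2)/4`, `w1` converts `∫ L S u` into gradient
  -- terms, and `w2` eliminates `S₀`. The pairings of `S` with `⟨∇ψ, ∇u⟩` from `w1` and `w2` cancel.
  linear_combination e - (((n : ℝ) - 2) / 4) * ρ t * w0 + (confConst n * (((n : ℝ) - 2) / 4)) * w1
    + (((n : ℝ) - 2) / 4) * w2 + (∫ x, ip G (X t) (fun x => ψ x • grad G (u t) x) x ∂(vol G.inner)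
          - ∫ x, u t x * ip G (X t) (grad G ψ) x ∂(vol G.inner)) * hc

end ConformalFlow

end SpatialIdentities

/-! ### Extension to bounded Sobolev functions, the Yamabe inequality for `g(t)`, and monotonicity
of `ρ`. -/

section SobolevIdentities

variable {n : ℕ} {M : Type*} [TopologicalSpace M] [T2Space M] [ChartedSpace (Eucl n) M]
  [IsManifold (𝓡 n) ∞ M] [MeasurableSpace M] [BorelSpace M] [SecondCountableTopology M]
  {G : Bundle.ContMDiffRiemannianMetric (𝓡 n) ∞ (Eucl n) (fun x : M => TangentSpace (𝓡 n) x)}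

namespace ConformalFlow

variable {T : ℝ} {u S S' : ℝ → M → ℝ} {X : ℝ → ∀ x : M, TangentSpace (𝓡 n) x} {S₀ : M → ℝ}
  {ρ : ℝ → ℝ} {t : ℝ}

/-- The intended test functions contain the factor `u` and so are merely `C¹`. They are reached from
smooth ones by density, with `η ∇u` in place of `∇u`. -/
lemma weak_of_contMDiff (h : ConformalFlow G T u S S' X S₀ ρ) (ht : t ∈ Icc 0 T) {w : M → ℝ}
    (hw : ContMDiff (𝓡 n) 𝓘(ℝ, ℝ) 1 w) (hc : HasCompactSupport w) :
    ∫ x, u t x ^ (((n : ℝ) + 2) / ((n : ℝ) - 2)) * w x * S t x ∂(vol G.inner)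
      = confConst n * ∫ x, ip G (grad G w) (grad G (u t)) x ∂(vol G.inner)
        + ∫ x, u t x * w x * S₀ x ∂(vol G.inner) := by
  have := h.isProbabilityMeasure
  obtain ⟨ψ, η, hψ, hη, hwη, hψη⟩ := exists_bApprox_of_contMDiff h.dense hw hc
  obtain ⟨K, hK⟩ := h.abs_le
  obtain ⟨C, -, hC⟩ := h.ae_bound_rpow (((n : ℝ) + 2) / ((n : ℝ) - 2))
  have hcu := h.contMDiff t ht
  have l1 := hψ.tendsto_integral (F := id) (g := fun _ => 1) continuous_id
    (h.continuous_rpow (((n : ℝ) + 2) / ((n : ℝ) - 2)) ht).aestronglyMeasurable (hC t ht)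
    (h.memLp t ht) (memLp_const 1)
  have l2 := hψ.tendsto_integral (F := id) (g := fun _ => 1) continuous_id
    (h.continuous ht).aestronglyMeasurable (hK t ht) h.memLp_zero (memLp_const 1)
  have l3 := tendsto_integral_mul_ip_of_L2 (a := fun _ => 1) (K := 1)
    (Y₀ := fun x => η x • grad G (u t) x)
    aestronglyMeasurable_const (by simp) (fun j => measField_grad (G := G) (hψ.test j).contMDiff)
    hψ.field hψ.memLp_nrm hψ.tendsto_grad ((measField_grad hcu).smul hη.aestronglyMeasurable)
    (memLp_nrm_grad hcu hη)
  simp only [id, mul_one, one_mul] at l1 l2 l3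
  have e1 : ∀ {f : M → ℝ}, (∀ x ∈ tsupport f, η x = 1) →
      ip G (grad G f) (fun x => η x • grad G (u t) x) = ip G (grad G f) (grad G (u t)) := by
    intro f hf
    funext x
    by_cases hx : x ∈ tsupport f
    · simp [ip, hf x hx]
    · simp [ip, grad_eq_zero_of_notMem_tsupport hx]
  rw [← e1 hwη]
  refine tendsto_nhds_unique l1 (((l3.const_mul (confConst n)).add l2).congr fun j => ?_)
  have e := h.weak t ht _ (hψ.test j)
  rw [e1 (hψη j), show (fun x => u t x ^ (((n : ℝ) + 2) / ((n : ℝ) - 2)) * ψ j x * S t x)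
      = fun x => S t x * u t x ^ (((n : ℝ) + 2) / ((n : ℝ) - 2)) * ψ j x from
      funext fun x => by ring, e]
  congr 2
  funext x
  ring

lemma integral_deriv_mul_of_contMDiff (h : ConformalFlow G T u S S' X S₀ ρ) (ht : t ∈ Ioo 0 T)
    {w : M → ℝ} (hw : ContMDiff (𝓡 n) 𝓘(ℝ, ℝ) 1 w) (hc : HasCompactSupport w) :
    ∫ x, u t x ^ (((n : ℝ) + 2) / ((n : ℝ) - 2)) * w x * S' t x ∂(vol G.inner)
      = ∫ x, u t x ^ (((n : ℝ) + 2) / ((n : ℝ) - 2)) * w x * S t x * S t x ∂(vol G.inner)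
        - ρ t * ∫ x, u t x ^ (((n : ℝ) + 2) / ((n : ℝ) - 2)) * w x * S t x ∂(vol G.inner)
        + ((n : ℝ) - 1) * (∫ x, ip G (X t) (fun x => w x • grad G (u t) x) x ∂(vol G.inner)
          - ∫ x, u t x * ip G (X t) (grad G w) x ∂(vol G.inner)) := by
  have := h.isProbabilityMeasure
  have ht' := Ioo_subset_Icc_self ht
  obtain ⟨ψ, η, hψ, hη, hwη, hψη⟩ := exists_bApprox_of_contMDiff h.dense hw hc
  obtain ⟨K, hK⟩ := h.abs_le
  obtain ⟨C, -, hC⟩ := h.ae_bound_rpow (((n : ℝ) + 2) / ((n : ℝ) - 2))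
  have hcu := h.contMDiff t ht'
  have hP := (h.continuous_rpow (((n : ℝ) + 2) / ((n : ℝ) - 2)) ht').aestronglyMeasurable
    (μ := vol G.inner)
  have l1 := hψ.tendsto_integral (F := id) (g := fun _ => 1) continuous_id hP (hC t ht')
    (h.memLp' t ht) (memLp_const 1)
  have l2 := hψ.tendsto_integral (F := id) continuous_id hP (hC t ht')
    (h.memLp t ht') (h.memLp t ht')
  have l3 := hψ.tendsto_integral (F := id) (g := fun _ => 1) continuous_id hP (hC t ht')
    (h.memLp t ht') (memLp_const 1)
  obtain ⟨B, -, hB, hwB⟩ := hψ.ae_bound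
  have hX := h.measField ht'
  have hX2 := h.memLp_nrm ht'
  have hz : Tendsto (fun _ : ℕ => eLpNorm (nrm G fun x => (0 : TangentSpace (𝓡 n) x)) 2
      (vol G.inner)) atTop (𝓝 0) := by
    have : (nrm G fun x => (0 : TangentSpace (𝓡 n) x)) = 0 := by
      funext x; simp [nrm, ip]
    simp [this]
  have l4 := tendsto_integral_mul_ip (a := ψ) (a₀ := w) (K := B) (X := fun _ => X t) (X₀ := X t)
    (Y := fun _ x => η x • grad G (u t) x) (Y₀ := fun x => η x • grad G (u t) x) (l := atTop)
    (Eventually.of_forall fun j => (hψ.test j).aestronglyMeasurable)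
    hw.continuous.aestronglyMeasurable (Eventually.of_forall fun j => ae_of_all _ (hB j)) hwB
    hψ.tendsto_ae (Eventually.of_forall fun _ => hX) hX hX2 (by simpa using hz)
    (Eventually.of_forall fun _ => (measField_grad hcu).smul hη.aestronglyMeasurable)
    ((measField_grad hcu).smul hη.aestronglyMeasurable) (memLp_nrm_grad hcu hη)
    (by simpa using hz)
  have l5 := tendsto_integral_mul_ip_of_L2 (a := u t) (h.continuous ht').aestronglyMeasurable
    (ae_of_all _ (hK t ht')) (fun j => measField_grad (G := G) (hψ.test j).contMDiff)
    hψ.field hψ.memLp_nrm hψ.tendsto_grad hX hX2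
  simp only [id, mul_one] at l1 l2 l3
  have e1 : ∀ {f : M → ℝ}, (∀ x ∈ tsupport f, η x = 1) →
      (fun x => f x * ip G (X t) (fun x => η x • grad G (u t) x) x)
        = ip G (X t) (fun x => f x • grad G (u t) x) := by
    intro f hf
    funext x
    by_cases hx : x ∈ tsupport f
    · simp [ip, hf x hx]
    · simp [ip, image_eq_zero_of_notMem_tsupport hx]
  simp only [e1 hwη, fun j => e1 (hψη j)] at l4
  simp only [fun f : M → ℝ => ip_comm (G := G) (grad G f) (X t)] at l5
  refine tendsto_nhds_unique l1 (((l2.sub (l3.const_mul (ρ t))).add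
    ((l4.sub l5).const_mul ((n : ℝ) - 1))).congr fun j => ?_)
  exact (h.integral_deriv_mul_test ht (hψ.test j)).symm

lemma rpow_mul_self (h : ConformalFlow G T u S S' X S₀ ρ) (ht : t ∈ Icc 0 T) (x : M) :
    u t x ^ (((n : ℝ) + 2) / ((n : ℝ) - 2)) * u t x = u t x ^ (2 * (n : ℝ) / ((n : ℝ) - 2)) := by
  have hn2 := h.two_lt
  rw [← Real.rpow_add_one (h.pos ht x).ne']
  congr 1
  field_simp
  ring

/-- With `w = u φ` the terms `u φ ⟨X, ∇u⟩` cancel and only `-u² ⟨∇φ, X⟩` is left, which is `-⟨∇φ,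
∇S⟩_g dVol_g`. The equation takes the divergence form `∂ₜS = (n-1) Δ_g S + S (S - ρ)`. -/
lemma integral_deriv_mul_of_isTest (h : ConformalFlow G T u S S' X S₀ ρ) (ht : t ∈ Ioo 0 T)
    {φ : M → ℝ} (hφ : IsTest n φ) :
    ∫ x, u t x ^ (2 * (n : ℝ) / ((n : ℝ) - 2)) * φ x * S' t x ∂(vol G.inner)
      = ∫ x, u t x ^ (2 * (n : ℝ) / ((n : ℝ) - 2)) * φ x * S t x * S t x ∂(vol G.inner)
        - ρ t * ∫ x, u t x ^ (2 * (n : ℝ) / ((n : ℝ) - 2)) * φ x * S t x ∂(vol G.inner)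
        - ((n : ℝ) - 1) * ∫ x, u t x ^ 2 * ip G (grad G φ) (X t) x ∂(vol G.inner) := by
  have := h.isProbabilityMeasure
  have ht' := Ioo_subset_Icc_self ht
  have hcu := h.contMDiff t ht'
  obtain ⟨K, hK⟩ := h.abs_le
  have e := h.integral_deriv_mul_of_contMDiff ht (hcu.mul hφ.contMDiff) hφ.2.mul_left
  simp only [Pi.mul_apply, ← mul_assoc, h.rpow_mul_self ht'] at e
  rw [e, sub_eq_add_neg _ (((n : ℝ) - 1) * _), ← mul_neg]
  congr 2
  have i1 : Integrable (ip G (X t) (fun x => (u t x * φ x) • grad G (u t) x)) (vol G.inner) := by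
    have := integrable_mul_ip (h.continuous ht').aestronglyMeasurable (ae_of_all _ (hK t ht'))
      (h.measField ht') (h.memLp_nrm ht') ((measField_grad hcu).smul hφ.aestronglyMeasurable)
      (memLp_nrm_grad hcu hφ)
    refine this.congr (ae_of_all _ fun x => ?_)
    simp [ip, mul_assoc]
  have i2 : Integrable (fun x => u t x * ip G (X t) (grad G fun x => u t x * φ x) x)
      (vol G.inner) :=
    integrable_mul_ip (h.continuous ht').aestronglyMeasurable (ae_of_all _ (hK t ht'))
      (h.measField ht') (h.memLp_nrm ht') (measField_grad (hcu.mul hφ.contMDiff))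
      (memLp_nrm_grad_of_hasCompactSupport (hcu.mul hφ.contMDiff) hφ.2.mul_left)
  rw [← integral_neg]
  refine (integral_sub i1 i2).symm.trans (integral_congr_ae (ae_of_all _ fun x => ?_))
  simp only [ip, grad_mul hcu hφ.contMDiff x, map_add, map_smul, smul_eq_mul]
  rw [G.symm x (grad G φ x)]
  ring

/-- Positivity of the Yamabe functional of the evolving metric, on test functions. -/
lemma yamabe_of_isTest (h : ConformalFlow G T u S S' X S₀ ρ) (ht : t ∈ Icc 0 T)
    {φ : M → ℝ} (hφ : IsTest n φ) :
    0 ≤ confConst n * ∫ x, u t x ^ 2 * ip G (grad G φ) (grad G φ) x ∂(vol G.inner)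
      + ∫ x, u t x ^ (2 * (n : ℝ) / ((n : ℝ) - 2)) * φ x ^ 2 * S t x ∂(vol G.inner) := by
  have := h.isProbabilityMeasure
  have hcu := h.contMDiff t ht
  have hv : ContMDiff (𝓡 n) 𝓘(ℝ, ℝ) 1 fun x => u t x * φ x := hcu.mul hφ.contMDiff
  have hvc : HasCompactSupport fun x => u t x * φ x := hφ.2.mul_left
  have hw : ContMDiff (𝓡 n) 𝓘(ℝ, ℝ) 1 fun x => (u t x * φ x) * φ x := hv.mul hφ.contMDiff
  have e1 := h.yamabe _ hv hvc
  have e2 := h.weak_of_contMDiff ht hw hφ.2.mul_left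
  simp only [← mul_assoc, h.rpow_mul_self ht] at e2
  have i1 : Integrable (fun x => u t x ^ 2 * ip G (grad G φ) (grad G φ) x) (vol G.inner) :=
    integrable_mul_grad_sq ((h.continuous ht).pow 2) hφ
  have i2 : Integrable (ip G (grad G fun x => (u t x * φ x) * φ x) (grad G (u t)))
      (vol G.inner) := by
    refine (continuous_ip_grad hw hcu).integrable_of_hasCompactSupport
      (HasCompactSupport.intro (hφ.2.mul_left (f := fun x => u t x * φ x)) fun x hx => ?_)
    have := grad_eq_zero_of_notMem_tsupport (G := G) hx
    simp only [Pi.mul_def] at this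
    simp [ip, this]
  -- The identity `|∇(uφ)|² = u² |∇φ|² + ⟨∇(uφ²), ∇u⟩` expresses conformal covariance. The last term
  -- is the gradient term of the curvature equation tested with `u φ²`.
  have e3 : ∫ x, ip G (grad G fun x => u t x * φ x) (grad G fun x => u t x * φ x) x ∂(vol G.inner)
      = ∫ x, u t x ^ 2 * ip G (grad G φ) (grad G φ) x ∂(vol G.inner)
        + ∫ x, ip G (grad G fun x => (u t x * φ x) * φ x) (grad G (u t)) x ∂(vol G.inner) := by
    rw [← integral_add i1 i2]
    refine integral_congr_ae (ae_of_all _ fun x => ?_)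
    simp only [ip, grad_mul hv hφ.contMDiff x, grad_mul hcu hφ.contMDiff x, map_add, map_smul,
      smul_eq_mul, _root_.add_apply, _root_.smul_apply]
    linear_combination (u t x * φ x) * G.symm x (grad G (u t) x) (grad G φ x)
  have e4 : ∫ x, S₀ x * (u t x * φ x) ^ 2 ∂(vol G.inner)
      = ∫ x, u t x * u t x * φ x * φ x * S₀ x ∂(vol G.inner) :=
    integral_congr_ae (ae_of_all _ fun x => by ring)
  have e5 : ∫ x, u t x ^ (2 * (n : ℝ) / ((n : ℝ) - 2)) * φ x ^ 2 * S t x ∂(vol G.inner)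
      = ∫ x, u t x ^ (2 * (n : ℝ) / ((n : ℝ) - 2)) * φ x * φ x * S t x ∂(vol G.inner) :=
    integral_congr_ae (ae_of_all _ fun x => by ring)
  rw [e3, e4] at e1
  rw [e5, e2]
  linarith

variable {φ : M → ℝ} {Y : ∀ x : M, TangentSpace (𝓡 n) x} {ψ : ℕ → M → ℝ}

lemma exists_abs_sq_le (h : ConformalFlow G T u S S' X S₀ ρ) :
    ∃ K, ∀ t ∈ Icc 0 T, ∀ x, |u t x ^ 2| ≤ K := by
  obtain ⟨K, hK⟩ := h.abs_le
  refine ⟨K ^ 2, fun t ht x => ?_⟩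
  rw [abs_pow]
  exact pow_le_pow_left₀ (abs_nonneg _) (hK t ht x) 2

/-- The factors `u` are bounded, `S` and `S'` are in `L²`, and `φ` is approximated boundedly with
gradients converging in `L²`. Every term of the equation passes to the limit. -/
lemma integral_deriv_mul (h : ConformalFlow G T u S S' X S₀ ρ) (ht : t ∈ Ioo 0 T)
    (hφ : BApprox G φ Y ψ) :
    ∫ x, u t x ^ (2 * (n : ℝ) / ((n : ℝ) - 2)) * φ x * S' t x ∂(vol G.inner)
      = ∫ x, u t x ^ (2 * (n : ℝ) / ((n : ℝ) - 2)) * φ x * S t x * S t x ∂(vol G.inner)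
        - ρ t * ∫ x, u t x ^ (2 * (n : ℝ) / ((n : ℝ) - 2)) * φ x * S t x ∂(vol G.inner)
        - ((n : ℝ) - 1) * ∫ x, u t x ^ 2 * ip G Y (X t) x ∂(vol G.inner) := by
  have := h.isProbabilityMeasure
  have ht' := Ioo_subset_Icc_self ht
  obtain ⟨K, hK⟩ := h.exists_abs_sq_le
  obtain ⟨C, -, hC⟩ := h.ae_bound_rpow (2 * (n : ℝ) / ((n : ℝ) - 2))
  have hP := (h.continuous_rpow (2 * (n : ℝ) / ((n : ℝ) - 2)) ht').aestronglyMeasurable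
    (μ := vol G.inner)
  have l1 := hφ.tendsto_integral (F := id) (g := fun _ => 1) continuous_id hP (hC t ht')
    (h.memLp' t ht) (memLp_const 1)
  have l2 := hφ.tendsto_integral (F := id) continuous_id hP (hC t ht')
    (h.memLp t ht') (h.memLp t ht')
  have l3 := hφ.tendsto_integral (F := id) (g := fun _ => 1) continuous_id hP (hC t ht')
    (h.memLp t ht') (memLp_const 1)
  have l5 := tendsto_integral_mul_ip_of_L2 (a := fun x => u t x ^ 2)
    ((h.continuous ht').pow 2).aestronglyMeasurable
    (ae_of_all _ (hK t ht')) (fun j => measField_grad (G := G) (hφ.test j).contMDiff)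
    hφ.field hφ.memLp_nrm hφ.tendsto_grad (h.measField ht') (h.memLp_nrm ht')
  simp only [id, mul_one] at l1 l2 l3
  refine tendsto_nhds_unique l1 (((l2.sub (l3.const_mul (ρ t))).sub
    (l5.const_mul ((n : ℝ) - 1))).congr fun j => ?_)
  exact (h.integral_deriv_mul_of_isTest ht (hφ.test j)).symm

lemma yamabe_nonneg (h : ConformalFlow G T u S S' X S₀ ρ) (ht : t ∈ Icc 0 T)
    (hφ : BApprox G φ Y ψ) :
    0 ≤ confConst n * ∫ x, u t x ^ 2 * ip G Y Y x ∂(vol G.inner)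
      + ∫ x, u t x ^ (2 * (n : ℝ) / ((n : ℝ) - 2)) * φ x ^ 2 * S t x ∂(vol G.inner) := by
  have := h.isProbabilityMeasure
  obtain ⟨K, hK⟩ := h.exists_abs_sq_le
  obtain ⟨C, -, hC⟩ := h.ae_bound_rpow (2 * (n : ℝ) / ((n : ℝ) - 2))
  have hP := (h.continuous_rpow (2 * (n : ℝ) / ((n : ℝ) - 2)) ht).aestronglyMeasurable
    (μ := vol G.inner)
  have l3 := hφ.tendsto_integral (F := fun y => y ^ 2) (g := fun _ => 1) (continuous_pow 2) hP
    (hC t ht) (h.memLp t ht) (memLp_const 1)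
  have hm : ∀ᶠ j in atTop, MeasField G (grad G (ψ j)) :=
    Eventually.of_forall fun j => measField_grad (G := G) (hφ.test j).contMDiff
  have ha : AEStronglyMeasurable (fun x => u t x ^ 2) (vol G.inner) :=
    ((h.continuous ht).pow 2).aestronglyMeasurable
  have l5 := tendsto_integral_mul_ip (a := fun _ x => u t x ^ 2) (a₀ := fun x => u t x ^ 2)
    (Eventually.of_forall fun _ => ha) ha (Eventually.of_forall fun _ => ae_of_all _ (hK t ht))
    (ae_of_all _ (hK t ht)) (ae_of_all _ fun _ => tendsto_const_nhds) hm
    hφ.field hφ.memLp_nrm hφ.tendsto_grad hm hφ.field hφ.memLp_nrm hφ.tendsto_grad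
  simp only [mul_one] at l3
  exact ge_of_tendsto ((l5.const_mul (confConst n)).add l3)
    (Eventually.of_forall fun j => h.yamabe_of_isTest ht (hφ.test j))

/-- The volume is finite, so `1` lies in `H¹` with zero gradient. Density of test functions then
yields cutoffs whose gradients tend to zero in `L²`, which is the role completeness would otherwise
play. -/
lemma exists_bApprox_one (h : ConformalFlow G T u S S' X S₀ ρ) :
    ∃ ψ, BApprox G (fun _ => 1) (fun _ => 0) ψ := by
  have := h.isProbabilityMeasure
  have hw : IsWeakGradient G.inner (fun _ => (1 : ℝ)) fun x => (0 : TangentSpace (𝓡 n) x) :=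
    (isWeakGradient_grad contMDiff_const).congr_field fun x => grad_const 1 x
  have hz : (nrm G fun x => (0 : TangentSpace (𝓡 n) x)) = 0 := by
    funext x; simp [nrm, ip]
  obtain ⟨ψ, hψ⟩ := exists_approx h.dense hw (memLp_const 1) (by rw [hz]; exact MemLp.zero)
  obtain ⟨F, hF, hF0, ⟨K, hK⟩, ⟨C, hC⟩, hFR⟩ := exists_truncation 1
  have := hψ.comp hF hF0 hK hC
  simp only [(hFR 1 (by simp)).1, smul_zero] at this
  exact ⟨_, this⟩

/-- The basic inequality for truncations `F(S)` of the scalar curvature. -/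
lemma integral_deriv_comp_le (h : ConformalFlow G T u S S' X S₀ ρ) (ht : t ∈ Ioo 0 T) {F : ℝ → ℝ}
    (hF : ContDiff ℝ ∞ F) (hF0 : F 0 = 0) {K : ℝ} (hK : ∀ y, |F y| ≤ K)
    (hd0 : ∀ y, 0 ≤ _root_.deriv F y) (hd1 : ∀ y, _root_.deriv F y ≤ 1) :
    ∫ x, u t x ^ (2 * (n : ℝ) / ((n : ℝ) - 2)) * F (S t x) * S' t x ∂(vol G.inner)
      ≤ ∫ x, u t x ^ (2 * (n : ℝ) / ((n : ℝ) - 2)) * F (S t x) * S t x * S t x ∂(vol G.inner)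
        - ρ t * ∫ x, u t x ^ (2 * (n : ℝ) / ((n : ℝ) - 2)) * F (S t x) * S t x ∂(vol G.inner)
        + ((n : ℝ) - 2) / 4 * ∫ x, u t x ^ (2 * (n : ℝ) / ((n : ℝ) - 2)) * F (S t x) ^ 2 * S t x
          ∂(vol G.inner) := by
  have := h.isProbabilityMeasure
  have ht' := Ioo_subset_Icc_self ht
  have hn2 := h.two_lt
  obtain ⟨σ, hσ⟩ := h.approx t ht'
  obtain ⟨Q, hQ⟩ := h.exists_abs_sq_le
  have hB := hσ.comp hF hF0 hK (fun y => (abs_of_nonneg (hd0 y)).le.trans (hd1 y))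
  have e1 := h.integral_deriv_mul ht hB
  have e2 := h.yamabe_nonneg ht' hB
  have hu2 : AEStronglyMeasurable (fun x => u t x ^ 2) (vol G.inner) :=
    ((h.continuous ht').pow 2).aestronglyMeasurable
  -- Since `0 ≤ F' ≤ 1`, one has `|∇F(S)|² = F'² |∇S|² ≤ F' |∇S|² = ⟨∇F(S), ∇S⟩`.
  have e3 : ∫ x, u t x ^ 2 * ip G (fun x => _root_.deriv F (S t x) • X t x)
      (fun x => _root_.deriv F (S t x) • X t x) x ∂(vol G.inner)
      ≤ ∫ x, u t x ^ 2 * ip G (fun x => _root_.deriv F (S t x) • X t x) (X t) x ∂(vol G.inner) := by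
    refine integral_mono (integrable_mul_ip hu2 (ae_of_all _ (hQ t ht')) hB.field hB.memLp_nrm
      hB.field hB.memLp_nrm) (integrable_mul_ip hu2 (ae_of_all _ (hQ t ht')) hB.field hB.memLp_nrm
      (h.measField ht') (h.memLp_nrm ht')) fun x => ?_
    refine mul_le_mul_of_nonneg_left ?_ (sq_nonneg _)
    simp only [ip, map_smul, _root_.smul_apply, smul_eq_mul]
    refine mul_le_of_le_one_left (mul_nonneg (hd0 _) (inner_self_nonneg G x _)) (hd1 _)
  -- Multiplied by `(n-2)/4`, the Dirichlet coefficient of the Yamabe functional is the diffusion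
  -- constant `n - 1`, so the functional absorbs the whole gradient term.
  have hc : confConst n * (((n : ℝ) - 2) / 4) = (n : ℝ) - 1 := by
    rw [confConst]; field_simp
  have hc0 : 0 ≤ (n : ℝ) - 1 := by linarith
  have e4 := mul_nonneg (by positivity : 0 ≤ ((n : ℝ) - 2) / 4) e2
  have e5 := mul_le_mul_of_nonneg_left e3 hc0
  rw [e1]
  rw [mul_add, ← mul_assoc, mul_comm (((n : ℝ) - 2) / 4) (confConst n), hc] at e4
  linarith

/-- The average of `S` is the Yamabe functional of `g(t)` at the constant `1`, as the volume is `1`.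
-/
lemma rho_nonneg (h : ConformalFlow G T u S S' X S₀ ρ) (ht : t ∈ Icc 0 T) : 0 ≤ ρ t := by
  obtain ⟨ψ, hψ⟩ := h.exists_bApprox_one
  have := h.yamabe_nonneg ht hψ
  simp only [ip, map_zero, mul_zero, integral_zero, zero_add, one_pow, mul_one] at this
  rw [h.rho_eq_integral ht]
  refine this.trans_eq (integral_congr_ae (ae_of_all _ fun x => mul_comm _ _))

/-- Testing the evolution of `S` with `1` and adding the change of the volume form gives `ρ' =
-((n-2)/2) ∫ (S - ρ)² dVol_g`. -/
lemma rho_antitone (h : ConformalFlow G T u S S' X S₀ ρ) : AntitoneOn ρ (Icc 0 T) := by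
  have := h.isProbabilityMeasure
  have hn2 := h.two_lt
  set p := 2 * (n : ℝ) / ((n : ℝ) - 2) with hp
  have hd : ∀ t ∈ Ioo 0 T, HasDerivAt ρ (-(((n : ℝ) - 2) / 2)
      * ∫ x, (S t x - ρ t) ^ 2 * u t x ^ p ∂(vol G.inner)) t := by
    intro t ht
    have ht' := Ioo_subset_Icc_self ht
    have d1 := h.hasDerivAt_integral_comp (η := fun _ => 1) (K := 1) (B := id) (B' := fun _ => 1)
      (K' := 1) (L := 0) p continuous_const (by simp) measurable_const (by simp)
      (by intros; simp) (fun s hs => h.memLp s (Ioo_subset_Icc_self hs)) ht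
    simp only [id, one_mul] at d1
    have d2 := d1.congr_of_eventuallyEq (f₁ := ρ) (by
      filter_upwards [Ioo_mem_nhds ht.1 ht.2] with s hs
      rw [h.rho_eq_integral (Ioo_subset_Icc_self hs)])
    convert! d2 using 1
    obtain ⟨ψ, hψ⟩ := h.exists_bApprox_one
    have e1 := h.integral_deriv_mul ht hψ
    simp only [ip, map_zero, _root_.zero_apply, mul_zero, integral_zero, sub_zero, mul_one] at e1
    rw [← hp] at e1
    have i1 : Integrable (fun x => S t x ^ 2 * u t x ^ p) (vol G.inner) :=
      h.integrable_rpow p ht' (h.memLp t ht').integrable_sq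
    have i2 : Integrable (fun x => S t x * u t x ^ p) (vol G.inner) :=
      h.integrable_rpow p ht' (h.integrable ht')
    have i3 : Integrable (fun x => u t x ^ p) (vol G.inner) := by
      simpa using h.integrable_rpow p ht' (integrable_const (1 : ℝ))
    have i4 : Integrable (fun x => S t x ^ 2 * u t x ^ p - 2 * ρ t * (S t x * u t x ^ p))
        (vol G.inner) := i1.sub (i2.const_mul _)
    have f1 : ∫ x, (S t x - ρ t) ^ 2 * u t x ^ p ∂(vol G.inner)
        = ∫ x, S t x ^ 2 * u t x ^ p ∂(vol G.inner) - 2 * ρ t * ∫ x, S t x * u t x ^ p ∂(vol G.inner)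
          + ρ t ^ 2 * ∫ x, u t x ^ p ∂(vol G.inner) := by
      rw [← integral_const_mul, ← integral_const_mul, ← integral_sub i1 (i2.const_mul _),
        ← integral_add i4 (i3.const_mul _)]
      exact integral_congr_ae (ae_of_all _ fun x => by ring)
    have f2 : ∫ x, S t x * (p * (((n : ℝ) - 2) / 4) * u t x ^ p * (ρ t - S t x)) ∂(vol G.inner)
        = p * (((n : ℝ) - 2) / 4) * (ρ t * ∫ x, S t x * u t x ^ p ∂(vol G.inner)
          - ∫ x, S t x ^ 2 * u t x ^ p ∂(vol G.inner)) := by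
      rw [← integral_const_mul, ← integral_sub (i2.const_mul _) i1, ← integral_const_mul]
      exact integral_congr_ae (ae_of_all _ fun x => by ring)
    have g1 : ∫ x, u t x ^ p * S t x * S t x ∂(vol G.inner)
        = ∫ x, S t x ^ 2 * u t x ^ p ∂(vol G.inner) :=
      integral_congr_ae (ae_of_all _ fun x => by ring)
    have g2 : ∫ x, u t x ^ p * S t x ∂(vol G.inner) = ∫ x, S t x * u t x ^ p ∂(vol G.inner) :=
      integral_congr_ae (ae_of_all _ fun x => by ring)
    have g3 : ∫ x, S' t x * u t x ^ p ∂(vol G.inner) = ∫ x, u t x ^ p * S' t x ∂(vol G.inner) :=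
      integral_congr_ae (ae_of_all _ fun x => by ring)
    have r1 := h.rho_eq_integral ht'
    have v1 := h.volume_eq_one ht'
    rw [← hp] at r1 v1
    have hp4 : p * (((n : ℝ) - 2) / 4) = (n : ℝ) / 2 := by
      rw [hp]; field_simp; ring
    rw [g3, e1, g1, g2, f1, f2, v1, hp4, ← r1]
    ring
  refine antitoneOn_of_deriv_nonpos (convex_Icc 0 T) h.continuousOn_rho ?_ ?_
  · rw [interior_Icc]
    exact fun s hs => (hd s hs).differentiableAt.differentiableWithinAt
  · rw [interior_Icc]
    intro s hs
    rw [(hd s hs).deriv]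
    have : 0 ≤ ∫ x, (S s x - ρ s) ^ 2 * u s x ^ p ∂(vol G.inner) :=
      integral_nonneg fun x => mul_nonneg (sq_nonneg _)
        (Real.rpow_nonneg (h.pos (Ioo_subset_Icc_self hs) x).le _)
    nlinarith

end ConformalFlow

end SobolevIdentities

/-! ### Elementary functions of one variable: excesses, smooth truncations, the cubic inequality. -/

section Truncation

/-- The excess `(-y - c)₊` of the negative part of `y` over `c`. -/
def negExcess (c y : ℝ) : ℝ := max (-y - c) 0

lemma negExcess_nonneg (c y : ℝ) : 0 ≤ negExcess c y := le_max_right _ _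

lemma negExcess_le_abs {c : ℝ} (hc : 0 ≤ c) (y : ℝ) : negExcess c y ≤ |y| :=
  max_le (by linarith [neg_abs_le y]) (abs_nonneg y)

lemma negExcess_anti {c d : ℝ} (h : c ≤ d) (y : ℝ) : negExcess d y ≤ negExcess c y :=
  max_le_max (by linarith) le_rfl

lemma negExcess_eq_zero {c y : ℝ} (h : -y ≤ c) : negExcess c y = 0 := max_eq_right (by linarith)

lemma negExcess_eq {c y : ℝ} (h : c ≤ -y) : negExcess c y = -y - c := max_eq_left (by linarith)

lemma abs_negExcess_sub_le (c x y : ℝ) : |negExcess c x - negExcess c y| ≤ |x - y| := by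
  refine (abs_max_sub_max_le_abs _ _ _).trans (le_of_eq ?_)
  rw [show -x - c - (-y - c) = -(x - y) by ring, abs_neg]

lemma continuous_negExcess (c : ℝ) : Continuous (negExcess c) := by
  unfold negExcess; fun_prop

/-- The squared excess is convex, with second derivative between `0` and `2` away from its kink. The
first order Taylor remainder is thus nonnegative and at most `(y - x)²`. -/
lemma negExcess_sq_sub (c x y : ℝ) :
    0 ≤ negExcess c y ^ 2 - negExcess c x ^ 2 + 2 * negExcess c x * (y - x) ∧
    negExcess c y ^ 2 - negExcess c x ^ 2 + 2 * negExcess c x * (y - x) ≤ (y - x) ^ 2 := by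
  rcases le_total c (-x) with hx | hx <;> rcases le_total c (-y) with hy | hy <;>
  simp only [negExcess_eq, negExcess_eq_zero, hx, hy] <;> constructor <;>
    nlinarith [sq_nonneg (y - x)]

lemma negExcess_sub_mem {c k : ℝ} (hk : 0 ≤ k) (y : ℝ) :
    0 ≤ negExcess c y - negExcess (c + k) y ∧ negExcess c y - negExcess (c + k) y ≤ k := by
  refine ⟨sub_nonneg.2 (negExcess_anti (by linarith) y), ?_⟩
  rw [sub_le_iff_le_add]
  exact max_le (by linarith [show -y - (c + k) ≤ negExcess (c + k) y from le_max_left _ _]) (add_nonneg hk (negExcess_nonneg _ _))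

lemma tendsto_negExcess_atTop (c y : ℝ) :
    ∀ᶠ k : ℕ in atTop, negExcess (c + k) y = 0 := by
  filter_upwards [eventually_ge_atTop ⌈-y - c⌉₊] with k hk
  exact negExcess_eq_zero (by linarith [Nat.ceil_le.1 hk])

open Real in
-- The functions `F m` are primitives of smooth functions `θ m` that lie below the indicator of
-- `(-c-k, -c)` and converge to it pointwise. Convergence of `F m` is enough, because its derivative
-- does not appear in the inequality to which it is applied.
lemma exists_smooth_truncation {c k : ℝ} (hc : 0 ≤ c) (hk : 0 ≤ k) : ∃ F : ℕ → ℝ → ℝ,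
    (∀ m, ContDiff ℝ ∞ (F m) ∧ F m 0 = 0 ∧ ∀ y, |F m y| ≤ k ∧ 0 ≤ deriv (F m) y ∧
      deriv (F m) y ≤ 1) ∧
    ∀ y, Tendsto (fun m => F m y) atTop (𝓝 (-(negExcess c y - negExcess (c + k) y))) := by
  -- The two factors switch on inside the interval next to its endpoints, with transition layers of
  -- width `1/m`.
  set θ : ℕ → ℝ → ℝ := fun m y => smoothTransition (m * (y + (c + k))) * smoothTransition
    (m * (-c - y)) with hθ
  have hθs : ∀ m, ContDiff ℝ ∞ (θ m) := fun m =>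
    (smoothTransition.contDiff.comp (by fun_prop)).mul (smoothTransition.contDiff.comp (by fun_prop))
  have hθ0 : ∀ m y, 0 ≤ θ m y := fun m y =>
    mul_nonneg (smoothTransition.nonneg _) (smoothTransition.nonneg _)
  have hθ1 : ∀ m y, θ m y ≤ 1 := fun m y =>
    mul_le_one₀ (smoothTransition.le_one _) (smoothTransition.nonneg _) (smoothTransition.le_one _)
  set I := Ioo (-c - k) (-c) with hI
  have hθI : ∀ m y, θ m y ≤ I.indicator 1 y := fun m y => by
    by_cases hy : y ∈ I
    · simpa [hy] using hθ1 m y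
    · have : θ m y = 0 := by
        rw [hI, mem_Ioo, not_and_or, not_lt, not_lt] at hy
        rcases hy with hy | hy
        · simp only [hθ]
          rw [smoothTransition.zero_of_nonpos
            (mul_nonpos_of_nonneg_of_nonpos m.cast_nonneg (by linarith)), zero_mul]
        · simp only [hθ]
          rw [smoothTransition.zero_of_nonpos (x := m * (-c - y))
            (mul_nonpos_of_nonneg_of_nonpos m.cast_nonneg (by linarith)), mul_zero]
      rw [this]
      exact indicator_nonneg (fun _ _ => zero_le_one) _
  have hθl : ∀ y, Tendsto (fun m => θ m y) atTop (𝓝 (I.indicator 1 y)) := fun y => by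
    by_cases hy : y ∈ I
    · refine tendsto_const_nhds.congr' ?_
      have hev : ∀ a : ℝ, 0 < a → ∀ᶠ m : ℕ in atTop, 1 ≤ m * a := fun a ha =>
        (tendsto_natCast_atTop_atTop.atTop_mul_const ha).eventually_ge_atTop 1
      filter_upwards [hev (y + (c + k)) (by linarith [hy.1]), hev (-c - y) (by linarith [hy.2])]
        with m h1 h2
      simp [hθ, hy, smoothTransition.one_of_one_le h1, smoothTransition.one_of_one_le h2]
    · refine tendsto_const_nhds.congr fun m => ?_
      refine le_antisymm ?_ (hθI m y)
      simpa [hy] using hθ0 m y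
  have hder : ∀ m y, HasDerivAt (fun y => ∫ r in (0 : ℝ)..y, θ m r) (θ m y) y := fun m y =>
    intervalIntegral.integral_hasDerivAt_right ((hθs m).continuous.intervalIntegrable _ _)
      ((hθs m).continuous.stronglyMeasurableAtFilter _ _) (hθs m).continuous.continuousAt
  have hderiv : ∀ m, deriv (fun y => ∫ r in (0 : ℝ)..y, θ m r) = θ m := fun m =>
    funext fun y => (hder m y).deriv
  have hIi : Integrable (I.indicator (1 : ℝ → ℝ)) :=
    (integrable_indicator_iff measurableSet_Ioo).2 (integrableOn_const (by simp))
  refine ⟨fun m y => ∫ r in (0 : ℝ)..y, θ m r, fun m => ⟨?_, by simp, fun y => ⟨?_, ?_, ?_⟩⟩,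
    fun y => ?_⟩
  · rw [contDiff_infty_iff_deriv, hderiv]
    exact ⟨fun y => (hder m y).differentiableAt, hθs m⟩
  · calc |∫ r in (0 : ℝ)..y, θ m r| ≤ ∫ r in uIoc 0 y, |θ m r| :=
          intervalIntegral.norm_integral_le_integral_norm_uIoc (f := θ m)
      _ ≤ ∫ r in uIoc 0 y, I.indicator 1 r := by
          refine integral_mono ?_ hIi.integrableOn fun r => ?_
          · exact (((hθs m).continuous.abs).intervalIntegrable _ _).def'
          · simp only [abs_of_nonneg (hθ0 m r), hθI]
      _ ≤ ∫ r, I.indicator 1 r := setIntegral_le_integral hIi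
          (ae_of_all _ fun r => indicator_nonneg (fun _ _ => zero_le_one) _)
      _ = k := by
          rw [integral_indicator_one measurableSet_Ioo]
          simp [hk]
  · rw [hderiv]; exact hθ0 m y
  · rw [hderiv]; exact hθ1 m y
  · have h1 : Tendsto (fun m => ∫ r in (0 : ℝ)..y, θ m r) atTop
        (𝓝 (∫ r in (0 : ℝ)..y, I.indicator 1 r)) :=
      intervalIntegral.tendsto_integral_filter_of_dominated_convergence (fun _ => 1)
        (Eventually.of_forall fun m => (hθs m).continuous.aestronglyMeasurable)
        (Eventually.of_forall fun m => ae_of_all _ fun r _ => by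
          rw [Real.norm_eq_abs, abs_of_nonneg (hθ0 m r)]; exact hθ1 m r)
        intervalIntegrable_const (ae_of_all _ fun r _ => hθl r)
    convert h1 using 2
    rcases le_total 0 y with hy | hy
    · rw [intervalIntegral.integral_of_le hy, setIntegral_eq_zero_of_forall_eq_zero,
        negExcess_eq_zero, negExcess_eq_zero] <;> try linarith
      intro r hr
      exact indicator_of_notMem (fun h => by linarith [h.2, hr.1]) _
    · rw [intervalIntegral.integral_of_ge hy, setIntegral_indicator measurableSet_Ioo]
      have e : Ioc y 0 ∩ I = Ioo (max y (-c - k)) (-c) := by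
        ext r
        simp only [hI, mem_inter_iff, mem_Ioc, mem_Ioo, max_lt_iff]
        constructor
        · rintro ⟨⟨a, b⟩, d, e⟩; exact ⟨⟨a, d⟩, e⟩
        · rintro ⟨⟨a, b⟩, d⟩; exact ⟨⟨a, by linarith⟩, b, d⟩
      rw [e]
      simp only [Pi.one_apply, integral_const, MeasurableSet.univ, measureReal_restrict_apply,
        univ_inter, smul_eq_mul, mul_one, Real.volume_real_Ioo, negExcess]
      grind

/-- The algebraic inequality behind the evolution of the truncated negative part. -/
lemma truncation_inequality {n ρ s j : ℝ} (hn : 3 ≤ n) (hρ : 0 ≤ ρ) (hs : 0 ≤ s) (hj : 0 ≤ j)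
    (y : ℝ) {a b e : ℝ} (ha : a = negExcess s y - negExcess (s + 2 * j) y)
    (hb : b = negExcess s y ^ 2 - negExcess (s + 2 * j) y ^ 2) (he : e = negExcess (s + j) y) :
    2 * (-(a * y * y) + ρ * (a * y) + (n - 2) / 4 * (a ^ 2 * y)) + n / 2 * (b * (ρ - y))
      ≤ n / 2 * ρ * b + n * (e * y * y) := by
  subst ha hb he
  rcases le_total (-y) s with h | h
  · rw [negExcess_eq_zero h, negExcess_eq_zero (by linarith), negExcess_eq_zero (by linarith)]
    simp
  rcases le_total (-y) (s + 2 * j) with h2 | h2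
  · rw [negExcess_eq h, negExcess_eq_zero h2]
    have h0 := negExcess_nonneg (s + j) y
    have h3 : 0 ≤ n * (negExcess (s + j) y * y * y) := by
      rw [mul_assoc]
      exact mul_nonneg (by linarith) (mul_nonneg h0 (mul_self_nonneg y))
    generalize negExcess (s + j) y = e at *
    obtain ⟨z, rfl⟩ : ∃ z, y = -(z + s) := ⟨-y - s, by ring⟩
    have hz0 : 0 ≤ z := by linarith
    -- Below the cutoff `a = z` and `b = z²`, and the terms with `n` cancel. What remains is `-z
    -- (z+s) (z+2s) - 2ρ z (z+s)`, which is nonpositive, so the error term is not needed here.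
    have : 0 ≤ z * (z + s) * (z + 2 * s) := by positivity
    have : 0 ≤ ρ * (z * (z + s)) := by positivity
    nlinarith
  · rw [negExcess_eq h, negExcess_eq h2, negExcess_eq (by linarith)]
    obtain ⟨w, hw⟩ : ∃ w, -y - (s + 2 * j) = w := ⟨_, rfl⟩
    have hw0 : 0 ≤ w := by linarith
    have hy : y = -(w + s + 2 * j) := by linarith
    subst hy
    -- Above the cutoff `a = 2j` is constant while `b` still grows, so the volume term is no longer
    -- compensated. Here `e = w + j`, and the term with `n` that is left over is `n |y| (w + j) (w +
    -- s)`, the last of these products.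
    have : 0 ≤ ρ * (j * (w + s + 2 * j)) := by positivity
    have : 0 ≤ j * (w + s + 2 * j) * (w + s + 2 * j) := by positivity
    have : 0 ≤ (n - 2) * (j ^ 2 * (w + s + 2 * j)) := mul_nonneg (by linarith) (by positivity)
    have : 0 ≤ n * ((w + s + 2 * j) * (w * s + s * j + w ^ 2 + w * j)) :=
      mul_nonneg (by linarith) (by positivity)
    nlinarith

end Truncation

/-! ### The evolution inequality for truncated excesses, and the integrability it implies. -/

section NegativePart

variable {n : ℕ} {M : Type*} [TopologicalSpace M] [T2Space M] [ChartedSpace (Eucl n) M]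
  [IsManifold (𝓡 n) ∞ M] [MeasurableSpace M] [BorelSpace M] [SecondCountableTopology M]
  {G : Bundle.ContMDiffRiemannianMetric (𝓡 n) ∞ (Eucl n) (fun x : M => TangentSpace (𝓡 n) x)}

namespace ConformalFlow

variable {T : ℝ} {u S S' : ℝ → M → ℝ} {X : ℝ → ∀ x : M, TangentSpace (𝓡 n) x} {S₀ : M → ℝ}
  {ρ : ℝ → ℝ} {t : ℝ}

lemma integrable_rpow_mul (h : ConformalFlow G T u S S' X S₀ ρ) (ht : t ∈ Icc 0 T) {a f g : M → ℝ}
    {k : ℝ} (ha : AEStronglyMeasurable a (vol G.inner)) (hk : ∀ x, |a x| ≤ k)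
    (hf : MemLp f 2 (vol G.inner)) (hg : MemLp g 2 (vol G.inner)) :
    Integrable (fun x => u t x ^ (2 * (n : ℝ) / ((n : ℝ) - 2)) * a x * f x * g x)
      (vol G.inner) := by
  obtain ⟨C, hC, hb⟩ := h.ae_bound_rpow (2 * (n : ℝ) / ((n : ℝ) - 2))
  refine integrable_mul_mul (K := C * k)
    ((h.continuous_rpow _ ht).aestronglyMeasurable.mul ha) (ae_of_all _ fun x => ?_) hf hg
  rw [abs_mul]
  exact mul_le_mul (hb t ht x) (hk x) (abs_nonneg _) hC.le

/-- The truncated excess is only Lipschitz. The basic inequality is applied to the smooth `F m`,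
which tend to `-a` and are bounded by `k`, and all its integrals pass to the limit. The sign of `a`
accounts for the signs here. -/
lemma integral_deriv_truncation_le (h : ConformalFlow G T u S S' X S₀ ρ) (ht : t ∈ Ioo 0 T)
    {c k : ℝ} (hc : 0 ≤ c) (hk : 0 ≤ k) {a : M → ℝ}
    (ha : a = fun x => negExcess c (S t x) - negExcess (c + k) (S t x)) :
    - ∫ x, u t x ^ (2 * (n : ℝ) / ((n : ℝ) - 2)) * a x * S' t x ∂(vol G.inner)
      ≤ - ∫ x, u t x ^ (2 * (n : ℝ) / ((n : ℝ) - 2)) * a x * S t x * S t x ∂(vol G.inner)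
        + ρ t * ∫ x, u t x ^ (2 * (n : ℝ) / ((n : ℝ) - 2)) * a x * S t x ∂(vol G.inner)
        + ((n : ℝ) - 2) / 4 * ∫ x, u t x ^ (2 * (n : ℝ) / ((n : ℝ) - 2)) * a x ^ 2 * S t x
          ∂(vol G.inner) := by
  have := h.isProbabilityMeasure
  have ht' := Ioo_subset_Icc_self ht
  obtain ⟨F, hF, hFl⟩ := exists_smooth_truncation hc hk
  obtain ⟨C, hC0, hC⟩ := h.ae_bound_rpow (2 * (n : ℝ) / ((n : ℝ) - 2))
  have hP := (h.continuous_rpow (2 * (n : ℝ) / ((n : ℝ) - 2)) ht').aestronglyMeasurable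
    (μ := vol G.inner)
  have ham : AEStronglyMeasurable a (vol G.inner) := by
    rw [ha]
    exact ((continuous_negExcess c).comp_aestronglyMeasurable (h.memLp t ht').1).sub
      ((continuous_negExcess _).comp_aestronglyMeasurable (h.memLp t ht').1)
  have hFa : ∀ x, Tendsto (fun m => F m (S t x)) atTop (𝓝 (- a x)) := fun x => by
    rw [ha]; exact hFl _
  have hak : ∀ x, |-a x| ≤ k := fun x =>
    le_of_tendsto (hFa x).abs (Eventually.of_forall fun m => ((hF m).2.2 _).1)
  have lim : ∀ {Φ : ℝ → ℝ} (D : ℝ) {f g : M → ℝ}, Continuous Φ → (∀ y, |y| ≤ k → |Φ y| ≤ D) →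
      MemLp f 2 (vol G.inner) → MemLp g 2 (vol G.inner) →
      Tendsto (fun m => ∫ x, u t x ^ (2 * (n : ℝ) / ((n : ℝ) - 2)) * Φ (F m (S t x)) * f x * g x
        ∂(vol G.inner)) atTop
        (𝓝 (∫ x, u t x ^ (2 * (n : ℝ) / ((n : ℝ) - 2)) * Φ (- a x) * f x * g x
          ∂(vol G.inner))) := by
    intro Φ D f g hΦ hD hf hg
    have hb : ∀ x y, |y| ≤ k → |u t x ^ (2 * (n : ℝ) / ((n : ℝ) - 2)) * Φ y| ≤ C * D :=
      fun x y hy => by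
        rw [abs_mul]
        exact mul_le_mul (hC t ht' x) (hD y hy) (abs_nonneg _) hC0.le
    refine tendsto_integral_mul_mul (K := C * D) (Eventually.of_forall fun m => ?_) ?_
      (Eventually.of_forall fun m => ae_of_all _ fun x => hb x _ ((hF m).2.2 _).1)
      (ae_of_all _ fun x => hb x _ (hak x)) (ae_of_all _ fun x => ?_)
      (Eventually.of_forall fun _ => hf.1) hf (by simp)
      (Eventually.of_forall fun _ => hg.1) hg (by simp)
    · exact hP.mul ((hΦ.comp (hF m).1.continuous).comp_aestronglyMeasurable (h.memLp t ht').1)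
    · exact hP.mul (hΦ.comp_aestronglyMeasurable ham.neg)
    · exact ((hΦ.tendsto _).comp (hFa x)).const_mul _
  have hS := h.memLp t ht'
  have h1 : MemLp (fun _ : M => (1 : ℝ)) 2 (vol G.inner) := memLp_const 1
  have l0 := lim (Φ := id) k continuous_id (fun _ h => h) (h.memLp' t ht) h1
  have l1 := lim (Φ := id) k continuous_id (fun _ h => h) hS hS
  have l2 := lim (Φ := id) k continuous_id (fun _ h => h) hS h1
  have l3 := lim (Φ := fun y => y ^ 2) (k ^ 2) (continuous_pow 2)
    (fun y hy => by rw [abs_pow]; exact pow_le_pow_left₀ (abs_nonneg _) hy 2) hS h1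
  simp only [mul_one, id] at l0 l1 l2 l3
  have := le_of_tendsto_of_tendsto' l0 ((l1.sub (l2.const_mul (ρ t))).add
    (l3.const_mul (((n : ℝ) - 2) / 4))) fun m => h.integral_deriv_comp_le ht (hF m).1 (hF m).2.1
      (fun y => ((hF m).2.2 y).1) (fun y => ((hF m).2.2 y).2.1) (fun y => ((hF m).2.2 y).2.2)
  simp only [mul_neg, neg_mul, integral_neg, neg_sq, sub_neg_eq_add] at this
  exact this

lemma memLp_negExcess (h : ConformalFlow G T u S S' X S₀ ρ) (ht : t ∈ Icc 0 T) {c : ℝ}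
    (hc : 0 ≤ c) : MemLp (fun x => negExcess c (S t x)) 2 (vol G.inner) :=
  (h.memLp t ht).mono ((continuous_negExcess c).comp_aestronglyMeasurable (h.memLp t ht).1)
    (ae_of_all _ fun x => by
      rw [Real.norm_eq_abs, abs_of_nonneg (negExcess_nonneg _ _)]
      exact negExcess_le_abs hc _)

/-- A priori `S` is only in `L²`, so this cubic integral could be infinite. In the inequality for
the truncated excess the terms with `ρ` and with `a² S` are nonpositive, since `a ≠ 0` forces `S ≤
0`. This leaves `∫ V a S² ≤ ∫ V a S'`, bounded independently of the height of truncation, and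
monotone convergence removes the truncation. -/
lemma integrable_negExcess_mul_sq (h : ConformalFlow G T u S S' X S₀ ρ) (ht : t ∈ Ioo 0 T)
    {c : ℝ} (hc : 0 ≤ c) :
    Integrable (fun x => u t x ^ (2 * (n : ℝ) / ((n : ℝ) - 2)) * negExcess c (S t x)
      * S t x * S t x) (vol G.inner) ∧
    ∫ x, u t x ^ (2 * (n : ℝ) / ((n : ℝ) - 2)) * negExcess c (S t x) * S t x * S t x ∂(vol G.inner)
      ≤ ∫ x, u t x ^ (2 * (n : ℝ) / ((n : ℝ) - 2)) * negExcess c (S t x) * |S' t x|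
        ∂(vol G.inner) := by
  have := h.isProbabilityMeasure
  have ht' := Ioo_subset_Icc_self ht
  set V := fun x => u t x ^ (2 * (n : ℝ) / ((n : ℝ) - 2)) with hV
  have hV0 : ∀ x, 0 ≤ V x := fun x => Real.rpow_nonneg (h.pos ht' x).le _
  have hS := h.memLp t ht'
  have hS' := h.memLp' t ht
  have h1 : MemLp (fun _ : M => (1 : ℝ)) 2 (vol G.inner) := memLp_const 1
  set I := ∫ x, V x * negExcess c (S t x) * |S' t x| ∂(vol G.inner) with hI
  have hIi : Integrable (fun x => V x * negExcess c (S t x) * |S' t x|) (vol G.inner) := by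
    have := h.integrable_rpow_mul (a := fun _ => 1) (k := 1) ht' aestronglyMeasurable_const
      (by simp) (h.memLp_negExcess ht' hc) hS'.abs
    simpa using this
  set a : ℕ → M → ℝ := fun k x => negExcess c (S t x) - negExcess (c + k) (S t x) with ha
  have ham : ∀ k, AEStronglyMeasurable (a k) (vol G.inner) := fun k =>
    ((continuous_negExcess c).comp_aestronglyMeasurable hS.1).sub
      ((continuous_negExcess _).comp_aestronglyMeasurable hS.1)
  have ha0 : ∀ k x, 0 ≤ a k x := fun k x => (negExcess_sub_mem k.cast_nonneg _).1
  have hak : ∀ k x, |a k x| ≤ k := fun k x => by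
    rw [abs_of_nonneg (ha0 k x)]; exact (negExcess_sub_mem k.cast_nonneg _).2
  have hle : ∀ k, ∫ x, V x * a k x * S t x * S t x ∂(vol G.inner) ≤ I := by
    intro k
    have e := h.integral_deriv_truncation_le ht hc k.cast_nonneg (a := a k) rfl
    have hneg : ∀ x, a k x ≠ 0 → S t x ≤ 0 := fun x hx => by
      by_contra! hlt
      refine hx ?_
      simp only [ha]
      rw [negExcess_eq_zero (by linarith), negExcess_eq_zero
        (by linarith [(k.cast_nonneg : (0 : ℝ) ≤ k)]), sub_zero]
    have e1 : ∫ x, V x * a k x * S t x ∂(vol G.inner) ≤ 0 := by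
      refine integral_nonpos fun x => ?_
      by_cases hx : a k x = 0
      · simp [hx]
      · exact mul_nonpos_of_nonneg_of_nonpos (mul_nonneg (hV0 x) (ha0 k x)) (hneg x hx)
    have e2 : ∫ x, V x * a k x ^ 2 * S t x ∂(vol G.inner) ≤ 0 := by
      refine integral_nonpos fun x => ?_
      by_cases hx : a k x = 0
      · simp [hx]
      · exact mul_nonpos_of_nonneg_of_nonpos (mul_nonneg (hV0 x) (sq_nonneg _)) (hneg x hx)
    have e3 : ∫ x, V x * a k x * S' t x ∂(vol G.inner) ≤ I := by
      have i1 := h.integrable_rpow_mul ht' (ham k) (hak k) hS' h1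
      simp only [mul_one] at i1
      refine integral_mono i1 hIi fun x => ?_
      exact (mul_le_mul_of_nonneg_left (le_abs_self _) (mul_nonneg (hV0 x) (ha0 k x))).trans
        (mul_le_mul_of_nonneg_right (mul_le_mul_of_nonneg_left
          (sub_le_self _ (negExcess_nonneg _ _)) (hV0 x)) (abs_nonneg _))
    have e4 : ρ t * ∫ x, V x * a k x * S t x ∂(vol G.inner) ≤ 0 :=
      mul_nonpos_of_nonneg_of_nonpos (h.rho_nonneg ht') e1
    have e5 : ((n : ℝ) - 2) / 4 * ∫ x, V x * a k x ^ 2 * S t x ∂(vol G.inner) ≤ 0 :=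
      mul_nonpos_of_nonneg_of_nonpos (by have := h.two_lt; positivity) e2
    linarith
  have hI0 : 0 ≤ I := integral_nonneg fun x =>
    mul_nonneg (mul_nonneg (hV0 x) (negExcess_nonneg _ _)) (abs_nonneg _)
  have hVm : AEStronglyMeasurable V (vol G.inner) :=
    (h.continuous_rpow _ ht').aestronglyMeasurable
  have hf0 : ∀ {r : ℝ} x, 0 ≤ r → 0 ≤ V x * r * S t x * S t x := fun x hr => by
    rw [mul_assoc]
    exact mul_nonneg (mul_nonneg (hV0 x) hr) (mul_self_nonneg _)
  have hlim := lintegral_tendsto_of_tendsto_of_monotone (μ := vol G.inner)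
    (f := fun k x => ENNReal.ofReal (V x * a k x * S t x * S t x))
    (F := fun x => ENNReal.ofReal (V x * negExcess c (S t x) * S t x * S t x))
    (fun k => (((hVm.mul (ham k)).mul hS.1).mul hS.1).aemeasurable.ennreal_ofReal)
    (ae_of_all _ fun x k l hkl => ENNReal.ofReal_le_ofReal (by
      simp only [mul_assoc]
      refine mul_le_mul_of_nonneg_left (mul_le_mul_of_nonneg_right ?_ (mul_self_nonneg _)) (hV0 x)
      have : (k : ℝ) ≤ l := by exact_mod_cast hkl
      exact sub_le_sub_left (negExcess_anti (by linarith) _) _))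
    (ae_of_all _ fun x => tendsto_const_nhds.congr' (by
      filter_upwards [tendsto_negExcess_atTop c (S t x)] with k hk
      simp [ha, hk]))
  have hbd := le_of_tendsto' hlim (b := ENNReal.ofReal I) fun k => by
    rw [← ofReal_integral_eq_lintegral_ofReal (h.integrable_rpow_mul ht' (ham k) (hak k) hS hS)
      (ae_of_all _ fun x => hf0 x (ha0 k x))]
    exact ENNReal.ofReal_le_ofReal (hle k)
  have hm : AEStronglyMeasurable (fun x => V x * negExcess c (S t x) * S t x * S t x)
      (vol G.inner) := ((hVm.mul (h.memLp_negExcess ht' hc).1).mul hS.1).mul hS.1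
  have h0 : 0 ≤ᵐ[vol G.inner] fun x => V x * negExcess c (S t x) * S t x * S t x :=
    ae_of_all _ fun x => hf0 x (negExcess_nonneg _ _)
  refine ⟨⟨hm, ?_⟩, ?_⟩
  · rw [hasFiniteIntegral_iff_ofReal h0]
    exact hbd.trans_lt ENNReal.ofReal_lt_top
  · rw [integral_eq_lintegral_of_nonneg_ae h0 hm]
    exact ENNReal.toReal_le_of_le_ofReal hI0 hbd

end ConformalFlow

end NegativePart

/-! ### The differential inequality for the truncated energy. -/

section NegativePartEvolution

variable {n : ℕ} {M : Type*} [TopologicalSpace M] [T2Space M] [ChartedSpace (Eucl n) M]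
  [IsManifold (𝓡 n) ∞ M] [MeasurableSpace M] [BorelSpace M] [SecondCountableTopology M]
  {G : Bundle.ContMDiffRiemannianMetric (𝓡 n) ∞ (Eucl n) (fun x : M => TangentSpace (𝓡 n) x)}

lemma integral_combination_le {α : Type*} {m0 : MeasurableSpace α} {μ : Measure α}
    {f₁ f₂ f₃ f₄ f₅ f₆ : α → ℝ} {r c m q k : ℝ} (i₁ : Integrable f₁ μ) (i₂ : Integrable f₂ μ)
    (i₃ : Integrable f₃ μ) (i₄ : Integrable f₄ μ) (i₅ : Integrable f₅ μ) (i₆ : Integrable f₆ μ)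
    (h : ∀ x, 2 * (-f₁ x + r * f₂ x + c * f₃ x) + m * f₄ x ≤ q * f₅ x + k * f₆ x) :
    2 * (-(∫ x, f₁ x ∂μ) + r * ∫ x, f₂ x ∂μ + c * ∫ x, f₃ x ∂μ) + m * ∫ x, f₄ x ∂μ
      ≤ q * ∫ x, f₅ x ∂μ + k * ∫ x, f₆ x ∂μ := by
  have j₁ : Integrable (fun x => -f₁ x + r * f₂ x) μ := i₁.neg.add (i₂.const_mul _)
  have j₂ : Integrable (fun x => -f₁ x + r * f₂ x + c * f₃ x) μ := j₁.add (i₃.const_mul _)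
  have key := integral_mono ((j₂.const_mul 2).add (i₄.const_mul m))
    ((i₅.const_mul q).add (i₆.const_mul k)) h
  rw [integral_add' (j₂.const_mul 2) (i₄.const_mul m), integral_const_mul,
    integral_add j₁ (i₃.const_mul _), integral_add i₁.fun_neg (i₂.const_mul _), integral_neg,
    integral_add' (i₅.const_mul q) (i₆.const_mul k)] at key
  simpa only [integral_const_mul] using key

namespace ConformalFlow

variable {T : ℝ} {u S S' : ℝ → M → ℝ} {X : ℝ → ∀ x : M, TangentSpace (𝓡 n) x} {S₀ : M → ℝ}
  {ρ : ℝ → ℝ} {t : ℝ}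

lemma tendsto_integral_sq_rpow (h : ConformalFlow G T u S S' X S₀ ρ) (q : ℝ) (ht : t ∈ Icc 0 T)
    {l : Filter ℝ} [l.IsCountablyGenerated] (hl : l ≤ 𝓝[Icc 0 T] t) {f : ℝ → M → ℝ}
    (hf : ∀ᶠ s in l, AEStronglyMeasurable (f s) (vol G.inner)) (hft : MemLp (f t) 2 (vol G.inner))
    (hfc : Tendsto (fun s => eLpNorm (fun x => f s x - f t x) 2 (vol G.inner)) l (𝓝 0)) :
    Tendsto (fun s => ∫ x, f s x ^ 2 * u s x ^ q ∂(vol G.inner)) l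
      (𝓝 (∫ x, f t x ^ 2 * u t x ^ q ∂(vol G.inner))) := by
  obtain ⟨K, -, hK⟩ := h.ae_bound_rpow q
  have hI : ∀ᶠ s in l, s ∈ Icc 0 T := hl self_mem_nhdsWithin
  have := tendsto_integral_mul_mul (K := K) (l := l) (μ := vol G.inner)
    (a := fun s x => u s x ^ q) (a₀ := fun x => u t x ^ q)
    (by filter_upwards [hI] with s hs using (h.continuous_rpow q hs).aestronglyMeasurable)
    (h.continuous_rpow q ht).aestronglyMeasurable
    (by filter_upwards [hI] with s hs using ae_of_all _ (hK s hs))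
    (ae_of_all _ (hK t ht)) (ae_of_all _ fun x => (h.tendsto_rpow q ht x).mono_left hl)
    hf hft hfc hf hft hfc
  have e : ∀ s x, u s x ^ q * f s x * f s x = f s x ^ 2 * u s x ^ q := fun s x => by ring
  simpa only [e] using this

lemma continuousOn_integral_negExcess_sq (h : ConformalFlow G T u S S' X S₀ ρ) (q : ℝ) {c : ℝ}
    (hc : 0 ≤ c) :
    ContinuousOn (fun t => ∫ x, negExcess c (S t x) ^ 2 * u t x ^ q ∂(vol G.inner)) (Icc 0 T) :=
  fun t ht => by
    refine h.tendsto_integral_sq_rpow q (f := fun t x => negExcess c (S t x)) ht le_rfl ?_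
      (h.memLp_negExcess ht hc) ?_
    · filter_upwards [self_mem_nhdsWithin] with s hs using (h.memLp_negExcess hs hc).1
    · refine tendsto_of_tendsto_of_tendsto_of_le_of_le tendsto_const_nhds (h.contS t ht)
        (fun _ => zero_le) fun s => eLpNorm_mono fun x => ?_
      exact abs_negExcess_sub_le _ _ _

lemma integrable_negExcess_sq (h : ConformalFlow G T u S S' X S₀ ρ) (q : ℝ) (ht : t ∈ Icc 0 T)
    {c : ℝ} (hc : 0 ≤ c) :
    Integrable (fun x => negExcess c (S t x) ^ 2 * u t x ^ q) (vol G.inner) :=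
  h.integrable_rpow q ht (h.memLp_negExcess ht hc).integrable_sq

/-- Dini's theorem: the integrals are continuous in time, decrease as the level rises, and tend to
zero at each time, so they do so uniformly on `[0, T]`. -/
lemma exists_integral_negExcess_sq_le (h : ConformalFlow G T u S S' X S₀ ρ) (q : ℝ) {s ε : ℝ}
    (hs : 0 ≤ s) (hε : 0 < ε) :
    ∃ j : ℕ, ∀ t ∈ Icc 0 T, ∀ c, s + j ≤ c →
      ∫ x, negExcess c (S t x) ^ 2 * u t x ^ q ∂(vol G.inner) ≤ ε := by
  have hmono : ∀ t ∈ Icc 0 T, ∀ c d, 0 ≤ c → c ≤ d →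
      ∫ x, negExcess d (S t x) ^ 2 * u t x ^ q ∂(vol G.inner)
        ≤ ∫ x, negExcess c (S t x) ^ 2 * u t x ^ q ∂(vol G.inner) := fun t ht c d hc hcd =>
    integral_mono (h.integrable_negExcess_sq q ht (hc.trans hcd)) (h.integrable_negExcess_sq q ht hc)
      fun x => mul_le_mul_of_nonneg_right
        (pow_le_pow_left₀ (negExcess_nonneg _ _) (negExcess_anti hcd _) 2)
        (Real.rpow_nonneg (h.pos ht x).le _)
  have hp : ∀ j : ℕ, 0 ≤ s + j := fun j => by positivity
  have := Antitone.tendstoUniformlyOn_of_forall_tendsto (s := Icc 0 T) (f := fun _ => (0 : ℝ))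
    (F := fun (j : ℕ) t => ∫ x, negExcess (s + j) (S t x) ^ 2 * u t x ^ q ∂(vol G.inner))
    isCompact_Icc (fun j => h.continuousOn_integral_negExcess_sq q (hp j))
    (fun t ht j k hjk => hmono t ht _ _ (hp j) (by gcongr)) continuousOn_const
    fun t ht => by
      have := tendsto_integral_of_dominated_convergence (μ := vol G.inner)
        (F := fun (j : ℕ) x => negExcess (s + j) (S t x) ^ 2 * u t x ^ q) (f := fun _ => (0 : ℝ))
        (fun x => negExcess s (S t x) ^ 2 * u t x ^ q)
        (fun j => (h.integrable_negExcess_sq q ht (hp j)).1) (h.integrable_negExcess_sq q ht hs)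
        (fun j => ae_of_all _ fun x => ?_) (ae_of_all _ fun x => ?_)
      · simpa using this
      · rw [Real.norm_eq_abs, abs_of_nonneg
          (mul_nonneg (sq_nonneg _) (Real.rpow_nonneg (h.pos ht x).le _))]
        exact mul_le_mul_of_nonneg_right
          (pow_le_pow_left₀ (negExcess_nonneg _ _) (negExcess_anti (by simp) _) 2)
          (Real.rpow_nonneg (h.pos ht x).le _)
      · refine tendsto_const_nhds.congr' ?_
        filter_upwards [tendsto_negExcess_atTop s (S t x)] with j hj
        simp [hj]
  rw [Metric.tendstoUniformlyOn_iff] at this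
  obtain ⟨j, hj⟩ := (this ε hε).exists
  refine ⟨j, fun t ht c hc => (hmono t ht _ _ (hp j) hc).trans ?_⟩
  have := hj t ht
  rw [Real.dist_eq, zero_sub, abs_neg] at this
  exact (le_abs_self _).trans this.le

/-- The energy density is `2 min((S₋ - s)₊, 2j)` integrated with respect to `S₋`. Its derivative
involves only bounded truncations, so the evolution inequality applies. The price is an error
supported where `S₋` exceeds `s + j`, estimated through `S'`. -/
lemma exists_hasDerivAt_le (h : ConformalFlow G T u S S' X S₀ ρ) {s j : ℝ}
    (hs : 0 ≤ s) (hj : 0 ≤ j) {f : ℝ → ℝ}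
    (hf : f = fun t => ∫ x, (negExcess s (S t x) ^ 2 - negExcess (s + 2 * j) (S t x) ^ 2)
        * u t x ^ (2 * (n : ℝ) / ((n : ℝ) - 2)) ∂(vol G.inner)) (ht : t ∈ Ioo 0 T) :
    ∃ D, HasDerivAt f D t ∧ D ≤ n / 2 * ρ 0 * f t + n * ∫ x,
      u t x ^ (2 * (n : ℝ) / ((n : ℝ) - 2)) * negExcess (s + j) (S t x) * |S' t x|
        ∂(vol G.inner) := by
  have := h.isProbabilityMeasure
  have ht' := Ioo_subset_Icc_self ht
  have hn2 := h.two_lt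
  have hn3 : (3 : ℝ) ≤ n := by exact_mod_cast h.dim
  have h2j : 0 ≤ 2 * j := by positivity
  set a := fun y => negExcess s y - negExcess (s + 2 * j) y with ha
  set b := fun y => negExcess s y ^ 2 - negExcess (s + 2 * j) y ^ 2 with hb
  have hab : ∀ y, b y = a y * (negExcess s y + negExcess (s + 2 * j) y) := fun y => by
    simp only [ha, hb]; ring
  have ha0 : ∀ y, 0 ≤ a y := fun y => (negExcess_sub_mem h2j y).1
  have hak : ∀ y, |a y| ≤ 2 * j := fun y => by
    rw [abs_of_nonneg (ha0 y)]; exact (negExcess_sub_mem h2j y).2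
  have ha2 : ∀ x : M, |a (S t x) ^ 2| ≤ (2 * j) ^ 2 := fun x => by
    rw [abs_pow]
    exact pow_le_pow_left₀ (abs_nonneg (a (S t x))) (hak (S t x)) 2
  have hac : Continuous a := (continuous_negExcess _).sub (continuous_negExcess _)
  -- The separate squares are not known to be in `L²`. Their difference is a bounded function times
  -- a sum of two `L²` functions.
  have hbS : ∀ t ∈ Icc 0 T, MemLp (fun x => b (S t x)) 2 (vol G.inner) := fun t ht => by
    refine (((h.memLp_negExcess ht hs).add (h.memLp_negExcess ht
      (add_nonneg hs h2j))).const_mul (2 * j)).mono ?_ (ae_of_all _ fun x => ?_)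
    · exact (((continuous_negExcess _).pow 2).sub
        ((continuous_negExcess _).pow 2)).comp_aestronglyMeasurable (h.memLp t ht).1
    · rw [hab, norm_mul, norm_mul]
      refine mul_le_mul_of_nonneg_right ?_ (norm_nonneg _)
      exact (hak _).trans (le_abs_self _)
  set p := 2 * (n : ℝ) / ((n : ℝ) - 2) with hp
  have hp4 : p * (((n : ℝ) - 2) / 4) = (n : ℝ) / 2 := by
    rw [hp]; field_simp; ring
  have hd := h.hasDerivAt_integral_comp (B := b) (B' := fun y => -2 * a y) (K' := 2 * (2 * j))
    (L := 1) (η := fun _ => 1) (K := 1) p continuous_const (by simp)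
    (hac.measurable.const_mul _)
    (fun y => by rw [abs_mul, abs_neg, abs_two]; exact mul_le_mul_of_nonneg_left (hak y) zero_le_two)
    (fun x y => by
      have h1 := negExcess_sq_sub s x y
      have h2 := negExcess_sq_sub (s + 2 * j) x y
      simp only [ha, hb]
      rw [_root_.abs_le]
      constructor <;> linarith [h1.1, h1.2, h2.1, h2.2])
    (fun t ht => hbS t (Ioo_subset_Icc_self ht)) ht
  have hf' : f = fun t => ∫ x, b (S t x) * u t x ^ p ∂(vol G.inner) := hf
  clear_value a b
  simp only [one_mul] at hd
  rw [show (fun t => ∫ x, b (S t x) * u t x ^ p ∂(vol G.inner)) = f from hf'.symm] at hd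
  refine ⟨_, hd, ?_⟩
  have hS := h.memLp t ht'
  have h1 : MemLp (fun _ : M => (1 : ℝ)) 2 (vol G.inner) := memLp_const 1
  have ham : AEStronglyMeasurable (fun x => a (S t x)) (vol G.inner) :=
    hac.comp_aestronglyMeasurable hS.1
  have hsj : 0 ≤ s + j := add_nonneg hs hj
  obtain ⟨i6, hE⟩ := h.integrable_negExcess_mul_sq ht hsj
  have i1 : Integrable (fun x => u t x ^ p * a (S t x) * S t x * S t x) (vol G.inner) :=
    h.integrable_rpow_mul (a := fun x => a (S t x)) ht' ham (fun x => hak (S t x)) hS hS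
  have i2 : Integrable (fun x => u t x ^ p * a (S t x) * S t x) (vol G.inner) := by
    simpa using h.integrable_rpow_mul (a := fun x => a (S t x)) ht' ham (fun x => hak (S t x)) hS h1
  have i3 : Integrable (fun x => u t x ^ p * a (S t x) ^ 2 * S t x) (vol G.inner) := by
    have m : AEStronglyMeasurable (fun x => a (S t x) ^ 2) (vol G.inner) :=
      (hac.pow 2).comp_aestronglyMeasurable hS.1
    have := h.integrable_rpow_mul ht' m ha2 hS h1
    simpa only [mul_one] using this
  have i4 : Integrable (fun x => u t x ^ p * b (S t x) * (ρ t - S t x)) (vol G.inner) := by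
    simpa using h.integrable_rpow_mul (a := fun _ => 1) (k := 1) ht' aestronglyMeasurable_const
      (by simp) (hbS t ht') (h.memLp_rho_sub ht')
  have i5 : Integrable (fun x => u t x ^ p * b (S t x)) (vol G.inner) := by
    simpa using h.integrable_rpow_mul (a := fun _ => 1) (k := 1) ht' aestronglyMeasurable_const
      (by simp) (hbS t ht') h1
  -- The pointwise cubic inequality multiplied by the density `V` and integrated; the left side
  -- bounds the derivative of the energy.
  have key := integral_combination_le (r := ρ t) (c := ((n : ℝ) - 2) / 4) (m := n / 2)
    (q := n / 2 * ρ t) (k := n) i1 i2 i3 i4 i5 i6 fun x => by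
      have := mul_le_mul_of_nonneg_left (truncation_inequality (n := n) hn3 (h.rho_nonneg ht') hs hj
        (S t x) (a := a (S t x)) (b := b (S t x)) (by rw [ha]) (by rw [hb]) rfl)
        (Real.rpow_nonneg (h.pos ht' x).le p)
      linarith
  have e0 := h.integral_deriv_truncation_le ht hs h2j (a := fun x => a (S t x)) (by rw [ha])
  have e1 : ∫ x, -2 * a (S t x) * S' t x * u t x ^ p ∂(vol G.inner)
      = 2 * -∫ x, u t x ^ p * a (S t x) * S' t x ∂(vol G.inner) := by
    rw [← integral_neg, ← integral_const_mul]
    exact integral_congr_ae (ae_of_all _ fun x => by ring)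
  have e2 : ∫ x, b (S t x) * (p * (((n : ℝ) - 2) / 4) * u t x ^ p * (ρ t - S t x)) ∂(vol G.inner)
      = n / 2 * ∫ x, u t x ^ p * b (S t x) * (ρ t - S t x) ∂(vol G.inner) := by
    rw [← integral_const_mul, hp4]
    exact integral_congr_ae (ae_of_all _ fun x => by ring)
  have e3 : f t = ∫ x, u t x ^ p * b (S t x) ∂(vol G.inner) := by
    rw [hf']
    exact integral_congr_ae (ae_of_all _ fun x => mul_comm _ _)
  have f0 : 0 ≤ f t := by
    rw [e3]
    refine integral_nonneg fun x => mul_nonneg (Real.rpow_nonneg (h.pos ht' x).le p) ?_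
    rw [hab]
    exact mul_nonneg (ha0 _) (add_nonneg (negExcess_nonneg _ _) (negExcess_nonneg _ _))
  -- Monotonicity replaces `ρ(t)` by the constant rate `ρ(0)`, which is an upper bound because the
  -- energy is nonnegative.
  have hρ := h.rho_antitone ⟨le_rfl, h.time.le⟩ ht' ht'.1
  rw [e1, e2]
  have e4 : (n : ℝ) / 2 * ρ t * f t ≤ n / 2 * ρ 0 * f t := by gcongr
  have e5 := mul_le_mul_of_nonneg_left hE (Nat.cast_nonneg n : (0 : ℝ) ≤ n)
  rw [← e3] at key
  linarith

end ConformalFlow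

end NegativePartEvolution

/-! ### Grönwall's argument, and removal of the truncation. -/

section NegativePartDecay

variable {n : ℕ} {M : Type*} [TopologicalSpace M] [T2Space M] [ChartedSpace (Eucl n) M]
  [IsManifold (𝓡 n) ∞ M] [MeasurableSpace M] [BorelSpace M] [SecondCountableTopology M]
  {G : Bundle.ContMDiffRiemannianMetric (𝓡 n) ∞ (Eucl n) (fun x : M => TangentSpace (𝓡 n) x)}

lemma antitoneOn_Icc_of_Ioo {f : ℝ → ℝ} {a b : ℝ} (h : AntitoneOn f (Ioo a b))
    (hc : ContinuousOn f (Icc a b)) : AntitoneOn f (Icc a b) := by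
  intro x hx y hy hxy
  rcases hxy.eq_or_lt with rfl | hlt
  · exact le_rfl
  have hI : Ioo x y ⊆ Ioo a b := Ioo_subset_Ioo hx.1 hy.2
  have key : ∀ z ∈ Ioo x y, f y ≤ f z ∧ f z ≤ f x := by
    intro z hz
    have : (𝓝[Ioo z y] y).NeBot := right_nhdsWithin_Ioo_neBot hz.2
    have : (𝓝[Ioo x z] x).NeBot := left_nhdsWithin_Ioo_neBot hz.1
    constructor
    · refine le_of_tendsto ((hc y hy).mono_left (nhdsWithin_mono y ((Ioo_subset_Ioo_left hz.1.le).trans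
        (hI.trans Ioo_subset_Icc_self)))) ?_
      filter_upwards [self_mem_nhdsWithin] with w hw
      exact h (hI hz) (hI ⟨hz.1.trans hw.1, hw.2⟩) hw.1.le
    · refine ge_of_tendsto ((hc x hx).mono_left (nhdsWithin_mono x ((Ioo_subset_Ioo_right hz.2.le).trans
        (hI.trans Ioo_subset_Icc_self)))) ?_
      filter_upwards [self_mem_nhdsWithin] with w hw
      exact h (hI ⟨hw.1, hw.2.trans hz.2⟩) (hI hz) hw.2.le
  obtain ⟨z, hz⟩ := nonempty_Ioo.2 hlt
  exact (key z hz).1.trans (key z hz).2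

namespace ConformalFlow

variable {T : ℝ} {u S S' : ℝ → M → ℝ} {X : ℝ → ∀ x : M, TangentSpace (𝓡 n) x} {S₀ : M → ℝ}
  {ρ : ℝ → ℝ} {t : ℝ}

lemma exists_integral_deriv_sq_le (h : ConformalFlow G T u S S' X S₀ ρ) (q : ℝ) {a b : ℝ}
    (hab : Icc a b ⊆ Ioo 0 T) : ∃ A, 0 ≤ A ∧
      ∀ t ∈ Icc a b, ∫ x, S' t x ^ 2 * u t x ^ q ∂(vol G.inner) ≤ A := by
  have hc : ContinuousOn (fun t => ∫ x, S' t x ^ 2 * u t x ^ q ∂(vol G.inner)) (Icc a b) := by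
    intro t ht
    refine h.tendsto_integral_sq_rpow q (Ioo_subset_Icc_self (hab ht))
      (nhdsWithin_mono t (hab.trans Ioo_subset_Icc_self)) ?_ (h.memLp' t (hab ht))
      ((h.contS' t (hab ht)).mono_left nhdsWithin_le_nhds)
    filter_upwards [self_mem_nhdsWithin] with s hs using (h.memLp' s (hab hs)).1
  obtain ⟨A, hA⟩ := isCompact_Icc.exists_bound_of_continuousOn hc
  exact ⟨|A|, abs_nonneg A, fun t ht => (le_abs_self _).trans ((hA t ht).trans (le_abs_self A))⟩

lemma integral_negExcess_mul_abs_le (h : ConformalFlow G T u S S' X S₀ ρ) (q : ℝ) {c ε : ℝ}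
    (hc : 0 ≤ c) (hε : 0 < ε) (ht : t ∈ Ioo 0 T) :
    ∫ x, u t x ^ q * negExcess c (S t x) * |S' t x| ∂(vol G.inner)
      ≤ ε⁻¹ * ∫ x, negExcess c (S t x) ^ 2 * u t x ^ q ∂(vol G.inner)
        + ε * ∫ x, S' t x ^ 2 * u t x ^ q ∂(vol G.inner) := by
  have ht' := Ioo_subset_Icc_self ht
  have i1 := h.integrable_negExcess_sq q ht' hc
  have i2 := h.integrable_rpow q ht' (h.memLp' t ht).integrable_sq
  have hp : ∀ x, 0 ≤ u t x ^ q := fun x => Real.rpow_nonneg (h.pos ht' x).le q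
  rw [← integral_const_mul, ← integral_const_mul, ← integral_add (i1.const_mul _) (i2.const_mul _)]
  refine integral_mono_of_nonneg (ae_of_all _ fun x => mul_nonneg (mul_nonneg (hp x)
    (negExcess_nonneg _ _)) (abs_nonneg _)) ((i1.const_mul _).add (i2.const_mul _))
    (ae_of_all _ fun x => ?_)
  have key : negExcess c (S t x) * |S' t x|
      ≤ ε⁻¹ * negExcess c (S t x) ^ 2 + ε * S' t x ^ 2 := by
    rw [← sq_abs (S' t x)]
    generalize negExcess c (S t x) = a, |S' t x| = b
    have e : ε⁻¹ * a ^ 2 + ε * b ^ 2 = ε⁻¹ * (a ^ 2 + (ε * b) ^ 2) := by field_simp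
    have e2 : a * b = ε⁻¹ * (a * (ε * b)) := by field_simp
    rw [e, e2]
    refine mul_le_mul_of_nonneg_left ?_ (inv_nonneg.2 hε.le)
    nlinarith [sq_nonneg (a - ε * b), sq_nonneg (a + ε * b)]
  have := mul_le_mul_of_nonneg_left key (hp x)
  simp only
  linarith

/-- On a compact interval inside `(0, T)` the `L²` norms of `S'` are bounded. The weighted Young
inequality then makes the error of truncation of order `ε`, and `ε → 0` removes it. -/
lemma integral_negExcess_sq_le_of_Ioo (h : ConformalFlow G T u S S' X S₀ ρ) {s a b : ℝ}
    (hs : 0 ≤ s) (ha : 0 < a) (hab : a ≤ b) (hb : b < T) :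
    Real.exp (-(n / 2 * ρ 0 * b)) * ∫ x, negExcess s (S b x) ^ 2
        * u b x ^ (2 * (n : ℝ) / ((n : ℝ) - 2)) ∂(vol G.inner)
      ≤ Real.exp (-(n / 2 * ρ 0 * a)) * ∫ x, negExcess s (S a x) ^ 2
        * u a x ^ (2 * (n : ℝ) / ((n : ℝ) - 2)) ∂(vol G.inner) := by
  set p := 2 * (n : ℝ) / ((n : ℝ) - 2) with hp
  have hI : Icc a b ⊆ Ioo 0 T := fun t ht => ⟨ha.trans_le ht.1, ht.2.trans_lt hb⟩
  have hK : 0 ≤ (n : ℝ) / 2 * ρ 0 :=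
    mul_nonneg (by positivity) (h.rho_nonneg ⟨le_rfl, h.time.le⟩)
  set K := (n : ℝ) / 2 * ρ 0 with hKd
  obtain ⟨A, hA0, hA⟩ := h.exists_integral_deriv_sq_le p hI
  have hexp : ∀ {t}, t ∈ Icc a b → Real.exp (-(K * t)) ≤ 1 := fun ht =>
    Real.exp_le_one_iff.2 (neg_nonpos.2 (mul_nonneg hK (ha.le.trans ht.1)))
  have main : ∀ ε, 0 < ε → Real.exp (-(K * b)) * ∫ x, negExcess s (S b x) ^ 2 * u b x ^ p ∂(vol G.inner)
      ≤ Real.exp (-(K * a)) * ∫ x, negExcess s (S a x) ^ 2 * u a x ^ p ∂(vol G.inner)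
        + ε * (ε + n * (1 + A) * (b - a)) := by
    intro ε hε
    -- The tail is made smaller than `ε²` because Young's inequality with parameter `ε` divides it
    -- by `ε`.
    obtain ⟨j, hj⟩ := h.exists_integral_negExcess_sq_le p hs (pow_pos hε 2)
    set f : ℝ → ℝ := fun t => ∫ x, (negExcess s (S t x) ^ 2
      - negExcess (s + 2 * (j : ℝ)) (S t x) ^ 2) * u t x ^ p ∂(vol G.inner) with hf
    have hsj : 0 ≤ s + 2 * (j : ℝ) := by positivity
    have hfe : ∀ t ∈ Icc a b, f t = ∫ x, negExcess s (S t x) ^ 2 * u t x ^ p ∂(vol G.inner)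
        - ∫ x, negExcess (s + 2 * (j : ℝ)) (S t x) ^ 2 * u t x ^ p ∂(vol G.inner) := by
      intro t ht
      rw [← integral_sub (h.integrable_negExcess_sq p (Ioo_subset_Icc_self (hI ht)) hs)
        (h.integrable_negExcess_sq p (Ioo_subset_Icc_self (hI ht)) hsj)]
      exact integral_congr_ae (ae_of_all _ fun x => sub_mul _ _ _)
    have hD : ∀ t ∈ Icc a b, ∃ D, HasDerivAt f D t ∧ D ≤ K * f t + n * (ε + ε * A) := by
      intro t ht
      obtain ⟨D, hD, hle⟩ := h.exists_hasDerivAt_le hs j.cast_nonneg hf (hI ht)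
      refine ⟨D, hD, hle.trans ?_⟩
      have e1 := h.integral_negExcess_mul_abs_le p (c := s + j) (by positivity) hε (hI ht)
      have e2 := hj t (Ioo_subset_Icc_self (hI ht)) _ le_rfl
      have e3 : ε⁻¹ * ∫ x, negExcess (s + j) (S t x) ^ 2 * u t x ^ p ∂(vol G.inner) ≤ ε := by
        rw [inv_mul_le_iff₀ hε, ← pow_two]; exact e2
      have e4 := mul_le_mul_of_nonneg_left (hA t ht) hε.le
      have e5 := mul_le_mul_of_nonneg_left (e1.trans (add_le_add e3 e4))
        (Nat.cast_nonneg n : (0 : ℝ) ≤ n)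
      exact add_le_add le_rfl e5
    choose! D hD hDle using hD
    set δ := n * (ε + ε * A) with hδ
    have hδ0 : 0 ≤ δ := by positivity
    -- The exponential absorbs the rate `K`, and subtracting `δ t` absorbs the additive error, as
    -- the exponential is at most `1`.
    have hφ : ∀ t ∈ Icc a b, HasDerivAt (fun t => Real.exp (-(K * t)) * f t - δ * t)
        (Real.exp (-(K * t)) * -(K * 1) * f t + Real.exp (-(K * t)) * D t - δ * 1) t :=
      fun t ht => ((((hasDerivAt_id t).const_mul K).fun_neg.exp).mul (hD t ht)).sub
        ((hasDerivAt_id t).const_mul δ)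
    have hanti : AntitoneOn (fun t => Real.exp (-(K * t)) * f t - δ * t) (Icc a b) := by
      refine antitoneOn_of_deriv_nonpos (convex_Icc a b)
        (fun t ht => (hφ t ht).continuousAt.continuousWithinAt)
        (fun t ht => (hφ t (interior_subset ht)).differentiableAt.differentiableWithinAt) ?_
      intro t ht
      rw [(hφ t (interior_subset ht)).deriv]
      have e1 := mul_le_mul_of_nonneg_left (hDle t (interior_subset ht))
        (Real.exp_pos (-(K * t))).le
      have e2 := mul_le_mul_of_nonneg_right (hexp (interior_subset ht)) hδ0
      linarith
    have e1 := hanti ⟨le_rfl, hab⟩ ⟨hab, le_rfl⟩ hab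
    simp only [hfe b ⟨hab, le_rfl⟩, hfe a ⟨le_rfl, hab⟩, mul_sub] at e1
    have ha' := Ioo_subset_Icc_self (hI ⟨le_rfl, hab⟩)
    have e2 : 0 ≤ Real.exp (-(K * a))
        * ∫ x, negExcess (s + 2 * (j : ℝ)) (S a x) ^ 2 * u a x ^ p ∂(vol G.inner) :=
      mul_nonneg (Real.exp_pos _).le (integral_nonneg fun x => mul_nonneg (sq_nonneg _)
        (Real.rpow_nonneg (h.pos ha' x).le p))
    have e3 := hj b (Ioo_subset_Icc_self (hI ⟨hab, le_rfl⟩)) (s + 2 * (j : ℝ))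
      (by linarith [(j.cast_nonneg : (0 : ℝ) ≤ j)])
    have e4 := (mul_le_mul_of_nonneg_left e3 (Real.exp_pos (-(K * b))).le).trans
      (mul_le_mul_of_nonneg_right (hexp ⟨hab, le_rfl⟩) (sq_nonneg ε))
    have e5 : δ * b - δ * a + 1 * ε ^ 2 = ε * (ε + n * (1 + A) * (b - a)) := by rw [hδ]; ring
    linarith
  have hlim : Tendsto (fun ε : ℝ => Real.exp (-(K * a))
      * ∫ x, negExcess s (S a x) ^ 2 * u a x ^ p ∂(vol G.inner)
        + ε * (ε + n * (1 + A) * (b - a))) (𝓝[>] 0)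
      (𝓝 (Real.exp (-(K * a)) * ∫ x, negExcess s (S a x) ^ 2 * u a x ^ p ∂(vol G.inner)
        + 0 * (0 + n * (1 + A) * (b - a)))) := by
    refine (Continuous.tendsto ?_ 0).mono_left nhdsWithin_le_nhds
    fun_prop
  rw [zero_mul, add_zero] at hlim
  refine ge_of_tendsto hlim ?_
  filter_upwards [self_mem_nhdsWithin] with ε hε using main ε hε

/-- No bound on `S'` is available near the endpoints of `[0, T]`. The energy is continuous up to
them, because `S` is continuous in `L²`, so monotonicity extends from the open interval. -/
theorem integral_negExcess_sq_le (h : ConformalFlow G T u S S' X S₀ ρ) {s : ℝ}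
    (hs : 0 ≤ s) (ht : t ∈ Icc 0 T) :
    ∫ x, negExcess s (S t x) ^ 2 * u t x ^ (2 * (n : ℝ) / ((n : ℝ) - 2)) ∂(vol G.inner)
      ≤ Real.exp (n / 2 * ρ 0 * t) * ∫ x, negExcess s (S 0 x) ^ 2 ∂(vol G.inner) := by
  set p := 2 * (n : ℝ) / ((n : ℝ) - 2) with hp
  have hc : ContinuousOn (fun t => Real.exp (-(n / 2 * ρ 0 * t))
      * ∫ x, negExcess s (S t x) ^ 2 * u t x ^ p ∂(vol G.inner)) (Icc 0 T) :=
    ContinuousOn.mul (by fun_prop) (h.continuousOn_integral_negExcess_sq p hs)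
  have := antitoneOn_Icc_of_Ioo (fun a ha b hb hab =>
    h.integral_negExcess_sq_le_of_Ioo hs ha.1 hab hb.2) hc ⟨le_rfl, h.time.le⟩ ht ht.1
  simp only [mul_zero, neg_zero, Real.exp_zero, one_mul, h.initial, Real.one_rpow, mul_one] at this
  rw [Real.exp_neg, inv_mul_le_iff₀ (Real.exp_pos _)] at this
  exact this

end ConformalFlow

end NegativePartDecay

/-! ### From squares of excesses to all `Lᵖ` norms. -/

section LayerCake

lemma negPart_eq_negExcess {M : Type*} (σ : M → ℝ) (x : M) : negPart σ x = negExcess 0 (σ x) := by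
  rw [negPart, negExcess, sub_zero]
  rcases le_total (σ x) 0 with h | h
  · rw [min_eq_left h, max_eq_left (by linarith)]
  · rw [min_eq_right h, max_eq_right (by linarith), neg_zero]

lemma continuous_negExcess_uncurry : Continuous fun r : ℝ × ℝ => negExcess r.1 r.2 := by
  unfold negExcess; fun_prop

/-- Powers of the negative part, as superpositions of squares of its excesses. -/
lemma exists_lintegral_rpow_mul_negExcess_sq {q : ℝ} (hq : 2 < q) : ∃ c : ℝ, 0 < c ∧ ∀ y : ℝ,
    ∫⁻ s in Ioi 0, ENNReal.ofReal (s ^ (q - 3)) * ENNReal.ofReal (negExcess s y ^ 2)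
      = ENNReal.ofReal c * ENNReal.ofReal (negExcess 0 y ^ q) := by
  have hq0 : 0 < q - 2 := by linarith
  have hq1 : 0 < q - 1 := by linarith
  have hq2 : 0 < q := by linarith
  -- The Beta integral `∫₀ᶻ s^{q-3} (z - s)² ds = B(q-2, 3) z^q`.
  refine ⟨2 / (q * (q - 1) * (q - 2)), by positivity, fun y => ?_⟩
  set z := negExcess 0 y with hz
  have hz0 : 0 ≤ z := negExcess_nonneg _ _
  have e0 : ∀ s ∈ Ioi (0 : ℝ), ENNReal.ofReal (s ^ (q - 3)) * ENNReal.ofReal (negExcess s y ^ 2)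
      = (Ioc 0 z).indicator (fun s => ENNReal.ofReal (z ^ 2 * s ^ (q - 3) - 2 * z * s ^ (q - 2)
        + s ^ (q - 1))) s := by
    intro s hs
    have hs : 0 < s := hs
    by_cases h : s ≤ z
    · rw [indicator_of_mem (show s ∈ Ioc 0 z from ⟨hs, h⟩), ← ENNReal.ofReal_mul (Real.rpow_nonneg hs.le _)]
      have hy : 0 ≤ -y := by
        by_contra! hlt
        rw [hz, negExcess_eq_zero (by linarith)] at h
        linarith
      have hzy : z = -y := by rw [hz, negExcess_eq hy, sub_zero]
      rw [negExcess_eq (by linarith), show q - 2 = q - 3 + 1 by ring,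
        show q - 1 = q - 3 + 1 + 1 by ring, Real.rpow_add_one hs.ne', Real.rpow_add_one hs.ne',
        Real.rpow_add_one hs.ne', hzy]
      congr 1
      ring
    · rw [indicator_of_notMem fun h' => h h'.2]
      have : negExcess s y = 0 := by
        refine negExcess_eq_zero ?_
        have : -y - 0 ≤ z := le_max_left _ _
        linarith
      simp [this]
  rw [setLIntegral_congr_fun measurableSet_Ioi e0, setLIntegral_indicator measurableSet_Ioc,
    inter_eq_left.2 Ioc_subset_Ioi_self]
  have i1 : IntervalIntegrable (fun s : ℝ => s ^ (q - 3)) volume 0 z :=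
    intervalIntegral.intervalIntegrable_rpow' (by linarith)
  have i2 : IntervalIntegrable (fun s : ℝ => s ^ (q - 2)) volume 0 z :=
    intervalIntegral.intervalIntegrable_rpow' (by linarith)
  have i3 : IntervalIntegrable (fun s : ℝ => s ^ (q - 1)) volume 0 z :=
    intervalIntegral.intervalIntegrable_rpow' (by linarith)
  have i4 := (i1.const_mul (z ^ 2)).sub (i2.const_mul (2 * z))
  rw [← ofReal_integral_eq_lintegral_ofReal]
  · rw [← intervalIntegral.integral_of_le hz0, intervalIntegral.integral_add i4 i3,
      intervalIntegral.integral_sub (i1.const_mul _) (i2.const_mul _),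
      intervalIntegral.integral_const_mul, intervalIntegral.integral_const_mul,
      integral_rpow (Or.inl (by linarith)), integral_rpow (Or.inl (by linarith)),
      integral_rpow (Or.inl (by linarith)), ← ENNReal.ofReal_mul (by positivity)]
    congr 1
    rw [Real.zero_rpow (by linarith), Real.zero_rpow (by linarith), Real.zero_rpow (by linarith)]
    have hzq : z ^ q = z ^ (q - 3 + 1) * z ^ 2 := by
      rw [← Real.rpow_natCast, ← Real.rpow_add_of_nonneg hz0 (by linarith) (by norm_num)]
      congr 1; push_cast; ring
    have hzq1 : z ^ (q - 2 + 1) = z ^ (q - 3 + 1) * z := by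
      nth_rewrite 3 [← Real.rpow_one z]
      rw [← Real.rpow_add_of_nonneg hz0 (by linarith) (by norm_num)]
      congr 1; ring
    rw [show q - 1 + 1 = q by ring, hzq, hzq1, show q - 3 + 1 = q - 2 by ring,
      show q - 2 + 1 = q - 1 by ring]
    field_simp
    ring
  · exact (i4.add i3).1
  · refine (ae_restrict_iff' measurableSet_Ioc).2 (ae_of_all _ fun s hs => ?_)
    have : z ^ 2 * s ^ (q - 3) - 2 * z * s ^ (q - 2) + s ^ (q - 1)
        = s ^ (q - 3) * (z - s) ^ 2 := by
      rw [show q - 2 = q - 3 + 1 by ring,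
        show q - 1 = q - 3 + 1 + 1 by ring, Real.rpow_add_one hs.1.ne', Real.rpow_add_one hs.1.ne',
        Real.rpow_add_one hs.1.ne']
      ring
    simp only [this]
    exact mul_nonneg (Real.rpow_nonneg hs.1.le _) (sq_nonneg _)

variable {α : Type*} {m0 : MeasurableSpace α} {μ ν : Measure α} {σ τ : α → ℝ}

lemma lintegral_lintegral_negExcess_sq [SFinite μ] (hσ : AEStronglyMeasurable σ μ) {q c : ℝ}
    (hc : ∀ y : ℝ, ∫⁻ s in Ioi 0, ENNReal.ofReal (s ^ (q - 3)) * ENNReal.ofReal (negExcess s y ^ 2)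
      = ENNReal.ofReal c * ENNReal.ofReal (negExcess 0 y ^ q)) :
    ENNReal.ofReal c * ∫⁻ x, ENNReal.ofReal (negExcess 0 (σ x) ^ q) ∂μ
      = ∫⁻ s in Ioi 0, ENNReal.ofReal (s ^ (q - 3))
        * ∫⁻ x, ENNReal.ofReal (negExcess s (σ x) ^ 2) ∂μ := by
  have hm : AEMeasurable (fun r : α × ℝ => ENNReal.ofReal (r.2 ^ (q - 3))
      * ENNReal.ofReal (negExcess r.2 (σ r.1) ^ 2)) (μ.prod (volume.restrict (Ioi 0))) := by
    refine (by fun_prop : Measurable fun r : α × ℝ => ENNReal.ofReal (r.2 ^ (q - 3))).aemeasurable.mul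
      (AEMeasurable.ennreal_ofReal (AEMeasurable.pow_const ?_ 2))
    exact continuous_negExcess_uncurry.measurable.comp_aemeasurable
      (measurable_snd.aemeasurable.prodMk hσ.aemeasurable.comp_fst)
  rw [← lintegral_const_mul' _ _ ENNReal.ofReal_ne_top]
  simp only [← hc]
  rw [lintegral_lintegral_swap hm]
  refine lintegral_congr fun s => ?_
  rw [lintegral_const_mul' _ _ ENNReal.ofReal_ne_top]

/-- Bounds of the squares of all excesses of the negative part imply bounds of its `Lᵖ` norms. -/
theorem eLpNorm_negPart_le [SFinite μ] [SFinite ν] (hσ : AEStronglyMeasurable σ ν)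
    (hτ : AEStronglyMeasurable τ μ) {A : ℝ}
    (h : ∀ s : ℝ, 0 ≤ s → ∫⁻ x, ENNReal.ofReal (negExcess s (σ x) ^ 2) ∂ν
      ≤ ENNReal.ofReal (Real.exp A) * ∫⁻ x, ENNReal.ofReal (negExcess s (τ x) ^ 2) ∂μ)
    {p : ℝ≥0∞} (hp : 2 ≤ p) :
    eLpNorm (negPart σ) p ν
      ≤ ENNReal.ofReal (Real.exp (A * (p⁻¹).toReal)) * eLpNorm (negPart τ) p μ := by
  rcases eq_or_ne p ⊤ with rfl | hpt
  · simp only [ENNReal.inv_top, ENNReal.toReal_zero, mul_zero, Real.exp_zero, ENNReal.ofReal_one,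
      one_mul]
    rcases eq_or_ne (eLpNorm (negPart τ) ⊤ μ) ⊤ with ht | ht
    · rw [ht]; exact le_top
    -- At the level of the essential supremum the initial excess vanishes almost everywhere, hence
    -- so does the later one, whatever the factor `e^A`.
    set s := (eLpNorm (negPart τ) ⊤ μ).toReal with hs
    have hs0 : 0 ≤ s := ENNReal.toReal_nonneg
    have h1 : ∀ᵐ x ∂μ, negExcess s (τ x) = 0 := by
      have := ae_le_eLpNormEssSup (f := negPart τ) (μ := μ)
      filter_upwards [this] with x hx
      rw [← eLpNorm_exponent_top, ← ENNReal.ofReal_toReal ht, ← hs,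
        Real.enorm_eq_ofReal (by rw [negPart_eq_negExcess]; exact negExcess_nonneg _ _),
        ENNReal.ofReal_le_ofReal_iff hs0, negPart_eq_negExcess] at hx
      refine negExcess_eq_zero ?_
      have : -τ x - 0 ≤ negExcess 0 (τ x) := le_max_left _ _
      linarith
    have h2 : ∫⁻ x, ENNReal.ofReal (negExcess s (σ x) ^ 2) ∂ν = 0 := by
      refine le_antisymm ((h s hs0).trans (le_of_eq ?_)) zero_le
      rw [lintegral_congr_ae (g := fun _ => 0) (by filter_upwards [h1] with x hx; simp [hx])]
      simp
    rw [lintegral_eq_zero_iff' (((continuous_negExcess s).comp_aestronglyMeasurable hσ).aemeasurable.pow_const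
      2).ennreal_ofReal] at h2
    rw [← ENNReal.ofReal_toReal ht, ← hs]
    refine (eLpNorm_le_of_ae_bound (C := s) ?_).trans (by simp)
    filter_upwards [h2] with x hx
    have h3 : negExcess s (σ x) = 0 := by
      rw [Pi.zero_apply, ENNReal.ofReal_eq_zero] at hx
      exact pow_eq_zero_iff two_ne_zero |>.1 (le_antisymm hx (sq_nonneg _))
    rw [negPart_eq_negExcess, Real.norm_eq_abs, abs_of_nonneg (negExcess_nonneg _ _)]
    refine max_le ?_ hs0
    have : -σ x - s ≤ negExcess s (σ x) := le_max_left _ _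
    linarith
  set q := p.toReal with hq
  have hp0 : p ≠ 0 := (two_pos.trans_le hp).ne'
  have hq2 : 2 ≤ q := by
    have := ENNReal.toReal_mono hpt hp
    simpa using this
  have hq0 : 0 < q := by linarith
  have hpow : ∀ {f : α → ℝ} {κ : Measure α}, eLpNorm (negPart f) p κ
      = (∫⁻ x, ENNReal.ofReal (negExcess 0 (f x) ^ q) ∂κ) ^ (1 / q) := by
    intro f κ
    rw [eLpNorm_eq_lintegral_rpow_enorm_toReal hp0 hpt]
    congr 1
    refine lintegral_congr fun x => ?_
    rw [negPart_eq_negExcess, Real.enorm_eq_ofReal (negExcess_nonneg _ _),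
      ENNReal.ofReal_rpow_of_nonneg (negExcess_nonneg _ _) hq0.le]
  have main : ∫⁻ x, ENNReal.ofReal (negExcess 0 (σ x) ^ q) ∂ν
      ≤ ENNReal.ofReal (Real.exp A) * ∫⁻ x, ENNReal.ofReal (negExcess 0 (τ x) ^ q) ∂μ := by
    -- For `q = 2` the weight `s^{q-3}` is not integrable at zero, but level `0` is already the
    -- claim.
    rcases hq2.eq_or_lt with h2 | h2
    · simpa only [← h2, Real.rpow_two] using h 0 le_rfl
    · obtain ⟨c, hc0, hc⟩ := exists_lintegral_rpow_mul_negExcess_sq h2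
      have e1 := lintegral_lintegral_negExcess_sq hσ hc
      have e2 := lintegral_lintegral_negExcess_sq hτ hc
      have hc' : ENNReal.ofReal c ≠ 0 := (ENNReal.ofReal_pos.2 hc0).ne'
      rw [← ENNReal.mul_le_mul_iff_right hc' ENNReal.ofReal_ne_top, mul_left_comm, e1, e2,
        ← lintegral_const_mul' _ _ ENNReal.ofReal_ne_top]
      refine setLIntegral_mono' measurableSet_Ioi fun s hs => ?_
      rw [mul_left_comm]
      gcongr
      exact h s (le_of_lt hs)
  rw [hpow, hpow]
  calc _ ≤ (ENNReal.ofReal (Real.exp A) * ∫⁻ x, ENNReal.ofReal (negExcess 0 (τ x) ^ q) ∂μ)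
        ^ (1 / q) := ENNReal.rpow_le_rpow main (by positivity)
    _ = _ := by
      rw [ENNReal.mul_rpow_of_nonneg _ _ (by positivity),
        ENNReal.ofReal_rpow_of_nonneg (Real.exp_pos _).le (by positivity), ← Real.exp_mul,
        ENNReal.toReal_inv, one_div]

end LayerCake

/-! ### From the given normalized Yamabe flow to a conformal flow with bounded factors. -/

section Construction

variable {n : ℕ} {M : Type*} [TopologicalSpace M] [T2Space M] [ChartedSpace (Eucl n) M]
  [IsManifold (𝓡 n) ∞ M] [MeasurableSpace M] [BorelSpace M] [SecondCountableTopology M]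
  {G : Bundle.ContMDiffRiemannianMetric (𝓡 n) ∞ (Eucl n) (fun x : M => TangentSpace (𝓡 n) x)}

lemma conformal_one (m : MetricField n M) : conformal m (fun _ => 1) = m := by
  funext x; simp [conformal]

lemma integral_vol_conformal (hn : 3 ≤ n) {w : M → ℝ} (hw : ∀ x, 0 < w x) (hwm : Measurable w)
    (f : M → ℝ) : ∫ x, f x ∂(vol (conformal G.inner w))
      = ∫ x, f x * w x ^ (2 * (n : ℝ) / ((n : ℝ) - 2)) ∂(vol G.inner) := by
  rw [vol_conformal G hn hw hwm, integral_withDensity_eq_integral_toReal_smul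
    (hwm.pow_const _).ennreal_ofReal (ae_of_all _ fun _ => ENNReal.ofReal_lt_top)]
  refine integral_congr_ae (ae_of_all _ fun x => ?_)
  simp only [ENNReal.toReal_ofReal (Real.rpow_nonneg (hw x).le _), smul_eq_mul, mul_comm]

lemma lintegral_vol_conformal (hn : 3 ≤ n) {w : M → ℝ} (hw : ∀ x, 0 < w x) (hwm : Measurable w)
    {f : M → ℝ} (hf : ∀ x, 0 ≤ f x) : ∫⁻ x, ENNReal.ofReal (f x) ∂(vol (conformal G.inner w))
      = ∫⁻ x, ENNReal.ofReal (f x * w x ^ (2 * (n : ℝ) / ((n : ℝ) - 2))) ∂(vol G.inner) := by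
  rw [vol_conformal G hn hw hwm, lintegral_withDensity_eq_lintegral_mul_non_measurable _
    (hwm.pow_const _).ennreal_ofReal (ae_of_all _ fun _ => ENNReal.ofReal_lt_top)]
  refine lintegral_congr fun x => ?_
  rw [Pi.mul_apply, mul_comm, ENNReal.ofReal_mul (hf x)]

lemma average_conformal (hn : 3 ≤ n) {w : M → ℝ} (hw : ∀ x, 0 < w x) (hwm : Measurable w)
    (σ : M → ℝ) : average (conformal G.inner w) σ
      = (∫ x, w x ^ (2 * (n : ℝ) / ((n : ℝ) - 2)) ∂(vol G.inner))⁻¹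
        * ∫ x, σ x * w x ^ (2 * (n : ℝ) / ((n : ℝ) - 2)) ∂(vol G.inner) := by
  have h := integral_vol_conformal (G := G) hn hw hwm fun _ => 1
  simp only [integral_const, smul_eq_mul, mul_one, one_mul] at h
  rw [average, integral_vol_conformal hn hw hwm, ← h]
  rfl

lemma tendsto_eLpNorm_of_h1Norm {ι : Type*} {l : Filter ι} {F : ι → M → ℝ} {m : MetricField n M}
    {C : ℝ≥0} (hC : ∀ v, h1Norm G.inner v ≤ C * h1Norm m v)
    (h : Tendsto (fun i => h1Norm m (F i)) l (𝓝 0)) :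
    Tendsto (fun i => eLpNorm (F i) 2 (vol G.inner)) l (𝓝 0) := by
  have := ENNReal.Tendsto.const_mul (a := (C : ℝ≥0∞)) h (Or.inr ENNReal.coe_ne_top)
  rw [mul_zero] at this
  exact tendsto_of_tendsto_of_tendsto_of_le_of_le tendsto_const_nhds this (fun _ => zero_le)
    fun i => (eLpNorm_le_h1Norm _ _).trans (hC _)

lemma mfderiv_ae_eq_ip {w : M → ℝ} {X : ∀ x : M, TangentSpace (𝓡 n) x}
    (hw : ContMDiff (𝓡 n) 𝓘(ℝ, ℝ) 1 w) (hX : IsWeakGradient G.inner w X) (ψ : M → ℝ) :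
    (fun x => (mfderiv (𝓡 n) 𝓘(ℝ, ℝ) ψ x (X x) : ℝ))
      =ᵐ[vol G.inner] ip G (grad G ψ) (grad G w) := by
  filter_upwards [hX.ae_eq (isWeakGradient_grad hw)] with x hx
  rw [hx, ip, inner_grad]

lemma IsConformalScalarCurvature.integral_eq {w σ : M → ℝ}
    (h : IsConformalScalarCurvature G.inner w σ) (hw : ContMDiff (𝓡 n) 𝓘(ℝ, ℝ) 1 w)
    {ψ : M → ℝ} (hψ : IsTest n ψ) :
    ∫ x, σ x * w x ^ (((n : ℝ) + 2) / ((n : ℝ) - 2)) * ψ x ∂(vol G.inner)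
      = confConst n * ∫ x, ip G (grad G ψ) (grad G w) x ∂(vol G.inner)
        + ∫ x, scalarCurvature G.inner x * w x * ψ x ∂(vol G.inner) := by
  obtain ⟨X, hX, e⟩ := h.2.2
  rw [e ψ hψ, integral_congr_ae (mfderiv_ae_eq_ip hw hX ψ)]

/-- For the constant factor `1` the gradient term vanishes and both functions have the same
integrals against all test functions. -/
lemma IsConformalScalarCurvature.ae_eq {σ : M → ℝ}
    (h : IsConformalScalarCurvature G.inner (fun _ => 1) σ) :
    σ =ᵐ[vol G.inner] scalarCurvature G.inner := by
  have := ChartedSpace.locallyCompactSpace (Eucl n) M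
  have i1 := h.1
  have i2 := h.2.1
  simp only [Real.one_rpow, mul_one] at i1 i2
  have := ae_eq_zero_of_integral_contMDiff_smul_eq_zero (𝓡 n) (i1.sub i2) fun ψ hψ hc => by
    have e := h.integral_eq contMDiff_const ⟨hψ, hc⟩
    simp only [Real.one_rpow, mul_one, ip, grad_const, map_zero, integral_zero, mul_zero,
      zero_add] at e
    have j1 := i1.integrable_smul_left_of_hasCompactSupport hψ.continuous hc
    have j2 := i2.integrable_smul_left_of_hasCompactSupport hψ.continuous hc
    simp only [Pi.sub_apply, smul_sub]
    rw [integral_sub j1 j2, sub_eq_zero]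
    simpa only [smul_eq_mul, mul_comm] using e
  filter_upwards [this] with x hx using sub_eq_zero.1 hx

lemma integrable_mul_sq_of_hasCompactSupport {f v : M → ℝ} (hf : Integrable f (vol G.inner))
    (hv : Continuous v) (hc : HasCompactSupport v) :
    Integrable (fun x => f x * v x ^ 2) (vol G.inner) := by
  obtain ⟨K, hK⟩ := hv.bounded_above_of_compact_support hc
  refine (hf.bdd_mul (c := K ^ 2) (hv.pow 2).aestronglyMeasurable (ae_of_all _ fun x => ?_)).congr
    (ae_of_all _ fun x => mul_comm _ _)
  rw [Pi.pow_apply, norm_pow]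
  exact pow_le_pow_left₀ (norm_nonneg _) (hK x) 2

/-- Only the sign of the quotient matters: a negative numerator would make it nonpositive whatever
the denominator is. For `v = 0`, where the quotient is not admitted, the claim is trivial. -/
lemma nonneg_of_yamabeConstant_pos [IsFiniteMeasure (vol G.inner)]
    (hY : 0 < yamabeConstant G.inner)
    (hS : Integrable (scalarCurvature G.inner) (vol G.inner)) {v : M → ℝ}
    (hv : ContMDiff (𝓡 n) 𝓘(ℝ, ℝ) 1 v) (hc : HasCompactSupport v) :
    0 ≤ confConst n * ∫ x, ip G (grad G v) (grad G v) x ∂(vol G.inner)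
      + ∫ x, scalarCurvature G.inner x * v x ^ 2 ∂(vol G.inner) := by
  have hw := isWeakGradient_grad (G := G) hv
  have h2 := memLp_nrm_grad_of_hasCompactSupport (G := G) hv hc
  by_cases h0 : v =ᵐ[vol G.inner] 0
  · have : v = fun _ => 0 := (hv.continuous.ae_eq_iff_eq (vol G.inner) continuous_const).1 h0
    simp [this, ip, grad_const]
  have hd : (dirichlet G.inner v).toReal = ∫ x, ip G (grad G v) (grad G v) x ∂(vol G.inner) := by
    rw [hw.dirichlet_eq, ← lintegral_ofReal_sq]
    simp only [← nrm_sq]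
    rw [integral_eq_lintegral_of_nonneg_ae (ae_of_all _ fun x => sq_nonneg _)
      h2.integrable_sq.1]
  have hm : MemH1 G.inner v := by
    have hv2 : MemLp v 2 (vol G.inner) := hv.continuous.memLp_of_hasCompactSupport hc
    have : h1Norm G.inner v ^ 2 < ⊤ := by
      rw [hw.h1Norm_eq]
      exact ENNReal.add_lt_top.2 ⟨ENNReal.pow_lt_top hv2.2, ENNReal.pow_lt_top h2.2⟩
    exact (ENNReal.pow_lt_top_iff.1 this).resolve_right (by norm_num)
  have hle := hY.trans_le (sInf_le ⟨v, hm, h0,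
    integrable_mul_sq_of_hasCompactSupport hS hv.continuous hc, rfl⟩)
  rw [hd] at hle
  norm_cast at hle
  by_contra! hneg
  exact (hle.trans_le (div_nonpos_of_nonpos_of_nonneg hneg.le (sq_nonneg _))).false

lemma hasDerivAt_of_rpow {f : ℝ → ℝ} {N a b t : ℝ} (hN : N ≠ 0) (hf : ∀ᶠ s in 𝓝 t, 0 < f s)
    (h : HasDerivAt (fun s => f s ^ N) (a * f t ^ N) t) (hb : a = b * N) :
    HasDerivAt f (b * f t) t := by
  have ht := hf.self_of_nhds
  have h1 := (h.rpow_const (p := 1 / N) (Or.inl (Real.rpow_pos_of_pos ht N).ne'))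
  refine (h1.congr_of_eventuallyEq ?_).congr_deriv ?_
  · filter_upwards [hf] with s hs
    rw [← Real.rpow_mul hs.le, mul_one_div_cancel hN, Real.rpow_one]
  · rw [Real.rpow_sub_one (Real.rpow_pos_of_pos ht N).ne', ← Real.rpow_mul ht.le,
      mul_one_div_cancel hN, Real.rpow_one, hb]
    have := (Real.rpow_pos_of_pos ht N).ne'
    field_simp

lemma IsNormalizedYamabeFlow.ae_eq {T : ℝ} (hT : 0 < T) {u S : ℝ → M → ℝ}
    (hflow : IsNormalizedYamabeFlow G.inner T u S) :
    S 0 =ᵐ[vol G.inner] scalarCurvature G.inner := by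
  have := hflow.scalar 0 ⟨le_rfl, hT.le⟩
  rw [show u 0 = fun _ => 1 from funext hflow.initial] at this
  exact IsConformalScalarCurvature.ae_eq this

/-- The norm equivalence is used twice: it turns limits in the moving norms into limits in the norm
of `g₀`, and it bounds the conformal factor. The equation for `u^{(n+2)/(n-2)}` becomes one for `u`
by the chain rule. -/
theorem IsNormalizedYamabeFlow.exists_conformalFlow (hn : 3 ≤ n) (hvol : vol G.inner univ = 1)
    {T : ℝ} (hT : 0 < T) {u S : ℝ → M → ℝ} (hflow : IsNormalizedYamabeFlow G.inner T u S)
    {C : ℝ≥0} (hC : ∀ t ∈ Icc 0 T, ∀ v : M → ℝ,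
      h1Norm G.inner v ≤ C * h1Norm (conformal G.inner (u t)) v ∧
      h1Norm (conformal G.inner (u t)) v ≤ C * h1Norm G.inner v)
    (hdense : TestDenseInH1 G.inner)
    (hS0 : ContInH1 (fun t => conformal G.inner (u t)) (Icc 0 T) S)
    (hS1 : C1InH1 (fun t => conformal G.inner (u t)) (Ioo 0 T) S)
    (hY : 0 < yamabeConstant G.inner) :
    ∃ S' X, ConformalFlow G T u S S' X (scalarCurvature G.inner)
      fun t => average (conformal G.inner (u t)) (S t) := by
  have hp : IsProbabilityMeasure (vol G.inner) := ⟨hvol⟩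
  have hn3 : (3 : ℝ) ≤ n := by exact_mod_cast hn
  have hn2 : (0 : ℝ) < (n : ℝ) - 2 := by linarith
  have hmem : ∀ t ∈ Icc 0 T, ∀ v, MemH1 (conformal G.inner (u t)) v → MemH1 G.inner v :=
    fun t ht v hv => (hC t ht v).1.trans_lt (ENNReal.mul_lt_top ENNReal.coe_lt_top hv)
  have hS := fun t ht => (hmem t ht _ (hS0 t ht).1).exists_isWeakGradient
  choose! hS2 X hX hX2 using hS
  obtain ⟨-, S', hS', hd⟩ := hS1
  have hcont : ∀ t ∈ Icc 0 T, Continuous (u t) := fun t ht => (hflow.contMDiff t ht).continuous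
  -- Square integrability of the background curvature is read off from `S(0) ∈ H¹`, since the two
  -- agree almost everywhere.
  have hS02 : MemLp (scalarCurvature G.inner) 2 (vol G.inner) :=
    (memLp_congr_ae (hflow.ae_eq hT)).1 (hS2 0 ⟨le_rfl, hT.le⟩)
  refine ⟨S', X, hn, hT, hvol, hdense, hflow.continuousOn, hflow.contMDiff, ?_, hflow.initial, ?_,
    hS2, ?_, ?_, ?_, ?_, fun t ht => exists_approx hdense (hX t ht) (hS2 t ht) (hX2 t ht), ?_, hS02,
    fun t ht ψ hψ => (hflow.scalar t ht).integral_eq (hflow.contMDiff t ht) hψ, fun v hv hc =>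
    nonneg_of_yamabeConstant_pos hY (hS02.integrable (by norm_num)) hv hc⟩
  -- The comparison with the constant factor `1`, in both directions, gives `u ≤ C` and `1 ≤ C u`.
  -- Adding `1` makes the constant positive.
  · refine ⟨C + 1, by positivity, fun t ht x => ?_⟩
    have h1 := le_of_forall_h1Norm_le (G := G) hn (hflow.pos t ht) (fun _ => one_pos)
      (hcont t ht) continuous_const (fun v => by rw [conformal_one]; exact (hC t ht v).2) x
    have h2 := le_of_forall_h1Norm_le (G := G) hn (fun _ => one_pos) (hflow.pos t ht)
      continuous_const (hcont t ht) (fun v => by rw [conformal_one]; exact (hC t ht v).1) x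
    have hu := hflow.pos t ht x
    refine ⟨?_, by linarith⟩
    rw [inv_le_iff_one_le_mul₀ (by positivity)]
    linarith
  · intro t ht x
    have hN : ((n : ℝ) + 2) / ((n : ℝ) - 2) ≠ 0 := by positivity
    refine hasDerivAt_of_rpow hN ?_ ((hflow.flow t ht x).congr_deriv ?_)
      (a := ((n : ℝ) + 2) / 4 * (average (conformal G.inner (u t)) (S t) - S t x)) ?_
    · filter_upwards [Icc_mem_nhds ht.1 ht.2] with s hs using hflow.pos s hs x
    · ring
    · field_simp
  · intro t ht
    exact tendsto_eLpNorm_of_h1Norm (fun v => (hC t ht v).1) (hS0 t ht).2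
  · intro t ht
    exact (hmem t (Ioo_subset_Icc_self ht) _ (hS' t ht).1).exists_isWeakGradient.1
  · intro t ht
    exact tendsto_eLpNorm_of_h1Norm (fun v => (hC t (Ioo_subset_Icc_self ht) v).1) (hd t ht)
  · intro t ht
    have := tendsto_eLpNorm_of_h1Norm (fun v => (hC t (Ioo_subset_Icc_self ht) v).1) (hS' t ht).2
    rwa [nhdsWithin_eq_nhds.2 (Ioo_mem_nhds ht.1 ht.2)] at this
  · intro t ht
    exact average_conformal hn (hflow.pos t ht) (hcont t ht).measurable _

variable {T t : ℝ} {u S S' : ℝ → M → ℝ} {X : ℝ → ∀ x : M, TangentSpace (𝓡 n) x} {S₀ : M → ℝ}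
  {ρ : ℝ → ℝ}

lemma ConformalFlow.aestronglyMeasurable (h : ConformalFlow G T u S S' X S₀ ρ) (ht : t ∈ Icc 0 T) :
    AEStronglyMeasurable (S t) (vol (conformal G.inner (u t))) := by
  rw [vol_conformal G h.dim (h.pos ht) (h.continuous ht).measurable]
  exact (h.memLp t ht).1.mono_ac (withDensity_absolutelyContinuous _ _)

theorem ConformalFlow.eLpNorm_negPart_le (h : ConformalFlow G T u S S' X S₀ ρ)
    (h0 : S 0 =ᵐ[vol G.inner] S₀) (ht : t ∈ Icc 0 T) {p : ℝ≥0∞} (hp : 2 ≤ p) :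
    eLpNorm (negPart (S t)) p (vol (conformal G.inner (u t)))
      ≤ ENNReal.ofReal (Real.exp (t * n * ρ 0 / 2 * (p⁻¹).toReal))
        * eLpNorm (negPart S₀) p (vol G.inner) := by
  have := h.isProbabilityMeasure
  have hum := (h.continuous ht).measurable
  have : SFinite (vol (conformal G.inner (u t))) := by
    rw [vol_conformal G h.dim (h.pos ht) hum]
    infer_instance
  refine YamabeFlow.eLpNorm_negPart_le (h.aestronglyMeasurable ht) h.memLp_zero.1
    (fun s hs => ?_) hp
  have hz := (h.memLp_negExcess ⟨le_rfl, h.time.le⟩ hs).integrable_sq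
  have e : ∫⁻ x, ENNReal.ofReal (negExcess s (S₀ x) ^ 2) ∂(vol G.inner)
      = ∫⁻ x, ENNReal.ofReal (negExcess s (S 0 x) ^ 2) ∂(vol G.inner) :=
    lintegral_congr_ae (by filter_upwards [h0] with x hx; rw [hx])
  rw [lintegral_vol_conformal h.dim (h.pos ht) hum fun x => sq_nonneg _, e,
    ← ofReal_integral_eq_lintegral_ofReal hz (ae_of_all _ fun x => sq_nonneg _),
    ← ofReal_integral_eq_lintegral_ofReal (h.integrable_negExcess_sq _ ht hs)
      (ae_of_all _ fun x => mul_nonneg (sq_nonneg _) (Real.rpow_nonneg (h.pos ht x).le _)),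
    ← ENNReal.ofReal_mul (Real.exp_pos _).le]
  refine ENNReal.ofReal_le_ofReal ((h.integral_negExcess_sq_le hs ht).trans (le_of_eq ?_))
  congr 2
  ring

end Construction

end YamabeFlow

end

/-! ### The theorem, assembled from the flow estimate. -/

theorem mainTheorem4 {n : ℕ} (hn : 3 ≤ n) {M : Type*} [TopologicalSpace M] [T2Space M]
    [SecondCountableTopology M] [ChartedSpace (YamabeFlow.Eucl n) M]
    [IsManifold (𝓡 n) ∞ M] [MeasurableSpace M] [BorelSpace M]
    (G₀ : Bundle.ContMDiffRiemannianMetric (𝓡 n) ∞ (YamabeFlow.Eucl n)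
      (fun x : M => TangentSpace (𝓡 n) x))
    (g₀ : YamabeFlow.MetricField n M) (hg₀ : g₀ = G₀.inner)
    (hvol : YamabeFlow.vol g₀ univ = 1)
    (T : ℝ) (hT : 0 < T) (u S : ℝ → M → ℝ)
    (hflow : YamabeFlow.IsNormalizedYamabeFlow g₀ T u S)
    (g : ℝ → YamabeFlow.MetricField n M) (hg : ∀ t, g t = YamabeFlow.conformal g₀ (u t))
    -- `H¹(M) = H¹(M, g)` with norms that are equivalent uniformly on `[0, T]`
    (hH1 : ∃ C : ℝ≥0, ∀ t ∈ Icc 0 T, ∀ v : M → ℝ,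
      YamabeFlow.h1Norm g₀ v ≤ C * YamabeFlow.h1Norm (g t) v ∧
      YamabeFlow.h1Norm (g t) v ≤ C * YamabeFlow.h1Norm g₀ v)
    (hdense : YamabeFlow.TestDenseInH1 g₀)
    (hS0 : YamabeFlow.ContInH1 g (Icc 0 T) S)
    (hS1 : YamabeFlow.C1InH1 g (Ioo 0 T) S)
    (hY : 0 < YamabeFlow.yamabeConstant g₀) :
    (∀ p : ℝ≥0∞, 2 ≤ p → ∀ t ∈ Icc 0 T,
      eLpNorm (YamabeFlow.negPart (S t)) p (YamabeFlow.vol (g t))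
        ≤ ENNReal.ofReal
            (Real.exp (t * n * YamabeFlow.average (g 0) (S 0) / 2 * (p⁻¹).toReal))
          * eLpNorm (YamabeFlow.negPart (YamabeFlow.scalarCurvature g₀)) p
              (YamabeFlow.vol g₀)) ∧
    (MemLp (YamabeFlow.negPart (YamabeFlow.scalarCurvature g₀)) ⊤ (YamabeFlow.vol g₀) →
      ∀ t ∈ Icc 0 T, MemLp (YamabeFlow.negPart (S t)) ⊤ (YamabeFlow.vol (g t)) ∧
        eLpNorm (YamabeFlow.negPart (S t)) ⊤ (YamabeFlow.vol (g t))
          ≤ eLpNorm (YamabeFlow.negPart (YamabeFlow.scalarCurvature g₀)) ⊤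
              (YamabeFlow.vol g₀)) ∧
    ((∀ᵐ x ∂(YamabeFlow.vol g₀), 0 ≤ YamabeFlow.scalarCurvature g₀ x) →
      ∀ t ∈ Icc 0 T, ∀ᵐ x ∂(YamabeFlow.vol (g t)), 0 ≤ S t x) := by
  subst hg₀
  obtain rfl : g = fun t => YamabeFlow.conformal G₀.inner (u t) := funext hg
  obtain ⟨C, hC⟩ := hH1
  obtain ⟨S', X, h⟩ := hflow.exists_conformalFlow hn hvol hT hC hdense hS0 hS1 hY
  have h0 := hflow.ae_eq hT
  have key := fun (p : ℝ≥0∞) (hp : 2 ≤ p) (t : ℝ) (ht : t ∈ Icc 0 T) =>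
    h.eLpNorm_negPart_le h0 ht hp
  have hm : ∀ t ∈ Icc 0 T, AEStronglyMeasurable (YamabeFlow.negPart (S t))
      (YamabeFlow.vol (YamabeFlow.conformal G₀.inner (u t))) := fun t ht => by
    rw [funext (YamabeFlow.negPart_eq_negExcess (S t))]
    exact (YamabeFlow.continuous_negExcess 0).comp_aestronglyMeasurable
      (h.aestronglyMeasurable ht)
  have key' : ∀ t ∈ Icc 0 T, eLpNorm (YamabeFlow.negPart (S t)) ⊤
      (YamabeFlow.vol (YamabeFlow.conformal G₀.inner (u t)))
      ≤ eLpNorm (YamabeFlow.negPart (YamabeFlow.scalarCurvature G₀.inner)) ⊤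
        (YamabeFlow.vol G₀.inner) := fun t ht => by
    simpa using key ⊤ le_top t ht
  refine ⟨key, fun hS t ht => ⟨⟨hm t ht, (key' t ht).trans_lt hS.2⟩, key' t ht⟩, fun hS t ht => ?_⟩
  -- Nonnegativity is the case `p = ∞` with vanishing initial norm.
  have hz : eLpNorm (YamabeFlow.negPart (YamabeFlow.scalarCurvature G₀.inner)) ⊤
      (YamabeFlow.vol G₀.inner) = 0 := by
    refine (eLpNorm_congr_ae ?_).trans eLpNorm_zero
    filter_upwards [hS] with x hx
    simp [YamabeFlow.negPart, hx]
  have := (eLpNorm_eq_zero_iff (hm t ht) ENNReal.top_ne_zero).1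
    (le_antisymm ((key' t ht).trans hz.le) zero_le)
  filter_upwards [this] with x hx
  rw [YamabeFlow.negPart, Pi.zero_apply, neg_eq_zero] at hx
  exact min_eq_right_iff.1 hx
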